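/- Let $n\ge 1$, let $G=Sp(n,1)$ be the group of quaternionic $(n+1)\times(n+1)$ matrices preserving $\sum_{j\le n}|u_j|^2-|u_{n+1}|^2$ on the right $\mathbb H$-vector space $\mathbb H^{n+1}$, and let $K=Sp(n)\times Sp(1)$ be its block-diagonal maximal compact subgroup, with normalized Haar measure $dk$. Let $H=\begin{pmatrix}0&e_1\\ {}^te_1&0\end{pmatrix}$, $a_t=\exp(tH)$, $A=\{a_t\}$, let $\alpha(H)=1$, let $N$ be the analytic subgroup with Lie algebra $\mathfrak g_\alpha+\mathfrak g_{2\alpha}$ (where $\mathfrak g_{c\alpha}=\{X\in\mathfrak g:[H,X]=cX\}$), and $\rho=2n+1$. Write $g=\kappa(g)\,a_{H(g)}\,n(g)$ with $\kappa(g)\in K$, $H(g)\in\mathbb R$, $n(g)\in N$ (Iwasawa decomposition), and $x=k_1(x)\,a_{A^+(x)}\,k_2(x)$ with $k_1(x),k_2(x)\in K$, $A^+(x)\ge 0$ (Cartan decomposition; any choice of $k_1(x),k_2(x)$ is allowed). Then $A^+(x)=d(0,xK)$ for the distance of $G/K$ induced by $\langle X,Y\rangle=\frac12\mathrm{Tr}(XY)$.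 Let $B(R)=\{A^+<R\}$, $A_0=\{A^+<1\}$, $A_j=\{2^{j-1}\le A^+<2^j\}$ for $j\ge1$, and let $dg_K$ be the invariant measure on $G/K$ normalized by $\int_{G/K} h\,dg_K=\int_K\int_0^\infty h(ka_t)\,(2\sinh t)^{4n-1}(2\cosh t)^3\,dt\,dk$. Let $\nu\ge 0$ be an integer and let $\tau_\nu$ be a (continuous) irreducible unitary representation of $Sp(1)$ on a complex Hilbert space $V_\nu$ of dimension $\nu+1$, extended to $K$ by letting $Sp(n)$ act trivially. For $\lambda\in\mathbb C$, $g\in G$, $v\in V_\nu$, $k\in K$ put $$\Phi_{\nu,\lambda}(g)=\int_K e^{-(i\lambda+\rho)H(g^{-1}k)}\,\tau_\nu\big(\kappa(g^{-1}k)k^{-1}\big)\,dk,\qquad f^g_{\lambda,v}(k)=e^{(i\lambda-\rho)H(g^{-1}k)}\,\tau_\nu\big(\kappa(g^{-1}k)\big)^{-1}v,$$ $$\mathbf c_\nu(\lambda)=\frac{2^{\rho-i\lambda}\,\Gamma(\rho-1)\,\Gamma(i\lambda)}{\Gamma\big(\frac{i\lambda+\rho+\nu}{2}\big)\,\Gamma\big(\frac{i\lambda+\rho-\nu-2}{2}\big)}.$$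 Let $B^*(G,\tau_\nu)$ be the space of (classes modulo null sets of) locally square integrable $F:G\to V_\nu$ with $F(gk)=\tau_\nu(k)^{-1}F(g)$ for $k\in K$ and $$\|F\|_{B^*}=\sup_{j\ge0}\,2^{-j/2}\Big(\int_{A_j}\|F(g)\|^2\,dg_K\Big)^{1/2}<\infty,$$ and for $F_1,F_2\in B^*(G,\tau_\nu)$ write $F_1\simeq F_2$ if $\lim_{R\to\infty}\frac1R\int_{B(R)}\|F_1(g)-F_2(g)\|^2\,dg_K=0$. Then for every real $\lambda\ne0$, every $g\in G$ and every $v\in V_\nu$, the two functions of $x\in G$ below belong to $B^*(G,\tau_\nu)$ and $$\Phi_{\nu,\lambda}(g^{-1}x)\,v\;\simeq\;\tau_\nu(k_2(x))^{-1}\sum_{s\in\{1,-1\}}\mathbf c_\nu(s\lambda)\,e^{(is\lambda-\rho)A^+(x)}\,f^g_{s\lambda,v}(k_1(x)).$$ -/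

import Mathlib

open MeasureTheory Filter Topology
open scoped Quaternion Matrix ENNReal

namespace QHyp

/-! ### The group `G = Sp(n,1)` and its subgroups `K`, `A`, `N` -/

/-- Square quaternionic matrices of size `n + 1`, acting on the left of the right `ℍ`-vector space
of columns; the last coordinate is indexed by `Sum.inr ()`. -/
abbrev QMat (n : ℕ) : Type := Matrix (Fin n ⊕ Unit) (Fin n ⊕ Unit) ℍ[ℝ]

noncomputable section

/-- The matrix of the form `∑_{j ≤ n} |u_j|² - |u_{n+1}|²`. -/
def formJ (n : ℕ) : QMat n := Matrix.fromBlocks 1 0 0 (-1)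

/-- `Sp(n,1)`, the group of invertible quaternionic matrices preserving the form. -/
def Spn1 (n : ℕ) : Subgroup (QMat n)ˣ where
  carrier := {g | (g : QMat n)ᴴ * formJ n * (g : QMat n) = formJ n}
  one_mem' := by simp
  mul_mem' := by
    intro a b ha hb
    simp only [Set.mem_ofPred_eq, Units.val_mul, Matrix.conjTranspose_mul] at ha hb ⊢
    calc (b : QMat n)ᴴ * (a : QMat n)ᴴ * formJ n * ((a : QMat n) * (b : QMat n))
        = (b : QMat n)ᴴ * ((a : QMat n)ᴴ * formJ n * (a : QMat n)) * (b : QMat n) := by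
          simp only [mul_assoc]
      _ = formJ n := by rw [ha, hb]
  inv_mem' := by
    intro a ha
    simp only [Set.mem_ofPred_eq] at ha ⊢
    have h1 : (a : QMat n) * ((a⁻¹ : (QMat n)ˣ) : QMat n) = 1 := a.mul_inv
    have h2 : ((a⁻¹ : (QMat n)ˣ) : QMat n)ᴴ * (a : QMat n)ᴴ = 1 := by
      rw [← Matrix.conjTranspose_mul, h1, Matrix.conjTranspose_one]
    calc ((a⁻¹ : (QMat n)ˣ) : QMat n)ᴴ * formJ n * ((a⁻¹ : (QMat n)ˣ) : QMat n)
        = ((a⁻¹ : (QMat n)ˣ) : QMat n)ᴴ * ((a : QMat n)ᴴ * formJ n * (a : QMat n))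
            * ((a⁻¹ : (QMat n)ˣ) : QMat n) := by rw [ha]
      _ = (((a⁻¹ : (QMat n)ˣ) : QMat n)ᴴ * (a : QMat n)ᴴ) * formJ n
            * ((a : QMat n) * ((a⁻¹ : (QMat n)ˣ) : QMat n)) := by simp only [mul_assoc]
      _ = formJ n := by rw [h1, h2, one_mul, mul_one]

/-- `Sp(1)`, the group of unit quaternions. -/
abbrev Sp1 : Type := unitary ℍ[ℝ]

/-- `K = Sp(n) × Sp(1)`. -/
def KGroup (n : ℕ) : Type := unitary (Matrix (Fin n) (Fin n) ℍ[ℝ]) × Sp1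

instance (n : ℕ) : Group (KGroup n) :=
  inferInstanceAs (Group (unitary (Matrix (Fin n) (Fin n) ℍ[ℝ]) × Sp1))

instance (n : ℕ) : TopologicalSpace (KGroup n) :=
  inferInstanceAs (TopologicalSpace (unitary (Matrix (Fin n) (Fin n) ℍ[ℝ]) × Sp1))

instance (n : ℕ) : IsTopologicalGroup (KGroup n) :=
  inferInstanceAs (IsTopologicalGroup (unitary (Matrix (Fin n) (Fin n) ℍ[ℝ]) × Sp1))

instance (n : ℕ) : MeasurableSpace (KGroup n) := borel _

instance (n : ℕ) : BorelSpace (KGroup n) := ⟨rfl⟩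

instance (n : ℕ) : MeasurableSpace (Spn1 n) := borel _

instance (n : ℕ) : BorelSpace (Spn1 n) := ⟨rfl⟩

theorem isCompact_unitary_matrix (n : ℕ) :
    IsCompact ((unitary (Matrix (Fin n) (Fin n) ℍ[ℝ]) : Submonoid _) :
      Set (Matrix (Fin n) (Fin n) ℍ[ℝ])) := by
  have hc : IsCompact (Set.pi Set.univ fun _ : Fin n => Set.pi Set.univ fun _ : Fin n =>
      Metric.closedBall (0 : ℍ[ℝ]) 1) :=
    isCompact_univ_pi fun _ => isCompact_univ_pi fun _ => isCompact_closedBall _ _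
  refine IsCompact.of_isClosed_subset hc ?_ ?_
  · have : ((unitary (Matrix (Fin n) (Fin n) ℍ[ℝ]) : Submonoid _) :
        Set (Matrix (Fin n) (Fin n) ℍ[ℝ])) = {U | star U * U = 1} ∩ {U | U * star U = 1} := by
      ext U; simp [Unitary.mem_iff]
    rw [this]
    exact (isClosed_eq (by fun_prop) (by fun_prop)).inter
      (isClosed_eq (by fun_prop) (by fun_prop))
  · intro U hU i _ j _
    have h := congrFun (congrFun (Unitary.mem_iff.1 hU).2 i) i
    have h2 := congrArg QuaternionAlgebra.re h
    simp only [Matrix.star_eq_conjTranspose, Matrix.mul_apply, Matrix.conjTranspose_apply,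
      Matrix.one_apply_eq] at h2
    have h3 : ∑ k, ‖U i k‖ ^ 2 = 1 := by
      have : ∀ q : ℍ[ℝ], q * star q = ((‖q‖ ^ 2 : ℝ) : ℍ[ℝ]) := by
        intro q
        rw [Quaternion.self_mul_star, Quaternion.normSq_eq_norm_mul_self, sq]
      simp only [this] at h2
      have h5 : ∀ s : Finset (Fin n), (∑ k ∈ s, ((‖U i k‖ ^ 2 : ℝ) : ℍ[ℝ])) =
          ((∑ k ∈ s, ‖U i k‖ ^ 2 : ℝ) : ℍ[ℝ]) := fun s =>
        (map_sum (algebraMap ℝ ℍ[ℝ]) (fun k => ‖U i k‖ ^ 2) s).symm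
      rw [h5] at h2
      simpa using h2
    have h4 : ‖U i j‖ ^ 2 ≤ 1 := h3 ▸
      Finset.single_le_sum (f := fun k => ‖U i k‖ ^ 2) (fun _ _ => sq_nonneg _) (Finset.mem_univ j)
    simpa using (sq_le_one_iff₀ (norm_nonneg _)).1 h4

theorem isCompact_Sp1 : IsCompact ((unitary ℍ[ℝ] : Submonoid _) : Set ℍ[ℝ]) := by
  refine IsCompact.of_isClosed_subset (isCompact_closedBall (0 : ℍ[ℝ]) 1) ?_ ?_
  · have : ((unitary ℍ[ℝ] : Submonoid _) : Set ℍ[ℝ]) =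
        {U | star U * U = 1} ∩ {U | U * star U = 1} := by
      ext U; simp [Unitary.mem_iff]
    rw [this]
    exact (isClosed_eq (by fun_prop) (by fun_prop)).inter
      (isClosed_eq (by fun_prop) (by fun_prop))
  · intro q hq
    have := CStarRing.norm_of_mem_unitary hq
    simp [this]

instance (n : ℕ) : CompactSpace (KGroup n) :=
  haveI := isCompact_iff_compactSpace.1 (isCompact_unitary_matrix n)
  haveI := isCompact_iff_compactSpace.1 isCompact_Sp1
  inferInstanceAs (CompactSpace (unitary (Matrix (Fin n) (Fin n) ℍ[ℝ]) × Sp1))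

/-- The matrix `diag(u, q)` of `k = (u, q) ∈ K`. -/
def kMat {n : ℕ} (k : KGroup n) : QMat n :=
  Matrix.fromBlocks (k.1 : Matrix (Fin n) (Fin n) ℍ[ℝ]) 0 0
    (Matrix.diagonal fun _ => (k.2 : ℍ[ℝ]))

theorem kMat_mul {n : ℕ} (k l : KGroup n) : kMat (k * l) = kMat k * kMat l := by
  have h1 : ((k * l).1 : Matrix (Fin n) (Fin n) ℍ[ℝ]) = k.1 * l.1 := rfl
  have h2 : ((k * l).2 : ℍ[ℝ]) = k.2 * l.2 := rfl
  simp [kMat, Matrix.fromBlocks_multiply, h1, h2]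

theorem kMat_one {n : ℕ} : kMat (1 : KGroup n) = 1 := by
  have h1 : ((1 : KGroup n).1 : Matrix (Fin n) (Fin n) ℍ[ℝ]) = 1 := rfl
  have h2 : ((1 : KGroup n).2 : ℍ[ℝ]) = 1 := rfl
  simp [kMat, h1, h2]

/-- The inclusion of `K` in `G`. -/
def ofK {n : ℕ} : KGroup n →* Spn1 n where
  toFun k := ⟨⟨kMat k, kMat k⁻¹, by rw [← kMat_mul, mul_inv_cancel, kMat_one],
      by rw [← kMat_mul, inv_mul_cancel, kMat_one]⟩, by
    have h1 : (k.1 : Matrix (Fin n) (Fin n) ℍ[ℝ])ᴴ * k.1 = 1 := (Unitary.mem_iff.1 k.1.2).1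
    have h2 : star (k.2 : ℍ[ℝ]) * k.2 = 1 := (Unitary.mem_iff.1 k.2.2).1
    change (kMat k)ᴴ * formJ n * kMat k = formJ n
    simp [kMat, formJ, Matrix.fromBlocks_conjTranspose, Matrix.fromBlocks_multiply, h1,
      Matrix.diagonal_conjTranspose, Pi.star_def, h2]
    exact Matrix.ext fun i j => by simp⟩
  map_one' := by
    apply Subtype.ext; apply Units.ext; exact kMat_one
  map_mul' k l := by
    apply Subtype.ext; apply Units.ext; exact kMat_mul k l

/-- The matrix `H = (0 e₁; ᵗe₁ 0)`, which spans the Cartan subspace `𝔞`. -/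
def matH (n : ℕ) [NeZero n] : QMat n :=
  Matrix.fromBlocks 0 (Matrix.of fun i _ => if i = 0 then 1 else 0)
    (Matrix.of fun _ j => if j = 0 then 1 else 0) 0

/-- The matrix of `a_t = exp (t H)`. -/
def aMat (n : ℕ) [NeZero n] (t : ℝ) : QMat n :=
  Matrix.fromBlocks (Matrix.diagonal fun i => if i = 0 then ((Real.cosh t : ℝ) : ℍ[ℝ]) else 1)
    (Matrix.of fun i _ => if i = 0 then ((Real.sinh t : ℝ) : ℍ[ℝ]) else 0)
    (Matrix.of fun _ j => if j = 0 then ((Real.sinh t : ℝ) : ℍ[ℝ]) else 0)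
    (Matrix.diagonal fun _ => ((Real.cosh t : ℝ) : ℍ[ℝ]))

theorem aMat_mul (n : ℕ) [NeZero n] (s t : ℝ) : aMat n s * aMat n t = aMat n (s + t) := by
  unfold aMat
  rw [Matrix.fromBlocks_multiply]
  congr 1
  · ext1 i j
    by_cases hi : i = 0 <;> by_cases hj : j = 0 <;> by_cases hij : i = j <;>
      simp_all [Matrix.mul_apply, Matrix.diagonal, Real.cosh_add]
  · ext1 i j
    by_cases hi : i = 0 <;>
      simp_all [Matrix.mul_apply, Matrix.diagonal, Real.sinh_add, add_comm]
  · ext1 i j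
    by_cases hj : j = 0 <;>
      simp_all [Matrix.mul_apply, Matrix.diagonal, Real.sinh_add]
  · ext1 i j
    simp [Matrix.mul_apply, Matrix.diagonal, Real.cosh_add, add_comm]

theorem aMat_zero (n : ℕ) [NeZero n] : aMat n 0 = 1 := by
  ext1 i j
  rcases i with i | i <;> rcases j with j | j <;>
    simp [aMat, Matrix.diagonal, Matrix.one_apply]

theorem aMat_conjTranspose (n : ℕ) [NeZero n] (t : ℝ) : (aMat n t)ᴴ = aMat n t := by
  ext1 i j
  rcases i with i | i <;> rcases j with j | j <;>
    simp [aMat, Matrix.diagonal, apply_ite star]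
  · by_cases h : i = j <;> simp_all [eq_comm]

theorem formJ_mul_aMat (n : ℕ) [NeZero n] (t : ℝ) :
    formJ n * aMat n t = aMat n (-t) * formJ n := by
  unfold aMat formJ
  rw [Matrix.fromBlocks_multiply, Matrix.fromBlocks_multiply]
  congr 1 <;> ext1 i j <;> simp
  · split_ifs <;> simp
  · split_ifs <;> simp

/-- The element `a_t` of `A ⊆ G`. -/
def aElt (n : ℕ) [NeZero n] (t : ℝ) : Spn1 n :=
  ⟨⟨aMat n t, aMat n (-t), by rw [aMat_mul, add_neg_cancel, aMat_zero],
    by rw [aMat_mul, neg_add_cancel, aMat_zero]⟩, by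
    change (aMat n t)ᴴ * formJ n * aMat n t = formJ n
    rw [aMat_conjTranspose, mul_assoc, formJ_mul_aMat, ← mul_assoc, aMat_mul, add_neg_cancel,
      aMat_zero, one_mul]⟩

/-- The root space `𝔤_{cα} = {X ∈ 𝔤 : [H, X] = c X}`, where `𝔤 = {X : X* J + J X = 0}` is the Lie
algebra of `Sp(n,1)` and `α(H) = 1`. -/
def rootSpace (n : ℕ) [NeZero n] (c : ℝ) : Set (QMat n) :=
  {X | Xᴴ * formJ n + formJ n * X = 0 ∧ matH n * X - X * matH n = c • X}

/-- `N`, the analytic subgroup of `G` with Lie algebra `𝔫 = 𝔤_α + 𝔤_{2α}`, that is, the subgroup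
generated by the exponentials of the elements of `𝔫`. -/
def NGroup (n : ℕ) [NeZero n] : Subgroup (Spn1 n) :=
  Subgroup.closure {g | ∃ X ∈ rootSpace n 1, ∃ Y ∈ rootSpace n 2,
    ((g : (QMat n)ˣ) : QMat n) = NormedSpace.exp (X + Y)}

/-! ### Iwasawa and Cartan projections -/

/-- `κ(g) ∈ K` in the Iwasawa decomposition `g = κ(g) e^{H(g)} n`, `n ∈ N`. -/
def iwasawaK {n : ℕ} [NeZero n] (g : Spn1 n) : KGroup n :=
  Classical.epsilon fun k => ∃ t : ℝ, ∃ u ∈ NGroup n, g = ofK k * aElt n t * u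

/-- `H(g) ∈ ℝ ≃ 𝔞` in the Iwasawa decomposition `g = κ(g) e^{H(g)} n`, `n ∈ N`. -/
def iwasawaH {n : ℕ} [NeZero n] (g : Spn1 n) : ℝ :=
  Classical.epsilon fun t => ∃ k : KGroup n, ∃ u ∈ NGroup n, g = ofK k * aElt n t * u

/-- `A⁺(g) ≥ 0` in the Cartan decomposition `g = k₁ e^{A⁺(g)} k₂`. For the distance `d` on `G/K`
induced by `⟨X, Y⟩ = ½ Tr (XY)` on `𝔭`, for which `|tH| = |t|`, it equals `d(0, gK)`. -/
def cartanA {n : ℕ} [NeZero n] (g : Spn1 n) : ℝ :=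
  Classical.epsilon fun t => 0 ≤ t ∧ ∃ k₁ k₂ : KGroup n, g = ofK k₁ * aElt n t * ofK k₂

/-! ### Measures -/

/-- The normalized Haar measure `dk` of the compact group `K`. -/
def haarK (n : ℕ) : Measure (KGroup n) := Measure.haarMeasure ⊤

/-- The density `Δ(t) = (2 sinh t)^{4n-1} (2 cosh t)^3`. -/
def weight (n : ℕ) (t : ℝ) : ℝ := (2 * Real.sinh t) ^ (4 * n - 1) * (2 * Real.cosh t) ^ 3

/-- The Haar measure `dg` of `G`, normalized by
`∫_G h(g) dg = ∫_K ∫_0^∞ ∫_K h(k a_t k') Δ(t) dk dt dk'`. For right `K`-invariant functions `h`,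
regarded as functions on `G/K`, integration against it is the integration
`∫_{G/K} h(gK) dg_K = ∫_K ∫_0^∞ h(k a_t) Δ(t) dk dt` against the invariant measure of `G/K`. -/
def haarG (n : ℕ) [NeZero n] : Measure (Spn1 n) :=
  Measure.map (fun p : KGroup n × ℝ × KGroup n => ofK p.1 * aElt n p.2.1 * ofK p.2.2)
    ((haarK n).prod
      (((volume.restrict (Set.Ioi (0 : ℝ))).withDensity fun t => ENNReal.ofReal (weight n t)).prod
        (haarK n)))

/-- The preimage in `G` of the open ball `B(R)` of `G/K` about the origin. -/
def ball (n : ℕ) [NeZero n] (R : ℝ) : Set (Spn1 n) := {g | cartanA g < R}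

/-- The dyadic shells: `A_0 = {d(0, g.0) < 1}`, `A_j = {2^{j-1} ≤ d(0, g.0) < 2^j}`, `j ≥ 1`. -/
def shell (n : ℕ) [NeZero n] (j : ℕ) : Set (Spn1 n) :=
  if j = 0 then ball n 1 else {g | (2 : ℝ) ^ (j - 1) ≤ cartanA g ∧ cartanA g < (2 : ℝ) ^ j}

/-! ### The bundle, the spherical function, and the function spaces -/

/-- A continuous irreducible unitary representation `τ_ν` of `Sp(1)` on a Hilbert space of dimension
`ν + 1`. -/
structure IsTau {V : Type*} [NormedAddCommGroup V] [InnerProductSpace ℂ V] (ν : ℕ)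
    (τ : Representation ℂ Sp1 V) : Prop where
  finrank_eq : Module.finrank ℂ V = ν + 1
  irreducible : τ.IsIrreducible
  norm_map : ∀ q v, ‖τ q v‖ = ‖v‖
  continuous_map : ∀ v, Continuous fun q => τ q v

section Bundle

variable {V : Type*} [NormedAddCommGroup V] [InnerProductSpace ℂ V]

/-- The extension of `τ_ν` to `K = Sp(n) × Sp(1)`, trivial on `Sp(n)`. -/
def extK (n : ℕ) (τ : Representation ℂ Sp1 V) : Representation ℂ (KGroup n) V :=
  τ.comp (MonoidHom.snd (unitary (Matrix (Fin n) (Fin n) ℍ[ℝ])) Sp1)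

/-- `ρ = 2n + 1`. -/
def rho (n : ℕ) : ℂ := 2 * n + 1

/-- `Φ_{ν,λ}(g) v = ∫_K e^{-(iλ+ρ) H(g⁻¹k)} τ_ν(κ(g⁻¹k) k⁻¹) v dk`, where `Φ_{ν,λ}` is the
`τ_ν`-spherical function. -/
def sphericalFn {n : ℕ} [NeZero n] (τ : Representation ℂ Sp1 V) (lam : ℂ) (g : Spn1 n) (v : V) :
    V :=
  ∫ k, Complex.exp (-(Complex.I * lam + rho n) * iwasawaH (g⁻¹ * ofK k)) •
    extK n τ (iwasawaK (g⁻¹ * ofK k) * k⁻¹) v ∂(haarK n)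

/-- `f^g_{λ,v}(k) = e^{(iλ-ρ) H(g⁻¹k)} τ_ν(κ(g⁻¹k))⁻¹ v`. -/
def fgv {n : ℕ} [NeZero n] (τ : Representation ℂ Sp1 V) (lam : ℂ) (g : Spn1 n) (v : V)
    (k : KGroup n) : V :=
  Complex.exp ((Complex.I * lam - rho n) * iwasawaH (g⁻¹ * ofK k)) •
    extK n τ (iwasawaK (g⁻¹ * ofK k))⁻¹ v

/-- The function
`c_ν(λ) = 2^{ρ-iλ} Γ(ρ-1) Γ(iλ) / (Γ((iλ+ρ+ν)/2) Γ((iλ+ρ-ν-2)/2))`. -/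
def cFn (n ν : ℕ) (lam : ℂ) : ℂ :=
  (2 : ℂ) ^ (rho n - Complex.I * lam) * Complex.Gamma (rho n - 1) * Complex.Gamma (Complex.I * lam)
    / (Complex.Gamma ((Complex.I * lam + rho n + ν) / 2)
      * Complex.Gamma ((Complex.I * lam + rho n - ν - 2) / 2))

/-- `L²_loc(G, τ_ν)`: functions on `G`, considered up to null sets, that are right `K`-covariant of
type `τ_ν` and square integrable over balls. -/
structure MemL2loc {n : ℕ} [NeZero n] (τ : Representation ℂ Sp1 V) (F : Spn1 n → V) : Prop where
  covariant : ∀ᵐ g ∂(haarG n), ∀ k : KGroup n, F (g * ofK k) = extK n τ k⁻¹ (F g)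
  memLp : ∀ R : ℝ, MemLp F 2 ((haarG n).restrict (ball n R))

/-- The norm `sup_j 2^{-j/2} (∫_{A_j} ‖F(g)‖² dg_K)^{1/2}`. -/
def bStarNorm {n : ℕ} [NeZero n] (F : Spn1 n → V) : ℝ≥0∞ :=
  ⨆ j : ℕ, ENNReal.ofReal ((2 : ℝ) ^ (-(j : ℝ) / 2)) *
    (∫⁻ g in shell n j, ‖F g‖ₑ ^ 2 ∂(haarG n)) ^ (1 / 2 : ℝ)

/-- Membership in the space `B*(G, τ_ν)`. -/
def MemBStar {n : ℕ} [NeZero n] (τ : Representation ℂ Sp1 V) (F : Spn1 n → V) : Prop :=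
  MemL2loc τ F ∧ bStarNorm F < ∞

/-- The relation `F₁ ≃ F₂`: `lim_{R → ∞} R⁻¹ ∫_{B(R)} ‖F₁(g) - F₂(g)‖² dg_K = 0`. -/
def AsympEq {n : ℕ} [NeZero n] (F₁ F₂ : Spn1 n → V) : Prop :=
  Tendsto (fun R : ℝ => ENNReal.ofReal (1 / R) *
    ∫⁻ g in ball n R, ‖F₁ g - F₂ g‖ₑ ^ 2 ∂(haarG n)) atTop (𝓝 0)

end Bundle

end

end QHyp

/-!
The theorem compares two functions of `x ∈ G`, and the proof evaluates both in terms of two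
quaternions. The Iwasawa data of `g` are read off the action on the isotropic vector `ξ = e₁ +
e_{n+1}`, which `N` fixes and `A` scales: the last coordinate of `g ξ`, called `nullEntry g`,
equals `e^{H(g)}` times the `Sp(1)`-component of `κ(g)`. The Cartan projection is read off the
entry `cornerEntry x = x_{n+1,n+1}`, whose norm is `cosh A⁺(x)`.

*The spherical function is hypergeometric.* With `Y = cornerEntry y`, `Φ(y) = |Y|^{-(iλ+ρ)} F(a,
b; 2n; 1 - |Y|^{-2}) τ(Y / |Y|)⁻¹`, where `a = (iλ + ρ + ν) / 2` and `b = (iλ + ρ - ν - 2) / 2`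
(`IsTau.sphericalFn_eq`). For `y = k₁ a_s k₂` the defining integral becomes the average over `(u,
q) ∈ K` of `|1 - r w|^{-(iλ+ρ)} τ(sgn (1 - r w))` with `r = tanh s` and `w = u₀₀ q⁻¹`.
* Over `Sp(1)` such an average is a scalar by Schur's lemma. The scalar follows from Weyl's
  integration formula (`weyl_integration`) and Weyl's character formula (`IsTau.sin_mul_tauChar`):
  it is a Fourier coefficient of a product of two binomial series, equal to `F(a, b; 2; r²)`
  (`IsTau.integral_radTau`). The character formula is obtained from the integrality of weight
  multiplicities together with Schur orthogonality, which leave a single pair of frequencies in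
  `sin θ χ(e^{iθ})`.
* The remaining average is over `|u₀₀|²`, whose `m`-th moment is `(2)_m / (2n)_m`
  (`moment_firstCol_succ`), a consequence of the invariance of Haar measure under reflections. It
  turns the parameter `2` into `2n` (`IsTau.integral_radTau_cornerRatio`).

*The connection formula.* As `z → 1`, `F(a, b; c; z)` with `a + b = c + iλ` is asymptotic to the
sum of a multiple of `(1 - z)^{-iλ}` and a constant (`tendsto_hypF_one`). The first coefficient
comes from the product formula for the Gamma function, by which the Taylor coefficients of `F` are
close to those of a binomial series; the constant is then identified by Euler's transformation,
which exchanges the two terms. The coefficients are `2^{iλ-ρ} c_ν(λ)` and `2^{-iλ-ρ} c_ν(-λ)`.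

*Comparison.* For `x = k₁ a_t k₂` the corner entry of `g⁻¹ x` is `(e^t / 2) (P + e^{-2t} P') q₂`,
where `q₂` is the `Sp(1)`-component of `k₂` and `P = nullEntry (g⁻¹ k₁)`. The same two-term
expression (`leadingTerm`) evaluated at the corner entry is the principal part of `Φ(g⁻¹ x) v`,
and evaluated at `(e^t / 2) P q₂` it is the right-hand side of the theorem
(`extK_sum_eq_leadingTerm`). By compactness of `[0, 1] × K` the two values differ by `o(e^{-ρt})`
uniformly in `k₁`, `k₂` (`IsTau.exists_radTau_sub_le`). Since the invariant measure has radial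
density at most `8 e^{2ρt}`, a bound `O(e^{-ρt})` gives membership in `B*` (`memBStar_of_bound`),
and an `o(e^{-ρt})` bound on the difference gives `≃` (`asympEq_of_bound`). The right-hand side is
measurable and `τ`-covariant for any choice of `k₁`, `k₂`, because off the null set `A⁺(x) = 0`
the product `P q₂` is a continuous function of `x` alone (`boundaryEntry`).
-/

namespace QHyp

/-! ### Matrices in `Sp(n,1)` and their last column -/

/-- The matrix of an element of `Sp(n,1)`. -/
abbrev toMat {n : ℕ} (g : Spn1 n) : QMat n := ((g : (QMat n)ˣ) : QMat n)

/-- The last diagonal entry `g_{n+1,n+1}`. -/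
noncomputable def cornerEntry {n : ℕ} (g : Spn1 n) : ℍ[ℝ] := toMat g (Sum.inr ()) (Sum.inr ())

section Geometry

variable {n : ℕ}

theorem toMat_mul (g h : Spn1 n) : toMat (g * h) = toMat g * toMat h := rfl

theorem toMat_one : toMat (1 : Spn1 n) = 1 := rfl

theorem toMat_injective : Function.Injective (toMat : Spn1 n → QMat n) :=
  fun _ _ h => Subtype.ext (Units.ext h)

theorem toMat_form (g : Spn1 n) : (toMat g)ᴴ * formJ n * toMat g = formJ n := g.2

theorem formJ_mul_self : formJ n * formJ n = 1 := by
  simp [formJ, Matrix.fromBlocks_multiply]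

theorem formJ_conjTranspose : (formJ n)ᴴ = formJ n := by
  simp [formJ, Matrix.fromBlocks_conjTranspose]

theorem toMat_inv (g : Spn1 n) : toMat g⁻¹ = formJ n * (toMat g)ᴴ * formJ n := by
  have h1 : formJ n * (toMat g)ᴴ * formJ n * toMat g = 1 := by
    rw [mul_assoc, mul_assoc, ← mul_assoc _ (formJ n) (toMat g), toMat_form, formJ_mul_self]
  have h2 : toMat g * toMat g⁻¹ = 1 := by rw [← toMat_mul, mul_inv_cancel, toMat_one]
  calc toMat g⁻¹ = (formJ n * (toMat g)ᴴ * formJ n * toMat g) * toMat g⁻¹ := by rw [h1, one_mul]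
    _ = _ := by rw [mul_assoc, h2, mul_one]

theorem toMat_form' (g : Spn1 n) : toMat g * formJ n * (toMat g)ᴴ = formJ n := by
  have h2 : toMat g * toMat g⁻¹ = 1 := by rw [← toMat_mul, mul_inv_cancel, toMat_one]
  rw [toMat_inv] at h2
  have := congrArg (· * formJ n) h2
  simpa [mul_assoc, formJ_mul_self] using this

theorem toMat_ofK (k : KGroup n) : toMat (ofK k) = kMat k := rfl

theorem toMat_aElt [NeZero n] (t : ℝ) : toMat (aElt n t) = aMat n t := rfl

theorem aElt_mul [NeZero n] (s t : ℝ) : aElt n s * aElt n t = aElt n (s + t) :=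
  toMat_injective (aMat_mul n s t)

theorem aElt_zero [NeZero n] : aElt n 0 = 1 := toMat_injective (aMat_zero n)

theorem aElt_neg [NeZero n] (t : ℝ) : aElt n (-t) = (aElt n t)⁻¹ := by
  rw [eq_inv_iff_mul_eq_one, aElt_mul, neg_add_cancel, aElt_zero]

theorem star_mul_self_real (q : ℍ[ℝ]) : star q * q = ((‖q‖ ^ 2 : ℝ) : ℍ[ℝ]) := by
  rw [Quaternion.star_mul_self, Quaternion.normSq_eq_norm_mul_self, sq]

theorem mul_star_self_real (q : ℍ[ℝ]) : q * star q = ((‖q‖ ^ 2 : ℝ) : ℍ[ℝ]) := by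
  rw [Quaternion.self_mul_star, Quaternion.normSq_eq_norm_mul_self, sq]

theorem sum_coe_quaternion {ι : Type*} (s : Finset ι) (f : ι → ℝ) :
    (∑ i ∈ s, (f i : ℍ[ℝ])) = ((∑ i ∈ s, f i : ℝ) : ℍ[ℝ]) :=
  (map_sum (algebraMap ℝ ℍ[ℝ]) f s).symm

/-- The columns of `g ∈ Sp(n,1)` are pseudo-orthonormal: the last one. -/
theorem norm_lastCol (g : Spn1 n) :
    ∑ i, ‖toMat g (Sum.inl i) (Sum.inr ())‖ ^ 2 + 1 = ‖cornerEntry g‖ ^ 2 := by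
  have h := congrFun (congrFun (toMat_form g) (Sum.inr ())) (Sum.inr ())
  have h2 : ((∑ i, ‖toMat g (Sum.inl i) (Sum.inr ())‖ ^ 2 : ℝ) : ℍ[ℝ])
      - ((‖cornerEntry g‖ ^ 2 : ℝ) : ℍ[ℝ]) = -1 := by
    simp only [Matrix.mul_apply, formJ, Fintype.sum_sum_type, Matrix.fromBlocks_apply₁₁,
      Matrix.fromBlocks_apply₁₂, Matrix.fromBlocks_apply₂₁, Matrix.fromBlocks_apply₂₂,
      Matrix.conjTranspose_apply, Matrix.one_apply] at h
    simp at h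
    rw [← sum_coe_quaternion, ← star_mul_self_real, cornerEntry]
    simp only [← star_mul_self_real]
    rw [sub_eq_add_neg]
    exact h
  have h3 : ∑ i, ‖toMat g (Sum.inl i) (Sum.inr ())‖ ^ 2 - ‖cornerEntry g‖ ^ 2 = -1 := by
    apply Quaternion.coe_injective
    rw [Quaternion.coe_sub, h2, Quaternion.coe_neg, Quaternion.coe_one]
  linarith

theorem one_le_norm_cornerEntry (g : Spn1 n) : 1 ≤ ‖cornerEntry g‖ := by
  have h := norm_lastCol g
  have h1 : 0 ≤ ∑ i, ‖toMat g (Sum.inl i) (Sum.inr ())‖ ^ 2 :=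
    Finset.sum_nonneg fun _ _ => by positivity
  nlinarith [norm_nonneg (cornerEntry g)]

theorem cornerEntry_ne_zero (g : Spn1 n) : cornerEntry g ≠ 0 := by
  intro h
  have := one_le_norm_cornerEntry g
  rw [h, norm_zero] at this
  linarith

/-- An element of `Sp(n,1)` whose last column is supported in the last coordinate lies in `K`. -/
theorem exists_ofK_of_lastCol (g : Spn1 n) (hg : ∀ i, toMat g (Sum.inl i) (Sum.inr ()) = 0) :
    ∃ k : KGroup n, g = ofK k := by
  have hq : ‖cornerEntry g‖ = 1 := by
    have h := norm_lastCol g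
    simp only [hg, norm_zero] at h
    have h' : ‖cornerEntry g‖ ^ 2 = 1 := by rw [← h]; simp
    exact (pow_eq_one_iff_of_nonneg (norm_nonneg _) two_ne_zero).1 h'
  have hqm : cornerEntry g ∈ unitary ℍ[ℝ] := by
    rw [Unitary.mem_iff, star_mul_self_real, mul_star_self_real, hq]; simp
  have hrow : ∀ j, toMat g (Sum.inr ()) (Sum.inl j) = 0 := by
    intro j
    have h := congrFun (congrFun (toMat_form g) (Sum.inr ())) (Sum.inl j)
    simp only [Matrix.mul_apply, formJ, Fintype.sum_sum_type, Matrix.fromBlocks_apply₁₁,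
      Matrix.fromBlocks_apply₁₂, Matrix.fromBlocks_apply₂₁, Matrix.fromBlocks_apply₂₂,
      Matrix.conjTranspose_apply, Matrix.one_apply, hg] at h
    simp at h
    rcases h with h | h
    · exact absurd h (cornerEntry_ne_zero g)
    · exact h
  have hblock : toMat g = Matrix.fromBlocks (Matrix.of fun i j => toMat g (Sum.inl i) (Sum.inl j))
      0 0 (Matrix.diagonal fun _ => cornerEntry g) := by
    ext1 i j
    rcases i with i | ⟨⟩ <;> rcases j with j | ⟨⟩ <;> simp [hg, hrow, cornerEntry]
  set u : Matrix (Fin n) (Fin n) ℍ[ℝ] := Matrix.of fun i j => toMat g (Sum.inl i) (Sum.inl j)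
  have hu1 : uᴴ * u = 1 := by
    have h := toMat_form g
    rw [hblock, formJ, Matrix.fromBlocks_conjTranspose, Matrix.fromBlocks_multiply,
      Matrix.fromBlocks_multiply] at h
    have := (Matrix.fromBlocks_inj.1 h).1
    simpa using this
  have hu2 : u * uᴴ = 1 := by
    have h := toMat_form' g
    rw [hblock, formJ, Matrix.fromBlocks_conjTranspose, Matrix.fromBlocks_multiply,
      Matrix.fromBlocks_multiply] at h
    have := (Matrix.fromBlocks_inj.1 h).1
    simpa using this
  exact ⟨(⟨u, Unitary.mem_iff.2 ⟨hu1, hu2⟩⟩, ⟨cornerEntry g, hqm⟩), toMat_injective hblock⟩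

end Geometry

/-! ### The Iwasawa decomposition -/

section Iwasawa

variable {n : ℕ}

theorem exp_of_pow_three_eq_zero (Z : QMat n) (hZ : Z * Z * Z = 0) :
    NormedSpace.exp Z = 1 + Z + (2⁻¹ : ℝ) • (Z * Z) := by
  rw [NormedSpace.exp_eq_tsum ℝ]
  have h0 : ∀ k ∉ Finset.range 3, ((k.factorial : ℝ)⁻¹ • Z ^ k) = 0 := by
    intro k hk
    have hk : 3 ≤ k := by simpa using hk
    obtain ⟨m, rfl⟩ := Nat.exists_eq_add_of_le hk
    rw [pow_add, pow_succ, pow_two, hZ, zero_mul, smul_zero]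
  change (∑' k : ℕ, ((k.factorial : ℝ)⁻¹ • Z ^ k)) = _
  rw [tsum_eq_sum h0]
  simp [Finset.sum_range_succ, pow_two, Nat.factorial]

theorem conjTranspose_real_smul {m p : Type*} (r : ℝ) (M : Matrix m p ℍ[ℝ]) :
    (r • M)ᴴ = r • Mᴴ := by
  ext1 i j; simp [Matrix.conjTranspose_apply]

/-- The element `exp Z` of `Sp(n,1)` for `Z` in its Lie algebra with `Z³ = 0`. -/
theorem exists_expUnipotent (Z : QMat n) (hJ : Zᴴ * formJ n + formJ n * Z = 0)
    (hZ : Z * Z * Z = 0) :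
    ∃ g : Spn1 n, toMat g = 1 + Z + (2⁻¹ : ℝ) • (Z * Z) := by
  have hmul : ∀ W : QMat n, W * W * W = 0 →
      (1 + W + (2⁻¹ : ℝ) • (W * W)) * (1 + -W + (2⁻¹ : ℝ) • (-W * -W)) = 1 := by
    intro W hW
    have hW4 : W * W * (W * W) = 0 := by rw [← mul_assoc, hW, zero_mul]
    have hW' : W * (W * W) = 0 := by rw [← mul_assoc, hW]
    simp only [mul_add, add_mul, one_mul, mul_one, neg_mul, mul_neg, neg_neg, smul_mul_assoc,
      mul_smul_comm, hW4, hW, hW', smul_zero]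
    module
  have hneg : ∀ W : QMat n, W * W * W = 0 → -W * -W * -W = 0 := by
    intro W hW; simp [hW]
  have h2 := hmul (-Z) (hneg Z hZ)
  rw [neg_neg] at h2
  refine ⟨⟨⟨_, _, hmul Z hZ, h2⟩, ?_⟩, rfl⟩
  change (1 + Z + (2⁻¹ : ℝ) • (Z * Z))ᴴ * formJ n * (1 + Z + (2⁻¹ : ℝ) • (Z * Z)) = formJ n
  have hJ1 : Zᴴ * formJ n = formJ n * -Z := by
    rw [mul_neg]; exact eq_neg_of_add_eq_zero_left hJ
  have hJ2 : Zᴴ * Zᴴ * formJ n = formJ n * (-Z * -Z) := by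
    rw [mul_assoc, hJ1, ← mul_assoc, hJ1, mul_assoc]
  have : (1 + Z + (2⁻¹ : ℝ) • (Z * Z))ᴴ * formJ n
      = formJ n * (1 + -Z + (2⁻¹ : ℝ) • (-Z * -Z)) := by
    rw [Matrix.conjTranspose_add, Matrix.conjTranspose_add, conjTranspose_real_smul,
      Matrix.conjTranspose_mul, Matrix.conjTranspose_one, add_mul, add_mul, one_mul, mul_add,
      mul_add, mul_one, hJ1, smul_mul_assoc, hJ2, mul_smul_comm]
  rw [this, mul_assoc, h2, mul_one]

variable [NeZero n]

/-- The isotropic vector `e₁ + e_{n+1}`, as a column; it is fixed by `N` and satisfies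
`a_t ξ = e^t ξ`. -/
noncomputable def nullVec (n : ℕ) [NeZero n] : Matrix (Fin n ⊕ Unit) Unit ℍ[ℝ] :=
  Matrix.of fun i _ => Sum.elim (fun j => if j = 0 then 1 else 0) (fun _ => 1) i

/-- The last coordinate of `g ξ`. It equals `e^{H(g)} q`, where `q` is the `Sp(1)`-component of
`κ(g)`. -/
noncomputable def nullEntry (g : Spn1 n) : ℍ[ℝ] := (toMat g * nullVec n) (Sum.inr ()) ()

theorem nullEntry_eq (g : Spn1 n) :
    nullEntry g = toMat g (Sum.inr ()) (Sum.inl 0) + toMat g (Sum.inr ()) (Sum.inr ()) := by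
  simp [nullEntry, nullVec, Matrix.mul_apply]

theorem matH_nullVec : matH n * nullVec n = nullVec n := by
  ext1 i j
  rcases i with i | i <;> simp [matH, nullVec, Matrix.mul_apply]

theorem matH_conjTranspose : (matH n)ᴴ = matH n := by
  ext1 i j
  rcases i with i | i <;> rcases j with j | j <;> simp [matH, apply_ite star]

theorem matH_cube : matH n * (matH n * matH n) = matH n := by
  ext1 i j
  rcases i with i | i <;> rcases j with j | j <;>
    simp [matH, Matrix.fromBlocks_multiply, Matrix.mul_apply]

theorem matH_formJ : matH n * formJ n = -(formJ n * matH n) := by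
  simp [matH, formJ, Matrix.fromBlocks_multiply, Matrix.fromBlocks_neg]

theorem aMat_nullVec (t : ℝ) : aMat n t * nullVec n = Real.exp t • nullVec n := by
  ext1 i j
  rcases i with i | i
  · by_cases hi : i = 0 <;>
      simp [aMat, nullVec, Matrix.mul_apply, Matrix.diagonal_apply, hi, Algebra.smul_def,
        ← Real.cosh_add_sinh]
  · simp [aMat, nullVec, Matrix.mul_apply, Algebra.smul_def, ← Real.cosh_add_sinh, add_comm]

/-- If `[H, X] = c X` with `c > 0`, then `X ξ` is an eigenvector of `H` with eigenvalue `1 + c`,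
which is not an eigenvalue since `H³ = H`. -/
theorem rootSpace_mul_nullVec {c : ℝ} (hc : 0 < c) {X : QMat n} (hX : X ∈ rootSpace n c) :
    X * nullVec n = 0 := by
  set w := X * nullVec n with hw
  have h1 : matH n * w = (1 + c) • w := by
    have := congrArg (· * nullVec n) hX.2
    simp only [Matrix.sub_mul, Matrix.mul_assoc, matH_nullVec, ← hw, Matrix.smul_mul] at this
    rw [add_smul, one_smul, ← this]; abel
  have h3 : matH n * (matH n * (matH n * w)) = matH n * w := by
    rw [← Matrix.mul_assoc, ← Matrix.mul_assoc, Matrix.mul_assoc (matH n) (matH n) (matH n)]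
    rw [matH_cube]
  have h4 : ((1 + c) * (1 + c) * (1 + c) - (1 + c)) • w = 0 := by
    simp only [h1, Matrix.mul_smul, smul_smul] at h3
    rw [sub_smul, h3, sub_self]
  refine (smul_eq_zero.1 h4).resolve_left ?_
  have : (1 + c) * (1 + c) * (1 + c) - (1 + c) = (1 + c) * c * (2 + c) := by ring
  rw [this]; positivity

theorem NGroup_mul_nullVec {u : Spn1 n} (hu : u ∈ NGroup n) :
    toMat u * nullVec n = nullVec n := by
  refine Subgroup.closure_induction (p := fun u _ => toMat u * nullVec n = nullVec n)
    ?_ ?_ ?_ ?_ hu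
  · rintro g ⟨X, hX, Y, hY, h⟩
    have h0 : (X + Y) * nullVec n = 0 := by
      rw [Matrix.add_mul, rootSpace_mul_nullVec one_pos hX, rootSpace_mul_nullVec two_pos hY,
        add_zero]
    change ((g : (QMat n)ˣ) : QMat n) * nullVec n = nullVec n
    rw [h, NormedSpace.exp_eq_tsum ℝ]
    have hs : Summable fun k : ℕ => ((k.factorial : ℝ)⁻¹ • (X + Y) ^ k) := by
      let _ : NormedRing (QMat n) := Matrix.linftyOpNormedRing
      let _ : NormedAlgebra ℝ (QMat n) := Matrix.linftyOpNormedAlgebra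
      exact NormedSpace.expSeries_summable' (𝕂 := ℝ) (X + Y)
    have h1 : HasSum (fun k : ℕ => ((k.factorial : ℝ)⁻¹ • (X + Y) ^ k) * nullVec n)
        ((∑' k : ℕ, ((k.factorial : ℝ)⁻¹ • (X + Y) ^ k)) * nullVec n) :=
      hs.hasSum.map (Matrix.addMonoidHomMulRight (nullVec n))
        (continuous_id.matrix_mul continuous_const)
    refine h1.unique ?_
    have h2 : ∀ k : ℕ, k ≠ 0 → ((k.factorial : ℝ)⁻¹ • (X + Y) ^ k) * nullVec n = 0 := by
      intro k hk
      obtain ⟨m, rfl⟩ := Nat.exists_eq_succ_of_ne_zero hk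
      rw [Matrix.smul_mul, pow_succ, Matrix.mul_assoc, h0, Matrix.mul_zero, smul_zero]
    have h3 := hasSum_single 0 h2
    simpa using h3
  · simp [toMat_one]
  · intro x y _ _ hx hy
    rw [toMat_mul, Matrix.mul_assoc, hy, hx]
  · intro x _ hx
    conv_lhs => rw [← hx]
    rw [← Matrix.mul_assoc, ← toMat_mul, inv_mul_cancel, toMat_one, Matrix.one_mul]

theorem nullEntry_ofK_mul (k : KGroup n) (g : Spn1 n) :
    nullEntry (ofK k * g) = (k.2 : ℍ[ℝ]) * nullEntry g := by
  rw [nullEntry, toMat_mul, Matrix.mul_assoc, toMat_ofK, kMat, nullEntry]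
  conv_lhs => rw [Matrix.mul_apply]
  simp [Fintype.sum_sum_type]

theorem nullEntry_iwasawa (k : KGroup n) (t : ℝ) {u : Spn1 n} (hu : u ∈ NGroup n) :
    nullEntry (ofK k * aElt n t * u) = Real.exp t • (k.2 : ℍ[ℝ]) := by
  rw [mul_assoc, nullEntry_ofK_mul, nullEntry, toMat_mul, Matrix.mul_assoc,
    NGroup_mul_nullVec hu, toMat_aElt, aMat_nullVec]
  simp [nullVec]

/-- Some element of `N` moves `z` to a vector `(x c, 0, …, 0, (x - 1) c)` with `x` real, where `c`
is the difference of the first and the last coordinate of `z`, which `N` preserves. -/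
theorem exists_NGroup_mul (z : Matrix (Fin n ⊕ Unit) Unit ℍ[ℝ])
    (hz : z (Sum.inl 0) () ≠ z (Sum.inr ()) ()) :
    ∃ u ∈ NGroup n, ∃ x : ℝ, ∀ c, c = z (Sum.inl 0) () - z (Sum.inr ()) () →
      (toMat u * z) (Sum.inl 0) () = x • c ∧ (toMat u * z) (Sum.inr ()) () = (x - 1) • c ∧
      ∀ i ≠ 0, (toMat u * z) (Sum.inl i) () = 0 := by
  obtain ⟨c, hc⟩ : ∃ c, c = z (Sum.inl 0) () - z (Sum.inr ()) () := ⟨_, rfl⟩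
  have hc0 : c ≠ 0 := by rw [hc]; exact sub_ne_zero.2 hz
  set ξ := nullVec n with hξ
  set J := formJ n with hJ
  set H := matH n with hH
  -- `X = w ξ* J - ξ w* J` lies in `𝔤_α` and `Y = ξ s ξ* J` in `𝔤_{2α}`. Since `ξ* J z = c`, the
  -- choice of `w` makes `exp (X + Y) z = z + w c + ξ (⋯)` vanish in the coordinates other than
  -- `e₁`, `e_{n+1}`.
  let w : Matrix (Fin n ⊕ Unit) Unit ℍ[ℝ] :=
    Matrix.of fun i _ => Sum.elim (fun j => if j = 0 then 0 else -(z (Sum.inl j) () * c⁻¹))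
      (fun _ => 0) i
  have hHw : H * w = 0 := by
    ext1 i j
    rcases i with i | i <;> simp [hH, matH, w, Matrix.mul_apply]
    exact Finset.sum_eq_zero fun a _ => by split_ifs <;> simp
  have hξJξ : ξᴴ * J * ξ = 0 := by
    ext1 i j
    simp [hξ, nullVec, hJ, formJ, Matrix.mul_apply, apply_ite star, Matrix.one_apply]
  have hξJw : ξᴴ * J * w = 0 := by
    ext1 i j
    simp [hξ, nullVec, hJ, formJ, Matrix.mul_apply, apply_ite star, Matrix.one_apply, w]
    exact Finset.sum_eq_zero fun a _ => by split_ifs <;> simp_all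
  have hwJξ : wᴴ * J * ξ = 0 := by
    have := congrArg Matrix.conjTranspose hξJw
    simpa [Matrix.mul_assoc, hJ, formJ_conjTranspose] using this
  have hξJz : ξᴴ * J * z = Matrix.of fun _ _ => c := by
    ext1 i j
    simp [hξ, nullVec, hJ, formJ, Matrix.mul_apply, apply_ite star, Matrix.one_apply, hc,
      sub_eq_add_neg]
  -- The first coordinate of `exp X z` is `q c`; the imaginary parameter `s` removes the imaginary
  -- part of `q`.
  let r : ℍ[ℝ] := -(wᴴ * J * z) () () - (2⁻¹ : ℝ) • ((wᴴ * J * w) () () * c)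
  let q : ℍ[ℝ] := (z (Sum.inl 0) () + r) * c⁻¹
  let s : Matrix Unit Unit ℍ[ℝ] := Matrix.of fun _ _ => -q.im
  have hs : sᴴ = -s := by
    ext1 i j; simp [s]
  let X : QMat n := w * ξᴴ * J - ξ * wᴴ * J
  let Y : QMat n := ξ * s * ξᴴ * J
  have hJH : J * H = -(H * J) := by rw [hH, hJ, matH_formJ, neg_neg]
  have hJt : Jᴴ = J := formJ_conjTranspose
  have hHt : Hᴴ = H := matH_conjTranspose
  have hHξ : H * ξ = ξ := matH_nullVec
  have hξH : ξᴴ * H = ξᴴ := by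
    have := congrArg Matrix.conjTranspose hHξ
    rwa [Matrix.conjTranspose_mul, hHt] at this
  have hwH : wᴴ * H = 0 := by
    have := congrArg Matrix.conjTranspose hHw
    rwa [Matrix.conjTranspose_mul, hHt, Matrix.conjTranspose_zero] at this
  have hξJH : ξᴴ * J * H = -(ξᴴ * J) := by
    rw [Matrix.mul_assoc, hJH, Matrix.mul_neg, ← Matrix.mul_assoc, hξH]
  have hwJH : wᴴ * J * H = 0 := by
    rw [Matrix.mul_assoc, hJH, Matrix.mul_neg, ← Matrix.mul_assoc, hwH, Matrix.zero_mul, neg_zero]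
  have hX : X ∈ rootSpace n 1 := by
    constructor
    · change Xᴴ * J + J * X = 0
      simp only [X, Matrix.conjTranspose_sub, Matrix.conjTranspose_mul,
        Matrix.conjTranspose_conjTranspose, hJt, Matrix.sub_mul, Matrix.mul_sub, Matrix.mul_assoc]
      abel
    · change H * X - X * H = (1 : ℝ) • X
      have e1 : H * X = -(ξ * wᴴ * J) := by
        simp only [X, Matrix.mul_sub, ← Matrix.mul_assoc, hHw, hHξ, Matrix.zero_mul, zero_sub]
      have e2 : X * H = -(w * ξᴴ * J) := by
        simp only [X, Matrix.sub_mul, Matrix.mul_assoc] at *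
        rw [hξJH, hwJH]
        simp
      rw [e1, e2, one_smul]
      simp only [X]
      abel
  have hY : Y ∈ rootSpace n 2 := by
    constructor
    · change Yᴴ * J + J * Y = 0
      simp only [Y, Matrix.conjTranspose_mul, Matrix.conjTranspose_conjTranspose, hJt, hs,
        Matrix.mul_assoc, Matrix.neg_mul, Matrix.mul_neg]
      abel
    · change H * Y - Y * H = (2 : ℝ) • Y
      have e1 : H * Y = Y := by
        simp only [Y, ← Matrix.mul_assoc, hHξ]
      have e2 : Y * H = -Y := by
        simp only [Y, Matrix.mul_assoc] at *
        rw [hξJH]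
        simp
      rw [e1, e2, two_smul]; abel
  have hZJ : (X + Y)ᴴ * J + J * (X + Y) = 0 := by
    rw [Matrix.conjTranspose_add, Matrix.add_mul, Matrix.mul_add]
    have h1 := hX.1
    have h2 := hY.1
    rw [← hJ] at h1 h2
    rw [add_add_add_comm, h1, h2, add_zero]
  have hZZ : (X + Y) * (X + Y) = -(ξ * (wᴴ * J * w) * (ξᴴ * J)) := by
    have a1 : ∀ {p : Type} (M : Matrix Unit p ℍ[ℝ]), ξᴴ * (J * (ξ * M)) = 0 := fun M => by
      rw [← Matrix.mul_assoc, ← Matrix.mul_assoc, hξJξ, Matrix.zero_mul]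
    have a2 : ∀ {p : Type} (M : Matrix Unit p ℍ[ℝ]), ξᴴ * (J * (w * M)) = 0 := fun M => by
      rw [← Matrix.mul_assoc, ← Matrix.mul_assoc, hξJw, Matrix.zero_mul]
    have a3 : ∀ {p : Type} (M : Matrix Unit p ℍ[ℝ]), wᴴ * (J * (ξ * M)) = 0 := fun M => by
      rw [← Matrix.mul_assoc, ← Matrix.mul_assoc, hwJξ, Matrix.zero_mul]
    simp only [X, Y, Matrix.mul_add, Matrix.add_mul, Matrix.mul_sub, Matrix.sub_mul,
      Matrix.mul_assoc, a1, a2, a3, Matrix.mul_zero]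
    abel
  have hZ0 : (X + Y) * ξ = 0 := by
    rw [Matrix.add_mul, rootSpace_mul_nullVec one_pos hX, rootSpace_mul_nullVec two_pos hY,
      add_zero]
  have hZ3 : (X + Y) * (X + Y) * (X + Y) = 0 := by
    rw [Matrix.mul_assoc, hZZ, Matrix.mul_neg, Matrix.mul_assoc ξ, ← Matrix.mul_assoc _ ξ, hZ0,
      Matrix.zero_mul, neg_zero]
  obtain ⟨u, hu⟩ := exists_expUnipotent (X + Y) hZJ hZ3
  refine ⟨u, Subgroup.subset_closure ⟨X, hX, Y, hY, ?_⟩, q.re, ?_⟩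
  · rw [exp_of_pow_three_eq_zero _ hZ3]; exact hu
  intro c' hc'
  obtain rfl : c' = c := by rw [hc', hc]
  have huz : toMat u * z = z + w * (ξᴴ * J * z) + ξ * (s * (ξᴴ * J * z) - wᴴ * J * z
      - (2⁻¹ : ℝ) • ((wᴴ * J * w) * (ξᴴ * J * z))) := by
    rw [hu, hZZ]
    simp only [X, Y, Matrix.add_mul, Matrix.mul_sub, Matrix.sub_mul,
      Matrix.mul_assoc, Matrix.smul_mul, Matrix.mul_smul, Matrix.neg_mul,
      Matrix.one_mul, smul_neg]
    abel
  rw [huz, hξJz]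
  have hq : q * c' = z (Sum.inl 0) () + r := by
    simp only [q]; rw [mul_assoc, inv_mul_cancel₀ hc0, mul_one]
  have hqq : (q.re : ℍ[ℝ]) = q - q.im := by
    rw [eq_sub_iff_add_eq]; exact Quaternion.re_add_im q
  have hxc : q.re • c' = z (Sum.inl 0) () + r - q.im * c' := by
    rw [← hq, ← sub_mul, ← hqq, Algebra.smul_def]; rfl
  have hbr : ∀ j : Unit, (s * (Matrix.of fun _ _ => c' : Matrix Unit Unit ℍ[ℝ]) - wᴴ * J * z
      - (2⁻¹ : ℝ) • ((wᴴ * J * w) * (Matrix.of fun _ _ => c' : Matrix Unit Unit ℍ[ℝ]))) () j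
      = r - q.im * c' := by
    have hm : ∀ M : Matrix Unit Unit ℍ[ℝ], M * (Matrix.of fun _ _ => c' : Matrix Unit Unit ℍ[ℝ])
        = Matrix.of fun _ _ => M () () * c' := fun M => by ext1 i j; simp [Matrix.mul_apply]
    rintro ⟨⟩
    rw [hm, hm]
    simp only [Matrix.sub_apply, Matrix.smul_apply, Matrix.of_apply, s, r, neg_mul]
    abel
  refine ⟨?_, ?_, ?_⟩
  · rw [Matrix.add_apply, Matrix.mul_apply (M := ξ)]
    simp only [Finset.univ_unique, Finset.sum_singleton, PUnit.default_eq_unit, hbr]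
    simp [w, hξ, nullVec, Matrix.mul_apply, hxc]
    abel
  · rw [Matrix.add_apply, Matrix.mul_apply (M := ξ)]
    simp only [Finset.univ_unique, Finset.sum_singleton, PUnit.default_eq_unit, hbr]
    have hzl : z (Sum.inr ()) () = z (Sum.inl 0) () - c' := by rw [hc]; abel
    simp [w, hξ, nullVec, Matrix.mul_apply, sub_smul, hxc, hzl]
    abel
  · intro i hi
    rw [Matrix.add_apply, Matrix.mul_apply (M := ξ)]
    simp only [Finset.univ_unique, Finset.sum_singleton, PUnit.default_eq_unit, hbr]
    simp [w, hξ, nullVec, Matrix.mul_apply, hi, mul_assoc, inv_mul_cancel₀ hc0]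

/-- The Iwasawa decomposition `G = K A N`. By `exists_NGroup_mul` some `u ∈ N` moves `g⁻¹ e_{n+1}`
into the real plane of `e₁`, `e_{n+1}` up to a right factor, and some `a ∈ A` moves it on to a
multiple of `e_{n+1}`; then `a u g⁻¹` lies in `K`. -/
theorem exists_iwasawa (g : Spn1 n) :
    ∃ (k : KGroup n) (t : ℝ), ∃ u ∈ NGroup n, g = ofK k * aElt n t * u := by
  let z : Matrix (Fin n ⊕ Unit) Unit ℍ[ℝ] := Matrix.of fun i _ => toMat g⁻¹ i (Sum.inr ())
  have hz : z (Sum.inl 0) () ≠ z (Sum.inr ()) () := by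
    intro h
    have h1 := norm_lastCol g⁻¹
    have h2 := Finset.single_le_sum (f := fun i => ‖toMat g⁻¹ (Sum.inl i) (Sum.inr ())‖ ^ 2)
      (fun i _ => by positivity) (Finset.mem_univ (0 : Fin n))
    simp only [z, Matrix.of_apply] at h
    simp only [h, cornerEntry] at h1 h2
    linarith
  obtain ⟨u, hu, x, hx⟩ := exists_NGroup_mul z hz
  obtain ⟨c, hc⟩ : ∃ c, c = z (Sum.inl 0) () - z (Sum.inr ()) () := ⟨_, rfl⟩
  obtain ⟨h0, hl, hi⟩ := hx c hc
  have hc0 : c ≠ 0 := by rw [hc]; exact sub_ne_zero.2 hz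
  have hcol : ∀ i, toMat (u * g⁻¹) i (Sum.inr ()) = (toMat u * z) i () := fun i => by
    rw [toMat_mul, Matrix.mul_apply, Matrix.mul_apply]; rfl
  set m := ‖c‖ with hm
  have hm0 : 0 < m := norm_pos_iff.2 hc0
  have hxm : (1 - 2 * x) * m ^ 2 = 1 := by
    have h1 := norm_lastCol (u * g⁻¹)
    rw [cornerEntry] at h1
    simp only [hcol] at h1
    rw [Finset.sum_eq_single (0 : Fin n) (fun i _ h => by rw [hi i h]; simp) (by simp), h0, hl,
      norm_smul, norm_smul, mul_pow, mul_pow, Real.norm_eq_abs, Real.norm_eq_abs, sq_abs, sq_abs,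
      ← hm] at h1
    linarith
  -- the hyperbolic rotation taking `(x, x - 1)` to a multiple of `(0, 1)`
  set t := -Real.log m with ht
  have e1 : Real.exp (-t) = m := by rw [ht, neg_neg, Real.exp_log hm0]
  have e2 : Real.exp t = m⁻¹ := by rw [ht, Real.exp_neg, Real.exp_log hm0]
  have hkey : Real.cosh t * x - Real.sinh t * (x - 1) = 0 := by
    rw [Real.cosh_eq, Real.sinh_eq, e1, e2]
    have : x = (1 - (m ^ 2)⁻¹) / 2 := by field_simp; linarith
    rw [this]; field_simp; ring
  obtain ⟨k, hk⟩ := exists_ofK_of_lastCol (aElt n (-t) * (u * g⁻¹)) (fun i => by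
    rw [toMat_mul, Matrix.mul_apply, Fintype.sum_sum_type]
    simp only [hcol, toMat_aElt, aMat, Matrix.fromBlocks_apply₁₁, Matrix.fromBlocks_apply₁₂,
      Finset.univ_unique, Finset.sum_singleton, PUnit.default_eq_unit, hl]
    rw [Finset.sum_eq_single (0 : Fin n) (fun i _ h => by rw [hi i h]; simp) (by simp), h0]
    by_cases hi0 : i = 0
    · subst hi0
      simp only [Matrix.diagonal_apply_eq, if_true, Real.cosh_neg, Real.sinh_neg, Matrix.of_apply,
        ← Quaternion.coe_mul_eq_smul, ← mul_assoc, ← Quaternion.coe_mul]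
      rw [← add_mul, ← Quaternion.coe_add]
      rw [show Real.cosh t * x + -Real.sinh t * (x - 1) = 0 by linarith]
      simp
    · simp [hi0])
  refine ⟨k⁻¹, -t, u, hu, ?_⟩
  rw [map_inv, ← hk]; group

theorem iwasawaH_eq (g : Spn1 n) : Real.exp (iwasawaH g) = ‖nullEntry g‖ := by
  have h : ∃ t, ∃ k : KGroup n, ∃ u ∈ NGroup n, g = ofK k * aElt n t * u := by
    obtain ⟨k, t, u, hu, h⟩ := exists_iwasawa g
    exact ⟨t, k, u, hu, h⟩
  obtain ⟨k, u, hu, hg⟩ := Classical.epsilon_spec h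
  change g = ofK k * aElt n (iwasawaH g) * u at hg
  have := congrArg (fun x => ‖nullEntry x‖) hg
  simp only [nullEntry_iwasawa k _ hu] at this
  rw [this, norm_smul, CStarRing.norm_of_mem_unitary k.2.2, mul_one, Real.norm_eq_abs,
    abs_of_pos (Real.exp_pos _)]

theorem nullEntry_ne_zero (g : Spn1 n) : nullEntry g ≠ 0 := by
  rw [← norm_pos_iff, ← iwasawaH_eq]; exact Real.exp_pos _

theorem iwasawaH_eq_log (g : Spn1 n) : iwasawaH g = Real.log ‖nullEntry g‖ := by
  rw [← iwasawaH_eq, Real.log_exp]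

open Classical in
/-- The unit quaternion `q / |q|` (with value `1` at `q = 0`). -/
noncomputable def quatSgn (q : ℍ[ℝ]) : Sp1 :=
  if h : q = 0 then 1 else ⟨‖q‖⁻¹ • q, by
    have h1 : ‖q‖ ≠ 0 := norm_ne_zero_iff.2 h
    have h2 : ‖‖q‖⁻¹ • q‖ = 1 := by rw [norm_smul, norm_inv, norm_norm, inv_mul_cancel₀ h1]
    rw [Unitary.mem_iff, star_mul_self_real, mul_star_self_real, h2]; simp⟩

theorem quatSgn_coe {q : ℍ[ℝ]} (h : q ≠ 0) : (quatSgn q : ℍ[ℝ]) = ‖q‖⁻¹ • q := by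
  rw [quatSgn, dif_neg h]

theorem norm_smul_quatSgn (q : ℍ[ℝ]) : ‖q‖ • (quatSgn q : ℍ[ℝ]) = q := by
  by_cases h : q = 0
  · simp [h]
  · rw [quatSgn_coe h, smul_smul, mul_inv_cancel₀ (norm_ne_zero_iff.2 h), one_smul]

theorem norm_Sp1 (p : Sp1) : ‖(p : ℍ[ℝ])‖ = 1 := CStarRing.norm_of_mem_unitary p.2

theorem quatSgn_smul_Sp1 {r : ℝ} (hr : 0 < r) (p : Sp1) : quatSgn (r • (p : ℍ[ℝ])) = p := by
  apply Subtype.ext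
  have hp : (p : ℍ[ℝ]) ≠ 0 := by rw [← norm_pos_iff, norm_Sp1]; exact one_pos
  rw [quatSgn_coe (smul_ne_zero hr.ne' hp), norm_smul, norm_Sp1, mul_one, Real.norm_eq_abs,
    abs_of_pos hr, smul_smul, inv_mul_cancel₀ hr.ne', one_smul]

theorem quatSgn_real_smul {r : ℝ} (hr : 0 < r) {q : ℍ[ℝ]} (hq : q ≠ 0) :
    quatSgn (r • q) = quatSgn q := by
  conv_lhs => rw [← norm_smul_quatSgn q, smul_smul]
  exact quatSgn_smul_Sp1 (mul_pos hr (norm_pos_iff.2 hq)) _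

theorem quatSgn_mul_right {q : ℍ[ℝ]} (hq : q ≠ 0) (p : Sp1) :
    quatSgn (q * p) = quatSgn q * p := by
  conv_lhs => rw [← norm_smul_quatSgn q, smul_mul_assoc]
  exact quatSgn_smul_Sp1 (norm_pos_iff.2 hq) (quatSgn q * p)

theorem quatSgn_mul_left {q : ℍ[ℝ]} (hq : q ≠ 0) (p : Sp1) :
    quatSgn (p * q) = p * quatSgn q := by
  conv_lhs => rw [← norm_smul_quatSgn q, mul_smul_comm]
  exact quatSgn_smul_Sp1 (norm_pos_iff.2 hq) (p * quatSgn q)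

theorem continuousAt_quatSgn {q : ℍ[ℝ]} (hq : q ≠ 0) : ContinuousAt quatSgn q := by
  rw [Topology.IsInducing.subtypeVal.continuousAt_iff]
  have h : ContinuousAt (fun x : ℍ[ℝ] => ‖x‖⁻¹ • x) q :=
    (continuousAt_id.norm.inv₀ (norm_ne_zero_iff.2 hq)).smul continuousAt_id
  refine h.congr ?_
  filter_upwards [isOpen_ne.mem_nhds hq] with x hx
  exact (quatSgn_coe hx).symm

theorem iwasawaK_snd (g : Spn1 n) : (iwasawaK g).2 = quatSgn (nullEntry g) := by
  obtain ⟨t, u, hu, hg⟩ := Classical.epsilon_spec (exists_iwasawa g)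
  change g = ofK (iwasawaK g) * aElt n t * u at hg
  have := congrArg (fun x => quatSgn (nullEntry x)) hg
  simp only [nullEntry_iwasawa _ _ hu] at this
  rw [this, quatSgn_smul_Sp1 (Real.exp_pos _)]

/-! ### The Cartan projection -/

theorem cornerEntry_cartan (k₁ k₂ : KGroup n) (t : ℝ) :
    cornerEntry (ofK k₁ * aElt n t * ofK k₂) = Real.cosh t • ((k₁.2 : ℍ[ℝ]) * k₂.2) := by
  have h1 : ∀ M : QMat n, (M * kMat k₂) (Sum.inr ()) (Sum.inr ())
      = M (Sum.inr ()) (Sum.inr ()) * k₂.2 := fun M => by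
    simp [Matrix.mul_apply, kMat, Fintype.sum_sum_type]
  have h2 : ∀ M : QMat n, (kMat k₁ * M) (Sum.inr ()) (Sum.inr ())
      = k₁.2 * M (Sum.inr ()) (Sum.inr ()) := fun M => by
    simp [Matrix.mul_apply, kMat, Fintype.sum_sum_type]
  rw [cornerEntry, toMat_mul, toMat_mul, toMat_ofK, toMat_ofK, h1, h2, toMat_aElt]
  simp [aMat, Algebra.smul_def, ← mul_assoc]
  exact Or.inl (Quaternion.coe_commutes (Real.cosh t) (k₁.2 : ℍ[ℝ])).symm

theorem norm_cornerEntry_cartan (k₁ k₂ : KGroup n) (t : ℝ) :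
    ‖cornerEntry (ofK k₁ * aElt n t * ofK k₂)‖ = Real.cosh t := by
  rw [cornerEntry_cartan, norm_smul, norm_mul, norm_Sp1, norm_Sp1, Real.norm_eq_abs,
    abs_of_pos (Real.cosh_pos t)]
  ring

/-- The element `diag(-1, 1, …, 1)` of `K`, representing the nontrivial Weyl group element. -/
noncomputable def weylElt (n : ℕ) [NeZero n] : KGroup n :=
  (⟨Matrix.diagonal fun i => if i = 0 then -1 else 1, by
    rw [Unitary.mem_iff, Matrix.star_eq_conjTranspose, Matrix.diagonal_conjTranspose,
      Matrix.diagonal_mul_diagonal, Matrix.diagonal_mul_diagonal, ← Matrix.diagonal_one]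
    constructor <;> congr 1 <;> ext1 i <;> by_cases h : i = 0 <;> simp [h]⟩, 1)

theorem aElt_neg_eq_conj (t : ℝ) :
    aElt n (-t) = ofK (weylElt n) * aElt n t * ofK (weylElt n) := by
  apply toMat_injective
  have h : ((weylElt n).1 : Matrix (Fin n) (Fin n) ℍ[ℝ])
    = Matrix.diagonal fun i => if i = 0 then -1 else 1 := rfl
  have h' : ((weylElt n).2 : ℍ[ℝ]) = 1 := rfl
  rw [toMat_mul, toMat_mul, toMat_aElt, toMat_aElt, toMat_ofK, kMat, h, h', aMat, aMat,
    Matrix.fromBlocks_multiply, Matrix.fromBlocks_multiply]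
  simp only [Matrix.zero_mul, Matrix.mul_zero, add_zero, zero_add, Matrix.diagonal_mul_diagonal,
    Matrix.diagonal_one, Matrix.one_mul, Matrix.mul_one, Real.cosh_neg, Real.sinh_neg]
  congr 1
  · refine congrArg Matrix.diagonal (funext fun i => ?_)
    by_cases hi : i = 0 <;> simp [hi]
  · ext1 i j; by_cases hi : i = 0 <;> simp [hi]
  · ext1 i j; by_cases hi : j = 0 <;> simp [hi]

/-- The defining property of the Cartan projection; a negative parameter is made positive by the
Weyl group. -/
theorem cartanA_spec {x : Spn1 n} (hx : ∃ (k₁ k₂ : KGroup n) (t : ℝ),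
    x = ofK k₁ * aElt n t * ofK k₂) :
    0 ≤ cartanA x ∧ ∃ k₁ k₂ : KGroup n, x = ofK k₁ * aElt n (cartanA x) * ofK k₂ := by
  refine Classical.epsilon_spec
    (p := fun t => 0 ≤ t ∧ ∃ k₁ k₂ : KGroup n, x = ofK k₁ * aElt n t * ofK k₂) ?_
  obtain ⟨k₁, k₂, t, h⟩ := hx
  rcases le_total 0 t with ht | ht
  · exact ⟨t, ht, k₁, k₂, h⟩
  · refine ⟨-t, by linarith, k₁ * weylElt n, weylElt n * k₂, ?_⟩
    have h2 := aElt_neg_eq_conj (n := n) (-t)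
    rw [neg_neg] at h2
    rw [h, h2]
    simp only [map_mul, mul_assoc]

theorem cosh_cartanA {x : Spn1 n} (hx : ∃ (k₁ k₂ : KGroup n) (t : ℝ),
    x = ofK k₁ * aElt n t * ofK k₂) : Real.cosh (cartanA x) = ‖cornerEntry x‖ := by
  obtain ⟨-, k₁, k₂, h⟩ := cartanA_spec hx
  conv_rhs => rw [h]
  rw [norm_cornerEntry_cartan]

theorem cartanA_eq {k₁ k₂ : KGroup n} {t : ℝ} (ht : 0 ≤ t) :
    cartanA (ofK k₁ * aElt n t * ofK k₂) = t := by
  have h := cosh_cartanA (x := ofK k₁ * aElt n t * ofK k₂) ⟨k₁, k₂, t, rfl⟩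
  have h0 := (cartanA_spec (x := ofK k₁ * aElt n t * ofK k₂) ⟨k₁, k₂, t, rfl⟩).1
  rw [norm_cornerEntry_cartan] at h
  exact Real.cosh_strictMonoOn.injOn h0 ht h

end Iwasawa

/-! ### Haar measure on `K` -/

section HaarK

variable {n : ℕ}

instance : (haarK n).IsHaarMeasure := by unfold haarK; infer_instance

instance : IsProbabilityMeasure (haarK n) := ⟨by unfold haarK; exact Measure.haarMeasure_self⟩

instance : T2Space (KGroup n) :=
  inferInstanceAs (T2Space (unitary (Matrix (Fin n) (Fin n) ℍ[ℝ]) × Sp1))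

/-- A compact group is unimodular. -/
instance : (haarK n).IsMulRightInvariant := by
  refine ⟨fun g => ?_⟩
  have h1 : IsProbabilityMeasure (Measure.map (· * g) (haarK n)) :=
    Measure.isProbabilityMeasure_map (by fun_prop)
  have h2 : (Measure.map (· * g) (haarK n)).IsHaarMeasure := Measure.isHaarMeasure_map_mul_right _ g
  exact Measure.isHaarMeasure_eq_of_isProbabilityMeasure _ _

theorem integral_haarK_mul_left {E : Type*} [NormedAddCommGroup E] [NormedSpace ℝ E]
    (f : KGroup n → E) (p : KGroup n) : ∫ k, f (p * k) ∂(haarK n) = ∫ k, f k ∂(haarK n) :=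
  integral_mul_left_eq_self f p

theorem integral_haarK_mul_right {E : Type*} [NormedAddCommGroup E] [NormedSpace ℝ E]
    (f : KGroup n → E) (p : KGroup n) : ∫ k, f (k * p) ∂(haarK n) = ∫ k, f k ∂(haarK n) :=
  integral_mul_right_eq_self f p

theorem integral_haarK_conj {E : Type*} [NormedAddCommGroup E] [NormedSpace ℝ E]
    (f : KGroup n → E) (p : KGroup n) :
    ∫ k, f (p * k * p⁻¹) ∂(haarK n) = ∫ k, f k ∂(haarK n) := by
  have h := integral_haarK_mul_right (fun k => f (p * k)) p⁻¹
  simp only [← mul_assoc] at h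
  rw [h, integral_haarK_mul_left]

theorem integrable_haarK {E : Type*} [NormedAddCommGroup E]
    {f : KGroup n → E} (hf : Continuous f) : Integrable f (haarK n) :=
  hf.integrable_of_hasCompactSupport (HasCompactSupport.of_compactSpace f)

/-- The projection of `K` onto the factor `Sp(1)`. -/
noncomputable def sp1Part : KGroup n →* Sp1 :=
  MonoidHom.snd (unitary (Matrix (Fin n) (Fin n) ℍ[ℝ])) Sp1

theorem continuous_sp1Part : Continuous (sp1Part : KGroup n → Sp1) := continuous_snd

/-- The `Sp(n)`-component of an element of `K`, as a matrix. -/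
def spnMat (k : KGroup n) : Matrix (Fin n) (Fin n) ℍ[ℝ] := k.1

theorem continuous_spnMat : Continuous (spnMat : KGroup n → _) :=
  continuous_subtype_val.comp continuous_fst

/-- The inclusion of the factor `Sp(1)` in `K`. -/
noncomputable def ofSp1 (p : Sp1) : KGroup n := (1, p)

theorem sp1Part_ofSp1 (p : Sp1) : sp1Part (ofSp1 p : KGroup n) = p := rfl

theorem spnMat_mul (k l : KGroup n) : spnMat (k * l) = spnMat k * spnMat l := rfl

theorem spnMat_ofSp1 (p : Sp1) : spnMat (ofSp1 p : KGroup n) = 1 := rfl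

instance : SecondCountableTopology (KGroup n) := by
  have h : SecondCountableTopology (Matrix (Fin n) (Fin n) ℍ[ℝ]) :=
    inferInstanceAs (SecondCountableTopology (Fin n → Fin n → ℍ[ℝ]))
  have h2 : SecondCountableTopology (unitary (Matrix (Fin n) (Fin n) ℍ[ℝ])) :=
    Topology.IsEmbedding.subtypeVal.secondCountableTopology
  exact inferInstanceAs
    (SecondCountableTopology (unitary (Matrix (Fin n) (Fin n) ℍ[ℝ]) × Sp1))

end HaarK

/-! ### Schur's lemma -/

section Schur

variable {V : Type*} [NormedAddCommGroup V] [InnerProductSpace ℂ V] {ν : ℕ}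
  {τ : Representation ℂ Sp1 V}

theorem IsTau.finiteDimensional (hτ : IsTau ν τ) : FiniteDimensional ℂ V :=
  FiniteDimensional.of_finrank_pos (by rw [hτ.finrank_eq]; exact Nat.succ_pos ν)

theorem IsTau.exists_eq_smul (hτ : IsTau ν τ) (A : V →ₗ[ℂ] V)
    (hA : ∀ p v, A (τ p v) = τ p (A v)) : ∃ c : ℂ, A = c • LinearMap.id := by
  have := hτ.finiteDimensional
  have := hτ.irreducible
  obtain ⟨c, hc⟩ :=
    (Representation.IsIrreducible.algebraMap_intertwiningMap_bijective_of_isAlgClosed (ρ := τ)).2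
      ⟨A, fun g => LinearMap.ext fun v => hA g v⟩
  refine ⟨c, LinearMap.ext fun v => ?_⟩
  have := congrArg (fun B : τ.IntertwiningMap τ => B.toLinearMap v) hc
  simpa using this.symm

/-- `(q, v) ↦ τ(q) v` is jointly continuous. -/
theorem IsTau.continuous_apply (hτ : IsTau ν τ) {X : Type*} [TopologicalSpace X] {f : X → Sp1}
    {g : X → V} (hf : Continuous f) (hg : Continuous g) : Continuous fun x => τ (f x) (g x) := by
  rw [continuous_iff_continuousAt]
  intro x₀
  have h1 : Tendsto (fun x => τ (f x) (g x - g x₀)) (𝓝 x₀) (𝓝 0) := by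
    rw [tendsto_zero_iff_norm_tendsto_zero]
    simp only [hτ.norm_map]
    rw [← tendsto_zero_iff_norm_tendsto_zero]
    simpa using (hg.tendsto x₀).sub_const (g x₀)
  have h2 : Tendsto (fun x => τ (f x) (g x₀)) (𝓝 x₀) (𝓝 (τ (f x₀) (g x₀))) :=
    ((hτ.continuous_map (g x₀)).comp hf).tendsto x₀
  have h3 := h1.add h2
  simp only [zero_add, ← map_add, sub_add_cancel] at h3
  exact h3

variable {n : ℕ}

theorem extK_apply (k : KGroup n) : extK n τ k = τ (sp1Part k) := rfl

/-- An average of operators that commutes with an irreducible representation is the scalar given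
by the average of the traces. -/
theorem IsTau.integral_apply_eq (hτ : IsTau ν τ) (f : KGroup n → V →ₗ[ℂ] V)
    (hf : ∀ v, Continuous fun k => f k v)
    (hcomm : ∀ p v, ∫ k, f k (τ p v) ∂(haarK n) = ∫ k, τ p (f k v) ∂(haarK n)) (v : V) :
    ∫ k, f k v ∂(haarK n)
      = (((ν : ℂ) + 1)⁻¹ * ∫ k, LinearMap.trace ℂ V (f k) ∂(haarK n)) • v := by
  have := hτ.finiteDimensional
  have : CompleteSpace V := FiniteDimensional.complete ℂ V
  let A : V →ₗ[ℂ] V :=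
    { toFun := fun v => ∫ k, f k v ∂(haarK n)
      map_add' := fun v w => by
        simp only [map_add]
        exact integral_add (integrable_haarK (hf v)) (integrable_haarK (hf w))
      map_smul' := fun c v => by
        simp only [map_smul, RingHom.id_apply]
        exact integral_smul c _ }
  have hint : ∀ (B : V →ₗ[ℂ] ℂ) v, B (∫ k, f k v ∂(haarK n)) = ∫ k, B (f k v) ∂(haarK n) :=
    fun B v => ((LinearMap.toContinuousLinearMap B).integral_comp_comm
      (integrable_haarK (hf v))).symm
  have hint' : ∀ (B : V →ₗ[ℂ] V) v, B (∫ k, f k v ∂(haarK n)) = ∫ k, B (f k v) ∂(haarK n) :=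
    fun B v => ((LinearMap.toContinuousLinearMap B).integral_comp_comm
      (integrable_haarK (hf v))).symm
  obtain ⟨c, hc⟩ := hτ.exists_eq_smul A fun p v => by
    change ∫ k, f k (τ p v) ∂(haarK n) = τ p (∫ k, f k v ∂(haarK n))
    rw [hcomm, hint']
  have htr : LinearMap.trace ℂ V A = ∫ k, LinearMap.trace ℂ V (f k) ∂(haarK n) := by
    let b := Module.finBasis ℂ V
    simp only [LinearMap.trace_eq_matrix_trace ℂ b, Matrix.trace, Matrix.diag_apply,
      LinearMap.toMatrix_apply]
    rw [integral_finsetSum _ fun i _ => ?_]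
    · exact Finset.sum_congr rfl fun i _ => hint (b.coord i) (b i)
    · exact integrable_haarK
        ((LinearMap.continuous_of_finiteDimensional (b.coord i)).comp (hf (b i)))
  have h1 : LinearMap.trace ℂ V A = c * (ν + 1) := by
    rw [hc, map_smul, LinearMap.trace_id, hτ.finrank_eq, smul_eq_mul]; push_cast; rfl
  change A v = _
  have h0 : (ν : ℂ) + 1 ≠ 0 := by exact_mod_cast Nat.succ_ne_zero ν
  rw [← htr, h1, hc, mul_comm c, inv_mul_cancel_left₀ h0]
  rfl

/-- The character of `τ`. -/
noncomputable def tauChar (τ : Representation ℂ Sp1 V) (q : Sp1) : ℂ := LinearMap.trace ℂ V (τ q)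

theorem tauChar_conj (p q : Sp1) : tauChar τ (p * q * p⁻¹) = tauChar τ q := by
  rw [tauChar, map_mul, LinearMap.trace_mul_comm, ← map_mul, ← mul_assoc, inv_mul_cancel,
    one_mul, tauChar]

theorem IsTau.tauChar_one (hτ : IsTau ν τ) : tauChar τ 1 = ν + 1 := by
  have := hτ.finiteDimensional
  rw [tauChar, map_one]
  change LinearMap.trace ℂ V LinearMap.id = _
  rw [LinearMap.trace_id, hτ.finrank_eq]; push_cast; rfl

theorem IsTau.tauChar_eq_sum (hτ : IsTau ν τ) (q : Sp1) :
    haveI := hτ.finiteDimensional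
    tauChar τ q = ∑ i, (Module.finBasis ℂ V).coord i (τ q (Module.finBasis ℂ V i)) := by
  have := hτ.finiteDimensional
  rw [tauChar, LinearMap.trace_eq_matrix_trace ℂ (Module.finBasis ℂ V)]
  simp [Matrix.trace, LinearMap.toMatrix_apply]

theorem IsTau.continuous_coord (hτ : IsTau ν τ) (B : V →ₗ[ℂ] ℂ) (v : V) :
    Continuous fun q => B (τ q v) := by
  have := hτ.finiteDimensional
  exact (LinearMap.continuous_of_finiteDimensional B).comp (hτ.continuous_map v)

theorem IsTau.continuous_tauChar (hτ : IsTau ν τ) : Continuous (tauChar τ) := by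
  have := hτ.finiteDimensional
  rw [show tauChar τ = _ from funext hτ.tauChar_eq_sum]
  exact continuous_finsetSum _ fun i _ => hτ.continuous_coord _ _

/-- Schur orthogonality for the character. -/
theorem IsTau.integral_tauChar_mul (hτ : IsTau ν τ) :
    ∫ k, tauChar τ (sp1Part k) * tauChar τ (sp1Part k)⁻¹ ∂(haarK n) = 1 := by
  have := hτ.finiteDimensional
  have h0 : (ν : ℂ) + 1 ≠ 0 := by exact_mod_cast Nat.succ_ne_zero ν
  obtain ⟨b, hb⟩ : ∃ b, b = Module.finBasis ℂ V := ⟨_, rfl⟩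
  have hcont : ∀ i j v, Continuous fun k : KGroup n =>
      τ (sp1Part k) ((b.coord j (τ (sp1Part k)⁻¹ v)) • b i) := fun i j v =>
    hτ.continuous_apply continuous_sp1Part
      (((hτ.continuous_coord (b.coord j) v).comp continuous_sp1Part.inv).smul continuous_const)
  have key : ∀ i j, ∫ k : KGroup n, b.coord i (τ (sp1Part k) (b i)) *
        b.coord j (τ (sp1Part k)⁻¹ (b j)) ∂(haarK n)
      = if i = j then ((ν : ℂ) + 1)⁻¹ else 0 := by
    intro i j
    -- the average of the conjugates of the rank one operator `b i ⊗ (b j)*`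
    let f : KGroup n → V →ₗ[ℂ] V := fun k =>
      τ (sp1Part k) ∘ₗ (LinearMap.toSpanSingleton ℂ V (b i)) ∘ₗ b.coord j ∘ₗ τ (sp1Part k)⁻¹
    have hfa : ∀ k v, f k v = τ (sp1Part k) ((b.coord j (τ (sp1Part k)⁻¹ v)) • b i) :=
      fun k v => rfl
    have htr : ∀ k, LinearMap.trace ℂ V (f k) = if i = j then 1 else 0 := by
      intro k
      have h1 : f k = τ (sp1Part k) * ((LinearMap.toSpanSingleton ℂ V (b i)) ∘ₗ
        b.coord j ∘ₗ τ (sp1Part k)⁻¹) := rfl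
      rw [h1, LinearMap.trace_mul_comm]
      have h2 : ((LinearMap.toSpanSingleton ℂ V (b i)) ∘ₗ b.coord j ∘ₗ
          τ (sp1Part k)⁻¹) * τ (sp1Part k)
          = (LinearMap.toSpanSingleton ℂ V (b i)) ∘ₗ b.coord j := by
        ext v
        have : τ (sp1Part k)⁻¹ (τ (sp1Part k) v) = v := by
          rw [← Module.End.mul_apply, ← map_mul, inv_mul_cancel, map_one]; rfl
        simp [Module.End.mul_apply, this]
      rw [h2, LinearMap.trace_comp_comm']
      rw [LinearMap.trace_eq_matrix_trace ℂ (Module.Basis.singleton Unit ℂ)]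
      simp [Matrix.trace, LinearMap.toMatrix_apply, Finsupp.single_apply]
    have hmain := hτ.integral_apply_eq f (fun v => by simp only [hfa]; exact hcont i j v)
      (fun p v => by
        rw [← integral_haarK_mul_left (fun k => f k (τ p v)) (ofSp1 p)]
        refine integral_congr_ae (ae_of_all _ fun k => ?_)
        simp only [hfa, map_mul, sp1Part_ofSp1, mul_inv_rev, Module.End.mul_apply]
        rw [← Module.End.mul_apply (τ p⁻¹), ← map_mul, inv_mul_cancel, map_one]
        rfl) (b j)
    have h3 := congrArg (b.coord i) hmain
    have : CompleteSpace V := FiniteDimensional.complete ℂ V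
    rw [show b.coord i (∫ k, f k (b j) ∂(haarK n)) = ∫ k, b.coord i (f k (b j)) ∂(haarK n) from
      ((LinearMap.toContinuousLinearMap (b.coord i)).integral_comp_comm
        (integrable_haarK (by simp only [hfa]; exact hcont i j (b j)))).symm] at h3
    simp only [htr, hfa, map_smul, smul_eq_mul] at h3
    calc _ = _ := integral_congr_ae (ae_of_all _ fun k => mul_comm _ _)
      _ = _ := h3
      _ = _ := by
        by_cases hij : i = j
        · subst hij; simp
        · simp [hij]
  have hsum : ∀ k : KGroup n, tauChar τ (sp1Part k) * tauChar τ (sp1Part k)⁻¹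
      = ∑ i, ∑ j, b.coord i (τ (sp1Part k) (b i)) * b.coord j (τ (sp1Part k)⁻¹ (b j)) := by
    intro k
    rw [hτ.tauChar_eq_sum, hτ.tauChar_eq_sum, Finset.sum_mul_sum, hb]
  simp only [hsum]
  have hint : ∀ i j, Integrable (fun k : KGroup n =>
      b.coord i (τ (sp1Part k) (b i)) * b.coord j (τ (sp1Part k)⁻¹ (b j))) (haarK n) := fun i j =>
    integrable_haarK (((hτ.continuous_coord _ _).comp continuous_sp1Part).mul
      ((hτ.continuous_coord _ _).comp continuous_sp1Part.inv))
  rw [integral_finsetSum _ fun i _ => integrable_finsetSum _ fun j _ => hint i j]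
  simp only [integral_finsetSum _ fun j _ => hint _ j, key]
  simp [hτ.finrank_eq]
  field_simp

end Schur

/-! ### Weyl's integration formula for `Sp(1)` -/

section WeylIntegration

variable {n : ℕ}

/-- Differentiation under the integral sign for a family of functions on `K` whose integral does
not depend on the parameter. -/
theorem integral_deriv_eq_zero (F F' : ℝ → KGroup n → ℝ)
    (hF : ∀ φ k, HasDerivAt (fun φ => F φ k) (F' φ k) φ)
    (hF' : Continuous (Function.uncurry F')) (hFc : ∀ φ, Continuous (F φ))
    (hconst : ∀ φ, ∫ k, F φ k ∂(haarK n) = ∫ k, F 0 k ∂(haarK n)) :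
    ∫ k, F' 0 k ∂(haarK n) = 0 := by
  obtain ⟨C, hC⟩ := ((isCompact_Icc (a := (-1 : ℝ)) (b := 1)).prod
    (isCompact_univ (X := KGroup n))).exists_bound_of_continuousOn hF'.continuousOn
  have h := (hasDerivAt_integral_of_dominated_loc_of_deriv_le (μ := haarK n) (F := F) (F' := F')
    (x₀ := (0 : ℝ)) (s := Set.Icc (-1) 1) (bound := fun _ => C)
    (Icc_mem_nhds (by norm_num) (by norm_num))
    (Eventually.of_forall fun φ => (hFc φ).aestronglyMeasurable)
    (integrable_haarK (hFc 0))
    ((hF'.comp (Continuous.prodMk_right (0 : ℝ))).aestronglyMeasurable)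
    (ae_of_all _ fun k φ hφ => hC (φ, k) ⟨hφ, Set.mem_univ _⟩)
    (integrable_const C) (ae_of_all _ fun k φ _ => hF φ k)).2
  have h2 : HasDerivAt (fun φ => ∫ k, F φ k ∂(haarK n)) 0 0 := by
    rw [show (fun φ => ∫ k, F φ k ∂(haarK n)) = fun _ => ∫ k, F 0 k ∂(haarK n) from funext hconst]
    exact hasDerivAt_const _ _
  exact h.unique h2

theorem continuous_quat_re : Continuous fun k : KGroup n => ((sp1Part k) : ℍ[ℝ]).re :=
  Quaternion.continuous_re.comp (continuous_subtype_val.comp continuous_sp1Part)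

/-- The consequence of invariance under the one-parameter group `φ ↦ cos φ + e sin φ`, where `x_e`
is the coordinate along the imaginary unit `e`. -/
theorem integral_re_pow_of_rotation (P : ℝ → Sp1) (x : ℍ[ℝ] → ℝ) (hx : Continuous x)
    (h1 : ∀ φ (q : ℍ[ℝ]), ((P φ : ℍ[ℝ]) * q).re = Real.cos φ * q.re - Real.sin φ * x q)
    (h2 : ∀ φ (q : ℍ[ℝ]), x ((P φ : ℍ[ℝ]) * q) = Real.cos φ * x q + Real.sin φ * q.re) (j : ℕ) :
    ∫ k : KGroup n, ((sp1Part k) : ℍ[ℝ]).re ^ (j + 2) ∂(haarK n)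
      = (j + 1) * ∫ k : KGroup n, ((sp1Part k) : ℍ[ℝ]).re ^ j * x (sp1Part k) ^ 2 ∂(haarK n) := by
  have hre := continuous_quat_re (n := n)
  have hxc : Continuous fun k : KGroup n => x (sp1Part k) :=
    hx.comp (continuous_subtype_val.comp continuous_sp1Part)
  let r : ℝ → KGroup n → ℝ := fun φ k =>
    Real.cos φ * ((sp1Part k) : ℍ[ℝ]).re - Real.sin φ * x (sp1Part k)
  let y : ℝ → KGroup n → ℝ := fun φ k =>
    Real.cos φ * x (sp1Part k) + Real.sin φ * ((sp1Part k) : ℍ[ℝ]).re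
  have hr : ∀ φ k, HasDerivAt (fun φ => r φ k) (-y φ k) φ := fun φ k => by
    have := ((Real.hasDerivAt_cos φ).mul_const ((sp1Part k) : ℍ[ℝ]).re).sub
      ((Real.hasDerivAt_sin φ).mul_const (x (sp1Part k)))
    refine this.congr_deriv ?_
    simp only [y]; ring
  have hy : ∀ φ k, HasDerivAt (fun φ => y φ k) (r φ k) φ := fun φ k => by
    have := ((Real.hasDerivAt_cos φ).mul_const (x (sp1Part k))).add
      ((Real.hasDerivAt_sin φ).mul_const ((sp1Part k) : ℍ[ℝ]).re)
    refine this.congr_deriv ?_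
    simp only [r]; ring
  have hrc : Continuous (Function.uncurry r) := by
    simp only [Function.uncurry_def, r]
    exact ((Real.continuous_cos.comp continuous_fst).mul (hre.comp continuous_snd)).sub
      ((Real.continuous_sin.comp continuous_fst).mul (hxc.comp continuous_snd))
  have hyc : Continuous (Function.uncurry y) := by
    simp only [Function.uncurry_def, y]
    exact ((Real.continuous_cos.comp continuous_fst).mul (hxc.comp continuous_snd)).add
      ((Real.continuous_sin.comp continuous_fst).mul (hre.comp continuous_snd))
  have h := integral_deriv_eq_zero (n := n) (fun φ k => r φ k ^ (j + 1) * y φ k)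
    (fun φ k => ((j + 1 : ℕ) : ℝ) * r φ k ^ j * (-y φ k) * y φ k + r φ k ^ (j + 1) * r φ k)
    (fun φ k => by simpa using! ((hr φ k).pow (j + 1)).mul (hy φ k))
    ((((continuous_const.mul (hrc.pow j)).mul hyc.neg).mul hyc).add ((hrc.pow (j + 1)).mul hrc))
    (fun φ => ((hrc.comp (Continuous.prodMk_right φ)).pow (j + 1)).mul
      (hyc.comp (Continuous.prodMk_right φ)))
    (fun φ => by
      have := integral_haarK_mul_left (n := n)
        (fun k => ((sp1Part k) : ℍ[ℝ]).re ^ (j + 1) * x (sp1Part k)) (ofSp1 (P φ))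
      simp only [map_mul, sp1Part_ofSp1, Submonoid.coe_mul, h1, h2] at this
      simp only [r, y, Real.cos_zero, Real.sin_zero, one_mul, zero_mul, sub_zero, add_zero]
      exact this)
  have e0 : ∀ k, r 0 k = ((sp1Part k) : ℍ[ℝ]).re := fun k => by simp [r]
  have e1 : ∀ k, y 0 k = x (sp1Part k) := fun k => by simp [y]
  simp only [e0, e1] at h
  have h3 : ∀ k : KGroup n,
      ((j + 1 : ℕ) : ℝ) * ((sp1Part k) : ℍ[ℝ]).re ^ j * (-x (sp1Part k)) * x (sp1Part k)
      + ((sp1Part k) : ℍ[ℝ]).re ^ (j + 1) * ((sp1Part k) : ℍ[ℝ]).re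
      = ((sp1Part k) : ℍ[ℝ]).re ^ (j + 2)
        - (j + 1) * (((sp1Part k) : ℍ[ℝ]).re ^ j * x (sp1Part k) ^ 2) := fun k => by
    push_cast; ring
  simp only [h3] at h
  have i1 : Integrable (fun k : KGroup n => (sp1Part k : ℍ[ℝ]).re ^ (j + 2)) (haarK n) :=
    integrable_haarK (hre.pow _)
  have i2 : Integrable (fun k : KGroup n => ((j : ℝ) + 1) *
      ((sp1Part k : ℍ[ℝ]).re ^ j * x (sp1Part k) ^ 2)) (haarK n) :=
    integrable_haarK (continuous_const.mul ((hre.pow _).mul (hxc.pow 2)))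
  rw [integral_sub i1 i2, integral_const_mul] at h
  linarith

theorem mem_unitary_of_norm_sq {q : ℍ[ℝ]} (h : q.re ^ 2 + q.imI ^ 2 + q.imJ ^ 2 + q.imK ^ 2 = 1) :
    q ∈ unitary ℍ[ℝ] := by
  have h1 : Quaternion.normSq q = 1 := by rw [Quaternion.normSq_def']; exact h
  rw [Unitary.mem_iff, Quaternion.star_mul_self, Quaternion.self_mul_star, h1]
  simp

theorem Sp1_coord_sq (q : Sp1) :
    (q : ℍ[ℝ]).re ^ 2 + (q : ℍ[ℝ]).imI ^ 2 + (q : ℍ[ℝ]).imJ ^ 2 + (q : ℍ[ℝ]).imK ^ 2 = 1 := by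
  rw [← Quaternion.normSq_def', Quaternion.normSq_eq_norm_mul_self, norm_Sp1]; ring

/-- The unit quaternion with given coordinates. -/
noncomputable def unitElt (a b c d : ℝ) (h : a ^ 2 + b ^ 2 + c ^ 2 + d ^ 2 = 1) : Sp1 :=
  ⟨⟨a, b, c, d⟩, mem_unitary_of_norm_sq h⟩

section UnitElt

variable (a b c d : ℝ) (h : a ^ 2 + b ^ 2 + c ^ 2 + d ^ 2 = 1)

@[simp] theorem unitElt_re : (unitElt a b c d h : ℍ[ℝ]).re = a := rfl
@[simp] theorem unitElt_imI : (unitElt a b c d h : ℍ[ℝ]).imI = b := rfl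
@[simp] theorem unitElt_imJ : (unitElt a b c d h : ℍ[ℝ]).imJ = c := rfl
@[simp] theorem unitElt_imK : (unitElt a b c d h : ℍ[ℝ]).imK = d := rfl

end UnitElt

/-- The element `e^{iθ} = cos θ + i sin θ` of `Sp(1)`. -/
noncomputable def circleElt (θ : ℝ) : Sp1 := unitElt (Real.cos θ) (Real.sin θ) 0 0 (by simp)

/-- The recursion for the moments of `Re q`: the identities of `integral_re_pow_of_rotation` for the
three imaginary units are added, and `|q| = 1`. -/
theorem moment_re_succ (j : ℕ) :
    ((j : ℝ) + 4) * ∫ k : KGroup n, ((sp1Part k) : ℍ[ℝ]).re ^ (j + 2) ∂(haarK n)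
      = (j + 1) * ∫ k : KGroup n, ((sp1Part k) : ℍ[ℝ]).re ^ j ∂(haarK n) := by
  have hre := continuous_quat_re (n := n)
  have hI := integral_re_pow_of_rotation (n := n) circleElt (fun q => q.imI)
    Quaternion.continuous_imI (fun φ q => by simp [circleElt]) (fun φ q => by simp [circleElt]) j
  have hJ := integral_re_pow_of_rotation (n := n)
    (fun φ => unitElt (Real.cos φ) 0 (Real.sin φ) 0 (by simp))
    (fun q => q.imJ) Quaternion.continuous_imJ (fun φ q => by simp) (fun φ q => by simp) j
  have hK := integral_re_pow_of_rotation (n := n)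
    (fun φ => unitElt (Real.cos φ) 0 0 (Real.sin φ) (by simp))
    (fun q => q.imK) Quaternion.continuous_imK (fun φ q => by simp) (fun φ q => by simp) j
  have hc : Continuous fun k : KGroup n => ((sp1Part k) : ℍ[ℝ]) :=
    continuous_subtype_val.comp continuous_sp1Part
  have hsum : ∫ k : KGroup n, ((sp1Part k) : ℍ[ℝ]).re ^ j ∂(haarK n)
      = ∫ k : KGroup n, ((sp1Part k) : ℍ[ℝ]).re ^ (j + 2) ∂(haarK n)
        + ∫ k : KGroup n, ((sp1Part k) : ℍ[ℝ]).re ^ j * ((sp1Part k) : ℍ[ℝ]).imI ^ 2 ∂(haarK n)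
        + ∫ k : KGroup n, ((sp1Part k) : ℍ[ℝ]).re ^ j * ((sp1Part k) : ℍ[ℝ]).imJ ^ 2 ∂(haarK n)
        + ∫ k : KGroup n, ((sp1Part k) : ℍ[ℝ]).re ^ j * ((sp1Part k) : ℍ[ℝ]).imK ^ 2
          ∂(haarK n) := by
    have i0 := integrable_haarK (hre.pow (j + 2))
    have i1 := integrable_haarK ((hre.pow j).mul ((Quaternion.continuous_imI.comp hc).pow 2))
    have i2 := integrable_haarK ((hre.pow j).mul ((Quaternion.continuous_imJ.comp hc).pow 2))
    have i3 := integrable_haarK ((hre.pow j).mul ((Quaternion.continuous_imK.comp hc).pow 2))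
    refine Eq.trans ?_ ((integral_add ((i0.add i1).add i2) i3).trans (congrArg₂ _
      ((integral_add (i0.add i1) i2).trans (congrArg₂ _ (integral_add i0 i1) rfl)) rfl))
    refine integral_congr_ae (ae_of_all _ fun k => ?_)
    simp only [Pi.add_apply, Pi.mul_apply, Pi.pow_apply, Function.comp_apply]
    linear_combination (-((sp1Part k) : ℍ[ℝ]).re ^ j) * Sp1_coord_sq (sp1Part k)
  rw [hsum, mul_add, mul_add, mul_add, ← hI, ← hJ, ← hK]
  ring

theorem moment_re_one : ∫ k : KGroup n, ((sp1Part k) : ℍ[ℝ]).re ∂(haarK n) = 0 := by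
  have := integral_haarK_mul_left (n := n) (fun k => ((sp1Part k) : ℍ[ℝ]).re)
    (ofSp1 (circleElt Real.pi))
  have h2 : ∀ k : KGroup n,
      (sp1Part (ofSp1 (circleElt Real.pi) * k) : ℍ[ℝ]).re = -((sp1Part k) : ℍ[ℝ]).re :=
    fun k => by rw [map_mul, sp1Part_ofSp1, Submonoid.coe_mul]; simp [circleElt]
  simp only [h2, integral_neg] at this
  linarith

/-- The moments of `cos θ` against `sin² θ dθ` obey the recursion of `moment_re_succ`. -/
theorem moment_weyl_succ (j : ℕ) :
    ((j : ℝ) + 4) * ∫ θ in (-Real.pi)..Real.pi, Real.cos θ ^ (j + 2) * Real.sin θ ^ 2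
      = (j + 1) * ∫ θ in (-Real.pi)..Real.pi, Real.cos θ ^ j * Real.sin θ ^ 2 := by
  have h : ∀ j : ℕ, ∫ θ in (-Real.pi)..Real.pi, Real.cos θ ^ j * Real.sin θ ^ 2
      = (∫ θ in (-Real.pi)..Real.pi, Real.cos θ ^ j) / (j + 2) := by
    intro j
    have e : ∀ θ, Real.cos θ ^ j * Real.sin θ ^ 2 = Real.cos θ ^ j - Real.cos θ ^ (j + 2) :=
      fun θ => by rw [Real.sin_sq]; ring
    simp only [e]
    rw [intervalIntegral.integral_sub (Continuous.intervalIntegrable (by fun_prop) _ _)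
      (Continuous.intervalIntegrable (by fun_prop) _ _), integral_cos_pow]
    simp
    field_simp
    ring
  rw [h, h, integral_cos_pow]
  simp
  field_simp
  ring

theorem moment_eq (j : ℕ) : ∫ k : KGroup n, ((sp1Part k) : ℍ[ℝ]).re ^ j ∂(haarK n)
    = Real.pi⁻¹ * ∫ θ in (-Real.pi)..Real.pi, Real.cos θ ^ j * Real.sin θ ^ 2 := by
  induction j using Nat.strong_induction_on with
  | _ j ih =>
    match j with
    | 0 => simp [integral_sin_sq]
    | 1 =>
      simp only [pow_one]
      rw [moment_re_one]
      have : ∀ θ, Real.cos θ * Real.sin θ ^ 2 = Real.sin θ ^ 2 * Real.cos θ := fun θ => mul_comm _ _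
      simp only [this]
      simp
    | j + 2 =>
      have h1 := moment_re_succ (n := n) j
      have h2 := moment_weyl_succ j
      rw [ih j (by omega)] at h1
      have h4 : (j : ℝ) + 4 ≠ 0 := by positivity
      apply mul_left_cancel₀ h4
      rw [h1]
      linear_combination (-Real.pi⁻¹) * h2

theorem norm_re_Sp1_le (q : Sp1) : |(q : ℍ[ℝ]).re| ≤ 1 := by
  rw [← sq_le_one_iff_abs_le_one]
  nlinarith [Sp1_coord_sq q, sq_nonneg (q : ℍ[ℝ]).imI, sq_nonneg (q : ℍ[ℝ]).imJ,
    sq_nonneg (q : ℍ[ℝ]).imK]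

theorem weyl_integration_polynomial (p : Polynomial ℝ) :
    ∫ k : KGroup n, p.eval (sp1Part k : ℍ[ℝ]).re ∂(haarK n)
      = Real.pi⁻¹ * ∫ θ in (-Real.pi)..Real.pi, p.eval (Real.cos θ) * Real.sin θ ^ 2 := by
  simp only [Polynomial.eval_eq_sum_range, Finset.sum_mul]
  rw [integral_finsetSum, intervalIntegral.integral_finsetSum fun i _ =>
    Continuous.intervalIntegrable (by fun_prop) _ _, Finset.mul_sum]
  swap
  · exact fun i _ => integrable_haarK (continuous_const.mul (continuous_quat_re.pow i))
  refine Finset.sum_congr rfl fun i _ => ?_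
  simp only [mul_assoc]
  rw [integral_const_mul, intervalIntegral.integral_const_mul, moment_eq]
  ring

/-- Passage from polynomials to continuous functions by Weierstrass approximation. -/
theorem weyl_integration_real (f : ℝ → ℝ) (hf : Continuous f) :
    ∫ k : KGroup n, f (sp1Part k : ℍ[ℝ]).re ∂(haarK n)
      = Real.pi⁻¹ * ∫ θ in (-Real.pi)..Real.pi, f (Real.cos θ) * Real.sin θ ^ 2 := by
  refine eq_of_forall_dist_le fun ε hε => ?_
  obtain ⟨p, hp⟩ := exists_polynomial_near_of_continuousOn (-1) 1 f hf.continuousOn (ε / 3)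
    (by positivity)
  have hpi := Real.pi_pos
  have h1 : |∫ k : KGroup n, f (sp1Part k : ℍ[ℝ]).re ∂(haarK n)
      - ∫ k : KGroup n, p.eval (sp1Part k : ℍ[ℝ]).re ∂(haarK n)| ≤ ε / 3 := by
    rw [← integral_sub]
    rotate_left
    · exact integrable_haarK (hf.comp continuous_quat_re)
    · exact integrable_haarK (p.continuous.comp continuous_quat_re)
    rw [← Real.norm_eq_abs]
    refine le_trans (norm_integral_le_of_norm_le_const (C := ε / 3) (ae_of_all _ fun k => ?_)) ?_
    · rw [Real.norm_eq_abs, abs_sub_comm]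
      exact (hp _ (abs_le.1 (norm_re_Sp1_le _))).le
    · simp
  have h2 : |(∫ θ in (-Real.pi)..Real.pi, f (Real.cos θ) * Real.sin θ ^ 2)
      - ∫ θ in (-Real.pi)..Real.pi, p.eval (Real.cos θ) * Real.sin θ ^ 2|
      ≤ ε / 3 * (2 * Real.pi) := by
    rw [← intervalIntegral.integral_sub]
    rotate_left
    · exact ((hf.comp Real.continuous_cos).mul (Real.continuous_sin.pow 2)).intervalIntegrable _ _
    · exact ((p.continuous.comp Real.continuous_cos).mul
        (Real.continuous_sin.pow 2)).intervalIntegrable _ _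
    rw [← Real.norm_eq_abs]
    refine le_trans (intervalIntegral.norm_integral_le_of_norm_le_const (C := ε / 3)
      fun θ _ => ?_) (le_of_eq ?_)
    · rw [← sub_mul, norm_mul, Real.norm_eq_abs, Real.norm_eq_abs, abs_sub_comm,
        abs_of_nonneg (sq_nonneg (Real.sin θ))]
      have h3 := (hp _ ⟨Real.neg_one_le_cos θ, Real.cos_le_one θ⟩).le
      have h4 := Real.sin_sq_le_one θ
      nlinarith [abs_nonneg (Polynomial.eval (Real.cos θ) p - f (Real.cos θ)),
        sq_nonneg (Real.sin θ)]
    · rw [show Real.pi - -Real.pi = 2 * Real.pi by ring, abs_of_pos (by positivity)]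
  rw [weyl_integration_polynomial] at h1
  rw [Real.dist_eq]
  set I := ∫ k : KGroup n, f (sp1Part k : ℍ[ℝ]).re ∂(haarK n)
  set A := ∫ θ in (-Real.pi)..Real.pi, f (Real.cos θ) * Real.sin θ ^ 2
  set B := ∫ θ in (-Real.pi)..Real.pi, p.eval (Real.cos θ) * Real.sin θ ^ 2
  have h5 : I - Real.pi⁻¹ * A = (I - Real.pi⁻¹ * B) - Real.pi⁻¹ * (A - B) := by ring
  rw [h5]
  calc |(I - Real.pi⁻¹ * B) - Real.pi⁻¹ * (A - B)|
      ≤ |I - Real.pi⁻¹ * B| + |Real.pi⁻¹ * (A - B)| := abs_sub _ _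
    _ ≤ ε / 3 + Real.pi⁻¹ * (ε / 3 * (2 * Real.pi)) := by
      rw [abs_mul Real.pi⁻¹, abs_of_pos (inv_pos.2 hpi)]
      gcongr
    _ = ε := by field_simp; ring

/-- Weyl's integration formula for `Sp(1)`, for functions of the real part. -/
theorem weyl_integration (f : ℝ → ℂ) (hf : Continuous f) :
    ∫ k : KGroup n, f (sp1Part k : ℍ[ℝ]).re ∂(haarK n)
      = (Real.pi : ℂ)⁻¹ * ∫ θ in (-Real.pi)..Real.pi, f (Real.cos θ) * (Real.sin θ : ℂ) ^ 2 := by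
  have hre := Complex.continuous_re.comp hf
  have him := Complex.continuous_im.comp hf
  have h1 := weyl_integration_real (n := n) _ hre
  have h2 := weyl_integration_real (n := n) _ him
  have hdec : ∀ x, f x = ((f x).re : ℂ) + ((f x).im : ℂ) * Complex.I :=
    fun x => (Complex.re_add_im _).symm
  have e1 : ∫ k : KGroup n, f (sp1Part k : ℍ[ℝ]).re ∂(haarK n)
      = ((∫ k : KGroup n, (f (sp1Part k : ℍ[ℝ]).re).re ∂(haarK n) : ℝ) : ℂ)
        + ((∫ k : KGroup n, (f (sp1Part k : ℍ[ℝ]).re).im ∂(haarK n) : ℝ) : ℂ) * Complex.I := by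
    rw [← integral_complex_ofReal, ← integral_complex_ofReal, ← integral_mul_const, ← integral_add]
    rotate_left
    · exact integrable_haarK (Complex.continuous_ofReal.comp (hre.comp continuous_quat_re))
    · exact integrable_haarK ((Complex.continuous_ofReal.comp
        (him.comp continuous_quat_re)).mul continuous_const)
    exact integral_congr_ae (ae_of_all _ fun k => hdec _)
  have e2 : ∫ θ in (-Real.pi)..Real.pi, f (Real.cos θ) * (Real.sin θ : ℂ) ^ 2
      = ((∫ θ in (-Real.pi)..Real.pi, (f (Real.cos θ)).re * Real.sin θ ^ 2 : ℝ) : ℂ)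
        + ((∫ θ in (-Real.pi)..Real.pi, (f (Real.cos θ)).im * Real.sin θ ^ 2 : ℝ) : ℂ)
          * Complex.I := by
    rw [← intervalIntegral.integral_ofReal, ← intervalIntegral.integral_ofReal,
      ← intervalIntegral.integral_mul_const, ← intervalIntegral.integral_add]
    rotate_left
    · exact (Complex.continuous_ofReal.comp ((hre.comp Real.continuous_cos).mul
        (Real.continuous_sin.pow 2))).intervalIntegrable _ _
    · exact ((Complex.continuous_ofReal.comp ((him.comp Real.continuous_cos).mul
        (Real.continuous_sin.pow 2))).mul continuous_const).intervalIntegrable _ _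
    refine intervalIntegral.integral_congr fun θ _ => ?_
    simp only [Complex.ofReal_mul, Complex.ofReal_pow]
    conv_lhs => rw [hdec]
    ring
  simp only [Function.comp_apply] at h1 h2
  rw [e1, e2, h1, h2]
  push_cast
  ring

end WeylIntegration

/-! ### The character of `τ` -/

/-- Every unit quaternion `q` is conjugate to an element of the circle `e^{iθ}`. If `r = |Im q|`,
then `P = r i + Im q` intertwines `Im q` with `r i`; it vanishes only for `q` with `Im q = -r i`,
and there `P = j` does. -/
theorem exists_conj_circleElt (q : Sp1) :
    ∃ p : Sp1, p * q * p⁻¹ = circleElt (Real.arccos (q : ℍ[ℝ]).re) := by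
  have hq := Sp1_coord_sq q
  have hre := abs_le.1 (norm_re_Sp1_le q)
  set c := circleElt (Real.arccos (q : ℍ[ℝ]).re) with hc
  have hc0 : (c : ℍ[ℝ]).re = (q : ℍ[ℝ]).re := Real.cos_arccos hre.1 hre.2
  have hc1 : (c : ℍ[ℝ]).imI = √(1 - (q : ℍ[ℝ]).re ^ 2) := Real.sin_arccos _
  have hc2 : (c : ℍ[ℝ]).imJ = 0 := rfl
  have hc3 : (c : ℍ[ℝ]).imK = 0 := rfl
  set r := √(1 - (q : ℍ[ℝ]).re ^ 2) with hr
  have hr2 : r ^ 2 = (q : ℍ[ℝ]).imI ^ 2 + (q : ℍ[ℝ]).imJ ^ 2 + (q : ℍ[ℝ]).imK ^ 2 := by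
    rw [hr, Real.sq_sqrt (by nlinarith)]; linarith
  suffices h : ∃ P : ℍ[ℝ], P ≠ 0 ∧ P * q = c * P by
    obtain ⟨P, hP, h⟩ := h
    refine ⟨quatSgn P, ?_⟩
    rw [mul_inv_eq_iff_eq_mul, ← quatSgn_mul_right hP, ← quatSgn_mul_left hP, h]
  by_cases h0 : r + (q : ℍ[ℝ]).imI = 0 ∧ (q : ℍ[ℝ]).imJ = 0 ∧ (q : ℍ[ℝ]).imK = 0
  · obtain ⟨h1, h2, h3⟩ := h0
    refine ⟨(unitElt 0 0 1 0 (by norm_num) : ℍ[ℝ]), ?_, ?_⟩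
    · intro h
      have := congrArg (fun x : ℍ[ℝ] => x.imJ) h
      simp at this
    · apply Quaternion.ext <;> simp [hc0, hc1, hc2, hc3, h2, h3]
      linarith
  · let P : ℍ[ℝ] := ⟨0, r + (q : ℍ[ℝ]).imI, (q : ℍ[ℝ]).imJ, (q : ℍ[ℝ]).imK⟩
    have p0 : P.re = 0 := rfl
    have p1 : P.imI = r + (q : ℍ[ℝ]).imI := rfl
    have p2 : P.imJ = (q : ℍ[ℝ]).imJ := rfl
    have p3 : P.imK = (q : ℍ[ℝ]).imK := rfl
    refine ⟨P, fun h => h0 ?_, ?_⟩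
    · have e1 := congrArg (fun x : ℍ[ℝ] => x.imI) h
      have e2 := congrArg (fun x : ℍ[ℝ] => x.imJ) h
      have e3 := congrArg (fun x : ℍ[ℝ] => x.imK) h
      exact ⟨e1, e2, e3⟩
    · apply Quaternion.ext <;>
        simp only [Quaternion.re_mul, Quaternion.imI_mul, Quaternion.imJ_mul, Quaternion.imK_mul,
          hc0, hc1, hc2, hc3, p0, p1, p2, p3]
      · linear_combination hr2
      · ring
      · ring
      · ring

theorem Sp1_inv_coe (q : Sp1) : ((q⁻¹ : Sp1) : ℍ[ℝ]) = star (q : ℍ[ℝ]) := rfl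

theorem circleElt_add (θ φ : ℝ) : circleElt (θ + φ) = circleElt θ * circleElt φ := by
  apply Subtype.ext
  apply Quaternion.ext <;>
    simp [circleElt, Real.cos_add, Real.sin_add]
  ring

theorem circleElt_periodic (θ : ℝ) : circleElt (θ + 2 * Real.pi) = circleElt θ := by
  apply Subtype.ext
  apply Quaternion.ext <;> simp [circleElt]

theorem continuous_circleElt : Continuous circleElt := by
  refine Topology.IsInducing.subtypeVal.continuous_iff.2 (Continuous.congr (f := fun θ =>
    Real.cos θ • (1 : ℍ[ℝ]) + Real.sin θ • (unitElt 0 1 0 0 (by norm_num) : ℍ[ℝ])) ?_ fun θ => ?_)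
  · exact (Real.continuous_cos.smul continuous_const).add
      (Real.continuous_sin.smul continuous_const)
  · apply Quaternion.ext <;> simp [circleElt]

section Character

variable {V : Type*} [NormedAddCommGroup V] [InnerProductSpace ℂ V] {ν : ℕ}
  {τ : Representation ℂ Sp1 V}

theorem tauChar_eq_circle (q : Sp1) :
    tauChar τ q = tauChar τ (circleElt (Real.arccos (q : ℍ[ℝ]).re)) := by
  obtain ⟨p, hp⟩ := exists_conj_circleElt q
  rw [← hp, tauChar_conj]

theorem tauChar_eq_of_re {p q : Sp1} (h : (p : ℍ[ℝ]).re = (q : ℍ[ℝ]).re) :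
    tauChar τ p = tauChar τ q := by
  rw [tauChar_eq_circle p, tauChar_eq_circle q, h]

theorem tauChar_inv (q : Sp1) : tauChar τ q⁻¹ = tauChar τ q :=
  tauChar_eq_of_re (by rw [Sp1_inv_coe]; simp)

theorem IsTau.inner_map (hτ : IsTau ν τ) (q : Sp1) (v w : V) :
    inner ℂ (τ q v) (τ q w) = inner ℂ v w :=
  (⟨τ q, hτ.norm_map q⟩ : V →ₗᵢ[ℂ] V).inner_map_map v w

theorem apply_inv_apply (q : Sp1) (v : V) : τ q (τ q⁻¹ v) = v := by
  rw [← Module.End.mul_apply, ← map_mul, mul_inv_cancel, map_one]; rfl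

theorem IsTau.conj_tauChar (hτ : IsTau ν τ) (q : Sp1) :
    (starRingEnd ℂ) (tauChar τ q) = tauChar τ q := by
  have := hτ.finiteDimensional
  conv_rhs => rw [← tauChar_inv]
  rw [tauChar, tauChar, LinearMap.trace_eq_sum_inner _ (stdOrthonormalBasis ℂ V),
    LinearMap.trace_eq_sum_inner _ (stdOrthonormalBasis ℂ V), map_sum]
  refine Finset.sum_congr rfl fun i _ => ?_
  rw [inner_conj_symm]
  conv_lhs => rw [← apply_inv_apply (τ := τ) q ((stdOrthonormalBasis ℂ V) i), hτ.inner_map]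
  rw [apply_inv_apply]

/-- The multiplicities of the weights of `τ` are integers: they are the traces of the projections
onto the weight spaces of the circle. -/
theorem IsTau.exists_weight_multiplicity (hτ : IsTau ν τ) (m : ℤ) :
    ∃ d : ℕ, ∫ θ in (-Real.pi)..Real.pi,
      Complex.exp (-(m * θ * Complex.I)) * tauChar τ (circleElt θ) = 2 * Real.pi * d := by
  have := hτ.finiteDimensional
  have : CompleteSpace V := FiniteDimensional.complete ℂ V
  have hpi : (2 * Real.pi : ℂ) ≠ 0 := by exact_mod_cast Real.two_pi_pos.ne'
  let g : V → ℝ → V := fun v θ => Complex.exp (-(m * θ * Complex.I)) • τ (circleElt θ) v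
  have hg : ∀ v, Continuous (g v) := fun v =>
    (by fun_prop : Continuous fun θ : ℝ => Complex.exp (-(m * θ * Complex.I))).smul
      ((hτ.continuous_map v).comp continuous_circleElt)
  have hgi : ∀ v, IntervalIntegrable (g v) volume (-Real.pi) Real.pi :=
    fun v => (hg v).intervalIntegrable _ _
  have hper : ∀ v, Function.Periodic (g v) (2 * Real.pi) := fun v θ => by
    simp only [g, circleElt_periodic]
    congr 1
    rw [Complex.exp_eq_exp_iff_exists_int]
    exact ⟨-m, by push_cast; ring⟩
  let P : V →ₗ[ℂ] V :=
    { toFun := fun v => (2 * Real.pi : ℂ)⁻¹ • ∫ θ in (-Real.pi)..Real.pi, g v θ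
      map_add' := fun v w => by
        rw [← smul_add, ← intervalIntegral.integral_add (hgi v) (hgi w)]
        simp only [g, map_add, smul_add]
      map_smul' := fun c v => by
        rw [RingHom.id_apply, smul_comm c, ← intervalIntegral.integral_smul c]
        refine congrArg (fun x : V => (2 * Real.pi : ℂ)⁻¹ • x)
          (intervalIntegral.integral_congr fun θ _ => ?_)
        simp only [g, map_smul]
        exact smul_comm _ _ _ }
  have hP : ∀ v, P v = (2 * Real.pi : ℂ)⁻¹ • ∫ θ in (-Real.pi)..Real.pi, g v θ := fun v => rfl
  have hcomm : ∀ φ v, τ (circleElt φ) (P v) = Complex.exp (m * φ * Complex.I) • P v := by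
    intro φ v
    rw [hP, map_smul, smul_comm (Complex.exp _)]
    congr 1
    have h1 : τ (circleElt φ) (∫ θ in (-Real.pi)..Real.pi, g v θ)
        = ∫ θ in (-Real.pi)..Real.pi, τ (circleElt φ) (g v θ) :=
      ((LinearMap.toContinuousLinearMap (τ (circleElt φ))).intervalIntegral_comp_comm
        (hgi v)).symm
    have h2 : ∀ θ, τ (circleElt φ) (g v θ) = Complex.exp (m * φ * Complex.I) • g v (θ + φ) := by
      intro θ
      simp only [g, map_smul, smul_smul]
      rw [← Complex.exp_add, ← Module.End.mul_apply, ← map_mul, ← circleElt_add, add_comm φ θ]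
      congr 2
      push_cast; ring
    rw [h1]
    simp only [h2]
    rw [intervalIntegral.integral_smul, intervalIntegral.integral_comp_add_right]
    congr 1
    have := (hper v).intervalIntegral_add_eq (-Real.pi + φ) (-Real.pi)
    rw [show -Real.pi + φ + 2 * Real.pi = Real.pi + φ by ring,
      show -Real.pi + 2 * Real.pi = Real.pi by ring] at this
    exact this
  have hidem : IsIdempotentElem P := by
    refine LinearMap.ext fun v => ?_
    rw [Module.End.mul_apply, hP (P v)]
    have : ∀ θ, g (P v) θ = P v := fun θ => by
      simp only [g, hcomm, smul_smul]
      rw [← Complex.exp_add, neg_add_cancel, Complex.exp_zero, one_smul]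
    simp only [this]
    rw [intervalIntegral.integral_const, show Real.pi - -Real.pi = 2 * Real.pi by ring,
      ← Complex.coe_smul, smul_smul]
    push_cast
    rw [inv_mul_cancel₀ hpi, one_smul]
  refine ⟨Module.finrank ℂ (LinearMap.range P), ?_⟩
  rw [← (LinearMap.IsIdempotentElem.isProj_range P hidem).trace]
  rw [LinearMap.trace_eq_matrix_trace ℂ (Module.finBasis ℂ V), Matrix.trace, Finset.mul_sum]
  simp only [hτ.tauChar_eq_sum, Finset.mul_sum]
  rw [intervalIntegral.integral_finsetSum]
  · refine Finset.sum_congr rfl fun i _ => ?_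
    rw [Matrix.diag_apply, LinearMap.toMatrix_apply, hP, map_smul, Finsupp.smul_apply, smul_eq_mul,
      mul_inv_cancel_left₀ hpi]
    refine Eq.trans ?_ ((LinearMap.toContinuousLinearMap
      ((Module.finBasis ℂ V).coord i)).intervalIntegral_comp_comm (hgi _))
    refine intervalIntegral.integral_congr fun θ _ => ?_
    simp [g]
  · intro i _
    exact Continuous.intervalIntegrable
      ((by fun_prop : Continuous fun θ : ℝ => Complex.exp (-(m * θ * Complex.I))).mul
        ((hτ.continuous_coord _ _).comp continuous_circleElt)) _ _

theorem continuous_circle_char (hτ : IsTau ν τ) : Continuous fun θ => tauChar τ (circleElt θ) :=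
  hτ.continuous_tauChar.comp continuous_circleElt

/-- Schur orthogonality, transported to the circle by Weyl's integration formula. -/
theorem IsTau.integral_tauChar_circle (hτ : IsTau ν τ) :
    ∫ θ in (-Real.pi)..Real.pi, (tauChar τ (circleElt θ)) ^ 2 * (Real.sin θ : ℂ) ^ 2
      = Real.pi := by
  have h := hτ.integral_tauChar_mul (n := 0)
  have hc : Continuous fun x : ℝ => tauChar τ (circleElt (Real.arccos x)) ^ 2 :=
    ((continuous_circle_char hτ).comp Real.continuous_arccos).pow 2
  have h2 := weyl_integration (n := 0) _ hc
  have e1 : ∀ k : KGroup 0, tauChar τ (circleElt (Real.arccos (sp1Part k : ℍ[ℝ]).re)) ^ 2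
      = tauChar τ (sp1Part k) * tauChar τ (sp1Part k)⁻¹ := fun k => by
    rw [tauChar_inv, ← tauChar_eq_circle, sq]
  have e2 : ∀ θ : ℝ, tauChar τ (circleElt (Real.arccos (Real.cos θ))) = tauChar τ (circleElt θ) :=
    fun θ => tauChar_eq_of_re
      (Real.cos_arccos (Real.neg_one_le_cos θ) (Real.cos_le_one θ))
  simp only [e1, e2] at h2
  rw [h] at h2
  have hpi : (Real.pi : ℂ) ≠ 0 := by exact_mod_cast Real.pi_ne_zero
  field_simp at h2
  exact h2.symm

/-- Weyl's character formula for `Sp(1)`. The function `sin θ χ(e^{iθ})` has Fourier coefficients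
`D_m / 2i` with integers `D_m = d_{m-1} - d_{m+1}`, and by Schur orthogonality and Parseval
`∑ D_m² = 2`, so exactly one pair `±N` of frequencies occurs. -/
theorem IsTau.sin_mul_tauChar (hτ : IsTau ν τ) (θ : ℝ) :
    (Real.sin θ : ℂ) * tauChar τ (circleElt θ) = Real.sin ((ν + 1) * θ) := by
  have hT : Fact (0 < 2 * Real.pi) := ⟨Real.two_pi_pos⟩
  have hpi : (Real.pi : ℂ) ≠ 0 := by exact_mod_cast Real.pi_ne_zero
  let f : ℝ → ℂ := fun θ => (Real.sin θ : ℂ) * tauChar τ (circleElt θ)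
  have hfc : Continuous f :=
    (Complex.continuous_ofReal.comp Real.continuous_sin).mul (continuous_circle_char hτ)
  have hper : Function.Periodic f (2 * Real.pi) := fun θ => by
    simp only [f, circleElt_periodic, Real.sin_add_two_pi]
  let F : C(AddCircle (2 * Real.pi), ℂ) := ⟨hper.lift, hfc.quotient_lift _⟩
  have hF : ∀ x : ℝ, F x = f x := fun x => hper.lift_coe x
  choose d hd using hτ.exists_weight_multiplicity
  have hexp : ∀ (m : ℤ) (x : ℝ), fourier (T := 2 * Real.pi) m (x : AddCircle (2 * Real.pi))
      = Complex.exp (m * x * Complex.I) := fun m x => by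
    rw [fourier_coe_apply]
    congr 1
    push_cast
    field_simp
  have hcoeff : ∀ m : ℤ, fourierCoeff F m = (((d (m - 1) : ℤ) - d (m + 1) : ℤ) : ℂ)
      / (2 * Complex.I) := by
    intro m
    rw [fourierCoeff_eq_intervalIntegral _ _ (-Real.pi)]
    rw [show -Real.pi + 2 * Real.pi = Real.pi by ring]
    have e : ∀ x : ℝ, fourier (T := 2 * Real.pi) (-m) (x : AddCircle (2 * Real.pi)) • F x
        = (Complex.exp (-((m - 1 : ℤ) * x * Complex.I)) * tauChar τ (circleElt x)
          - Complex.exp (-((m + 1 : ℤ) * x * Complex.I)) * tauChar τ (circleElt x))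
            / (2 * Complex.I) := by
      intro x
      have h1 : Complex.exp (-((m - 1 : ℤ) * x * Complex.I))
          = Complex.exp (-m * x * Complex.I) * Complex.exp (x * Complex.I) := by
        rw [← Complex.exp_add]; congr 1; push_cast; ring
      have h2 : Complex.exp (-((m + 1 : ℤ) * x * Complex.I))
          = Complex.exp (-m * x * Complex.I) * Complex.exp (-x * Complex.I) := by
        rw [← Complex.exp_add]; congr 1; push_cast; ring
      rw [hexp, hF, smul_eq_mul, h1, h2]
      simp only [f]
      rw [Complex.ofReal_sin, Complex.sin, Int.cast_neg, div_eq_mul_inv _ (2 * Complex.I), mul_inv,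
        Complex.inv_I]
      ring
    simp only [e]
    have hi : ∀ m : ℤ, IntervalIntegrable (fun x : ℝ => Complex.exp (-(m * x * Complex.I))
        * tauChar τ (circleElt x)) volume (-Real.pi) Real.pi := fun m =>
      Continuous.intervalIntegrable
        ((by fun_prop : Continuous fun θ : ℝ => Complex.exp (-(m * θ * Complex.I))).mul
          (continuous_circle_char hτ)) _ _
    rw [intervalIntegral.integral_div, intervalIntegral.integral_sub (hi _) (hi _), hd, hd,
      Complex.real_smul]
    push_cast
    field_simp
  set D : ℤ → ℤ := fun m => (d (m - 1) : ℤ) - d (m + 1) with hD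
  have hnorm : ∀ m, ‖fourierCoeff F m‖ ^ 2 = (D m : ℝ) ^ 2 / 4 := by
    intro m
    rw [hcoeff, norm_div, norm_mul, Complex.norm_I, Complex.norm_intCast, div_pow, sq_abs]
    rw [Complex.norm_ofNat]
    change (D m : ℝ) ^ 2 / _ = _
    norm_num
  have hpars : ∑' m, (D m : ℝ) ^ 2 / 4 = 1 / 2 := by
    have h := tsum_sq_fourierCoeff (ContinuousMap.toLp 2 AddCircle.haarAddCircle ℂ F)
    simp only [fourierCoeff_toLp, hnorm] at h
    rw [h]
    have h2 : ∫ t : AddCircle (2 * Real.pi),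
        ‖(ContinuousMap.toLp 2 AddCircle.haarAddCircle ℂ F) t‖ ^ 2
        ∂AddCircle.haarAddCircle = ∫ t, ‖F t‖ ^ 2 ∂AddCircle.haarAddCircle := by
      refine integral_congr_ae ?_
      filter_upwards [ContinuousMap.coeFn_toLp (p := 2) (𝕜 := ℂ) AddCircle.haarAddCircle F]
        with t ht
      rw [ht]
    rw [h2]
    have h3 : ((∫ t, ‖F t‖ ^ 2 ∂AddCircle.haarAddCircle : ℝ) : ℂ) = 1 / 2 := by
      rw [← integral_complex_ofReal]
      have h4 : ∫ t, ((‖F t‖ ^ 2 : ℝ) : ℂ) ∂AddCircle.haarAddCircle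
          = fourierCoeff (fun t => ((‖F t‖ ^ 2 : ℝ) : ℂ)) 0 := by
        simp [fourierCoeff]
      rw [h4, fourierCoeff_eq_intervalIntegral _ _ (-Real.pi),
        show -Real.pi + 2 * Real.pi = Real.pi by ring]
      have h5 : ∀ x : ℝ, fourier (T := 2 * Real.pi) (-0) (x : AddCircle (2 * Real.pi))
          • ((‖F x‖ ^ 2 : ℝ) : ℂ) = (tauChar τ (circleElt x)) ^ 2 * (Real.sin x : ℂ) ^ 2 := by
        intro x
        rw [neg_zero, fourier_zero, one_smul, hF]
        push_cast
        rw [← Complex.mul_conj']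
        simp only [f, map_mul, Complex.conj_ofReal, hτ.conj_tauChar]
        rw [Complex.ofReal_sin]
        ring
      simp only [h5]
      rw [hτ.integral_tauChar_circle, Complex.real_smul]
      push_cast
      field_simp
    have h6 : ((∫ t, ‖F t‖ ^ 2 ∂AddCircle.haarAddCircle : ℝ) : ℂ) = ((1 / 2 : ℝ) : ℂ) := by
      rw [h3]; push_cast; rfl
    exact_mod_cast h6
  have hsummable : Summable fun m => (D m : ℝ) ^ 2 / 4 := by
    by_contra h
    rw [tsum_eq_zero_of_not_summable h] at hpars
    norm_num at hpars
  have hfin : ∀ s : Finset ℤ, ∑ m ∈ s, (D m) ^ 2 ≤ 2 := by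
    intro s
    have h := hsummable.sum_le_tsum s fun m _ => by positivity
    rw [hpars, ← Finset.sum_div] at h
    have : ∑ m ∈ s, (D m : ℝ) ^ 2 ≤ 2 := by linarith
    exact_mod_cast this
  have hodd : ∀ m, D (-m) = -D m := by
    have hd' : ∀ m, d (-m) = d m := by
      intro m
      have h1 : (2 * Real.pi : ℂ) * d (-m) = 2 * Real.pi * d m := by
        have h0 := intervalIntegral.integral_comp_neg (a := -Real.pi) (b := Real.pi)
          (fun θ : ℝ => Complex.exp (-(m * θ * Complex.I)) * tauChar τ (circleElt θ))
        rw [neg_neg] at h0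
        rw [← hd, ← hd, ← h0]
        refine intervalIntegral.integral_congr fun θ _ => ?_
        have : tauChar τ (circleElt (-θ)) = tauChar τ (circleElt θ) :=
          tauChar_eq_of_re (by simp [circleElt])
        simp only [this]
        push_cast
        ring_nf
      have h2 := mul_left_cancel₀ (by simp) h1
      exact_mod_cast h2
    intro m
    simp only [hD]
    rw [show -m - 1 = -(m + 1) by ring, show -m + 1 = -(m - 1) by ring, hd', hd']
    ring
  obtain ⟨N, hN0, hN⟩ : ∃ N : ℤ, 0 < N ∧ D N ≠ 0 := by
    by_contra! h
    have : ∀ m, D m = 0 := by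
      intro m
      rcases lt_trichotomy m 0 with hm | hm | hm
      · have := hodd (-m)
        rw [neg_neg, h (-m) (by omega)] at this
        simpa using this
      · have := hodd 0
        rw [neg_zero] at this
        rw [hm]; omega
      · exact h m hm
    simp [this] at hpars
  have hpair : D N ^ 2 = 1 := by
    have h := hfin {N, -N}
    rw [Finset.sum_pair (by omega), hodd, neg_sq] at h
    have : 0 < D N ^ 2 := by positivity
    omega
  have hzero : ∀ m, m ≠ N → m ≠ -N → D m = 0 := by
    intro m h1 h2
    have h := hfin {m, N, -N}
    rw [Finset.sum_insert (by simp [h1, h2]), Finset.sum_pair (by omega), hodd, neg_sq, hpair] at h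
    have : D m ^ 2 ≤ 0 := by linarith
    exact pow_eq_zero_iff two_ne_zero |>.1 (le_antisymm this (sq_nonneg _))
  have hsupp : ∀ m ∉ ({N, -N} : Finset ℤ), fourierCoeff F m = 0 := by
    intro m hm
    simp only [Finset.mem_insert, Finset.mem_singleton, not_or] at hm
    rw [hcoeff]
    change ((D m : ℤ) : ℂ) / _ = 0
    rw [hzero m hm.1 hm.2]; simp
  have hval : ∀ x : ℝ, f x = D N * Real.sin (N * x) := by
    intro x
    have h := (has_pointwise_sum_fourier_series_of_summable
      (summable_of_ne_finset_zero hsupp) (x : AddCircle (2 * Real.pi))).unique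
      (hasSum_sum_of_ne_finset_zero (s := {N, -N}) fun m hm => by rw [hsupp m hm, zero_smul])
    rw [hF, Finset.sum_pair (by omega), hexp, hexp, hcoeff, hcoeff] at h
    change f x = ((D N : ℤ) : ℂ) / _ * _ + ((D (-N) : ℤ) : ℂ) / _ * _ at h
    rw [h, hodd, Complex.ofReal_sin, Complex.sin]
    push_cast
    field_simp
    ring_nf
    simp only [Complex.I_sq]
    ring_nf
  -- the derivative at `θ = 0` evaluates the dimension of `τ`, which fixes the sign of `D N` and `N`
  have hderiv : (ν : ℂ) + 1 = D N * N := by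
    have h1 : HasDerivAt f (ν + 1) 0 := by
      rw [hasDerivAt_iff_tendsto_slope]
      have h2 : HasDerivAt (fun x : ℝ => (Real.sin x : ℂ)) 1 0 := by
        simpa using (Real.hasDerivAt_sin 0).ofReal_comp
      rw [hasDerivAt_iff_tendsto_slope] at h2
      have h3 : Tendsto (fun x => tauChar τ (circleElt x)) (𝓝[≠] (0 : ℝ)) (𝓝 (ν + 1)) := by
        have := ((continuous_circle_char hτ).tendsto 0).mono_left
          (nhdsWithin_le_nhds (s := {0}ᶜ))
        have e : circleElt 0 = 1 := by
          apply Subtype.ext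
          apply Quaternion.ext <;> simp [circleElt]
        rwa [e, hτ.tauChar_one] at this
      have h4 := h2.mul h3
      rw [one_mul] at h4
      refine h4.congr fun x => ?_
      simp [slope, f, mul_assoc]
    have h2 : HasDerivAt f (D N * N) 0 := by
      rw [show f = _ from funext hval]
      have := ((Real.hasDerivAt_sin (N * 0)).comp (0 : ℝ)
        ((hasDerivAt_id (0 : ℝ)).const_mul (N : ℝ))).ofReal_comp.const_mul (D N : ℂ)
      simpa using! this
    exact h1.unique h2
  have hprod : (ν : ℤ) + 1 = D N * N := by exact_mod_cast hderiv
  have hDN : D N = 1 := by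
    have h0 : (D N - 1) * (D N + 1) = 0 := by linear_combination hpair
    rcases mul_eq_zero.1 h0 with h | h
    · omega
    · rw [show D N = -1 by omega] at hprod; omega
  have hNν : N = ν + 1 := by rw [hDN] at hprod; omega
  have := hval θ
  rw [hDN, hNν] at this
  simpa [f] using this

end Character

/-! ### Moments of the first column of a random element of `Sp(n)` -/

section FirstColumn

variable {n : ℕ}

/-- The reflection `1 - 2 v v*` in a unit vector `v`, as an element of `Sp(n) ⊆ K`. -/
noncomputable def householder (v : Matrix (Fin n) Unit ℍ[ℝ]) (hv : vᴴ * v = 1) : KGroup n :=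
  (⟨1 - (2 : ℝ) • (v * vᴴ), by
    have h1 : (1 - (2 : ℝ) • (v * vᴴ))ᴴ = 1 - (2 : ℝ) • (v * vᴴ) := by
      rw [Matrix.conjTranspose_sub, conjTranspose_real_smul, Matrix.conjTranspose_mul,
        Matrix.conjTranspose_conjTranspose, Matrix.conjTranspose_one]
    have h2 : v * vᴴ * (v * vᴴ) = v * vᴴ := by
      rw [Matrix.mul_assoc, ← Matrix.mul_assoc vᴴ, hv, Matrix.one_mul]
    have h3 : (1 - (2 : ℝ) • (v * vᴴ)) * (1 - (2 : ℝ) • (v * vᴴ)) = 1 := by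
      simp only [mul_sub, sub_mul, one_mul, mul_one, smul_mul_assoc, mul_smul_comm, h2]
      module
    rw [Unitary.mem_iff, Matrix.star_eq_conjTranspose, h1]
    exact ⟨h3, h3⟩⟩, 1)

theorem spnMat_householder (v : Matrix (Fin n) Unit ℍ[ℝ]) (hv : vᴴ * v = 1) :
    spnMat (householder v hv) = 1 - (2 : ℝ) • (v * vᴴ) := rfl

/-- If `∫ ⟪X, Z⟫ |X|^{2m}` is invariant under rotations of the pair `(X, Z)`, its derivative along
the rotations vanishes. -/
theorem integral_rotation_identity (X Z : KGroup n → ℍ[ℝ]) (hX : Continuous X) (hZ : Continuous Z)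
    (m : ℕ)
    (hinv : ∀ φ : ℝ, ∫ k, inner ℝ (Real.cos φ • X k + Real.sin φ • Z k)
        (Real.cos φ • Z k - Real.sin φ • X k)
        * (‖Real.cos φ • X k + Real.sin φ • Z k‖ ^ 2) ^ m ∂(haarK n)
      = ∫ k, inner ℝ (X k) (Z k) * (‖X k‖ ^ 2) ^ m ∂(haarK n)) :
    ∫ k, ((‖Z k‖ ^ 2 - ‖X k‖ ^ 2) * (‖X k‖ ^ 2) ^ m
      + 2 * m * (inner ℝ (X k) (Z k)) ^ 2 * (‖X k‖ ^ 2) ^ (m - 1)) ∂(haarK n) = 0 := by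
  let a : ℝ → KGroup n → ℍ[ℝ] := fun φ k => Real.cos φ • X k + Real.sin φ • Z k
  let b : ℝ → KGroup n → ℍ[ℝ] := fun φ k => Real.cos φ • Z k - Real.sin φ • X k
  have ha : ∀ φ k, HasDerivAt (fun φ => a φ k) (b φ k) φ := fun φ k => by
    have := ((Real.hasDerivAt_cos φ).smul_const (X k)).add
      ((Real.hasDerivAt_sin φ).smul_const (Z k))
    refine this.congr_deriv ?_
    simp only [b]; module
  have hb : ∀ φ k, HasDerivAt (fun φ => b φ k) (-a φ k) φ := fun φ k => by
    have := ((Real.hasDerivAt_cos φ).smul_const (Z k)).sub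
      ((Real.hasDerivAt_sin φ).smul_const (X k))
    refine this.congr_deriv ?_
    simp only [a]; module
  have hac : Continuous (Function.uncurry a) := by
    simp only [Function.uncurry_def, a]
    exact ((Real.continuous_cos.comp continuous_fst).smul (hX.comp continuous_snd)).add
      ((Real.continuous_sin.comp continuous_fst).smul (hZ.comp continuous_snd))
  have hbc : Continuous (Function.uncurry b) := by
    simp only [Function.uncurry_def, b]
    exact ((Real.continuous_cos.comp continuous_fst).smul (hZ.comp continuous_snd)).sub
      ((Real.continuous_sin.comp continuous_fst).smul (hX.comp continuous_snd))
  have e0 : ∀ k, a 0 k = X k := fun k => by simp [a]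
  have e1 : ∀ k, b 0 k = Z k := fun k => by simp [b]
  have h := integral_deriv_eq_zero (n := n)
    (fun φ k => inner ℝ (a φ k) (b φ k) * (‖a φ k‖ ^ 2) ^ m)
    (fun φ k => (‖b φ k‖ ^ 2 - ‖a φ k‖ ^ 2) * (‖a φ k‖ ^ 2) ^ m
      + 2 * m * (inner ℝ (a φ k) (b φ k)) ^ 2 * (‖a φ k‖ ^ 2) ^ (m - 1))
    (fun φ k => by
      have h1 := ((ha φ k).inner ℝ (hb φ k)).mul ((ha φ k).norm_sq.pow m)
      refine (h1.congr_deriv ?_)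
      simp only [inner_neg_right, real_inner_self_eq_norm_sq, Pi.pow_apply]
      ring)
    ?_ (fun φ => ?_) (fun φ => ?_)
  · simpa only [e0, e1] using h
  · exact (((hbc.norm.pow 2).sub (hac.norm.pow 2)).mul ((hac.norm.pow 2).pow m)).add
      ((continuous_const.mul ((hac.inner hbc).pow 2)).mul ((hac.norm.pow 2).pow (m - 1)))
  · have h1 := hac.comp (Continuous.prodMk_right φ)
    have h2 := hbc.comp (Continuous.prodMk_right φ)
    exact (h1.inner h2).mul ((h1.norm.pow 2).pow m)
  · simp only [e0, e1]
    exact hinv φ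

variable [NeZero n]

/-- The entries of the first column of the `Sp(n)`-component. -/
noncomputable def firstCol (k : KGroup n) (i : Fin n) : ℍ[ℝ] := spnMat k i 0

theorem continuous_firstCol (i : Fin n) : Continuous fun k : KGroup n => firstCol k i :=
  (continuous_spnMat.matrix_elem i 0)

theorem sum_norm_firstCol (k : KGroup n) : ∑ i, ‖firstCol k i‖ ^ 2 = 1 := by
  have h : (spnMat k)ᴴ * spnMat k = 1 := (Unitary.mem_iff.1 k.1.2).1
  have h2 := congrFun (congrFun h 0) 0
  simp only [Matrix.mul_apply, Matrix.conjTranspose_apply, Matrix.one_apply_eq,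
    star_mul_self_real, sum_coe_quaternion] at h2
  have h3 : ((∑ i, ‖spnMat k i 0‖ ^ 2 : ℝ) : ℍ[ℝ]) = ((1 : ℝ) : ℍ[ℝ]) := by simpa using h2
  exact Quaternion.coe_injective h3

/-- The Householder reflection in `(cos (φ/2), sin (φ/2) q)`, supported in the coordinates `0` and
`j`, rotates the pair `(u₀₀, q̄ u_{j0})` of entries of the first column by `φ` and changes the
sign of its first member. Invariance of Haar measure under it yields the hypothesis of
`integral_rotation_identity`. -/
theorem integral_firstCol_unit (j : Fin n) (hj : j ≠ 0) (q : Sp1) (m : ℕ) :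
    ∫ k : KGroup n, ((‖firstCol k j‖ ^ 2 - ‖firstCol k 0‖ ^ 2) * (‖firstCol k 0‖ ^ 2) ^ m
      + 2 * m * (inner ℝ (firstCol k 0) (star (q : ℍ[ℝ]) * firstCol k j)) ^ 2
        * (‖firstCol k 0‖ ^ 2) ^ (m - 1)) ∂(haarK n) = 0 := by
  have hq1 : star (q : ℍ[ℝ]) * q = 1 := by rw [star_mul_self_real, norm_Sp1]; simp
  have hnorm : ∀ x : ℍ[ℝ], ‖star (q : ℍ[ℝ]) * x‖ = ‖x‖ := fun x => by
    rw [norm_mul, norm_star, norm_Sp1, one_mul]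
  have h := integral_rotation_identity (n := n) (fun k => firstCol k 0)
    (fun k => star (q : ℍ[ℝ]) * firstCol k j) (continuous_firstCol 0)
    (continuous_const.mul (continuous_firstCol j)) m ?_
  · simpa only [hnorm] using h
  -- The reflection reverses the sign, so all these integrals vanish.
  suffices hneg : ∀ φ : ℝ, ∫ k : KGroup n, inner ℝ (Real.cos φ • firstCol k 0
        + Real.sin φ • (star (q : ℍ[ℝ]) * firstCol k j))
        (Real.cos φ • (star (q : ℍ[ℝ]) * firstCol k j) - Real.sin φ • firstCol k 0)
        * (‖Real.cos φ • firstCol k 0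
          + Real.sin φ • (star (q : ℍ[ℝ]) * firstCol k j)‖ ^ 2) ^ m ∂(haarK n)
      = -∫ k : KGroup n, inner ℝ (firstCol k 0) (star (q : ℍ[ℝ]) * firstCol k j)
        * (‖firstCol k 0‖ ^ 2) ^ m ∂(haarK n) by
    have h0 := hneg 0
    simp only [Real.cos_zero, Real.sin_zero, one_smul, zero_smul, add_zero, sub_zero] at h0
    intro φ
    rw [hneg φ]
    linarith
  intro φ
  let c := Real.cos (φ / 2)
  let s := Real.sin (φ / 2)
  have hcos : Real.cos φ = 2 * c ^ 2 - 1 := by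
    rw [show φ = 2 * (φ / 2) by ring, Real.cos_two_mul]
  have hsin : Real.sin φ = 2 * s * c := by
    rw [show φ = 2 * (φ / 2) by ring, Real.sin_two_mul]
  have hcs : s ^ 2 + c ^ 2 = 1 := Real.sin_sq_add_cos_sq (φ / 2)
  let v : Matrix (Fin n) Unit ℍ[ℝ] :=
    Matrix.of fun i _ => if i = 0 then (c : ℍ[ℝ]) else if i = j then s • (q : ℍ[ℝ]) else 0
  have hvsum : ∀ x : Fin n → ℍ[ℝ], ∑ i, star (v i ()) * x i
      = c • x 0 + s • (star (q : ℍ[ℝ]) * x j) := by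
    intro x
    rw [Fintype.sum_eq_add 0 j hj.symm]
    · simp [v, hj, Quaternion.coe_mul_eq_smul]
    · rintro i ⟨h1, h2⟩
      simp [v, h1, h2]
  have hv : vᴴ * v = 1 := by
    ext1 a b
    rw [Matrix.mul_apply]
    simp only [Matrix.conjTranspose_apply]
    rw [hvsum (fun i => v i b)]
    simp only [v, Matrix.of_apply, if_true, if_neg hj, mul_smul_comm, hq1, Matrix.one_apply_eq]
    rw [← Quaternion.coe_mul_eq_smul, ← Quaternion.coe_mul, smul_smul, Algebra.smul_def, mul_one]
    change ((c * c : ℝ) : ℍ[ℝ]) + ((s * s : ℝ) : ℍ[ℝ]) = 1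
    rw [← Quaternion.coe_add, show c * c + s * s = 1 by linarith, Quaternion.coe_one]
  have hrow : ∀ k i, firstCol (householder v hv * k) i
      = firstCol k i - (2 : ℝ) • (v i () * (c • firstCol k 0
        + s • (star (q : ℍ[ℝ]) * firstCol k j))) := by
    intro k i
    rw [← hvsum]
    rw [firstCol, spnMat_mul, spnMat_householder, Matrix.sub_mul, Matrix.one_mul, Matrix.sub_apply,
      Matrix.smul_mul, Matrix.smul_apply, Matrix.mul_assoc, Matrix.mul_apply]
    simp [Matrix.mul_apply, firstCol]
  have hy0 : ∀ k, firstCol (householder v hv * k) 0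
      = -(Real.cos φ • firstCol k 0 + Real.sin φ • (star (q : ℍ[ℝ]) * firstCol k j)) := by
    intro k
    rw [hrow, hcos, hsin]
    simp only [v, Matrix.of_apply, if_true, Quaternion.coe_mul_eq_smul]
    module
  have hyj : ∀ k, star (q : ℍ[ℝ]) * firstCol (householder v hv * k) j
      = Real.cos φ • (star (q : ℍ[ℝ]) * firstCol k j) - Real.sin φ • firstCol k 0 := by
    intro k
    rw [hrow, hcos, hsin]
    simp only [v, Matrix.of_apply, if_neg hj, if_true, mul_sub, mul_smul_comm, smul_mul_assoc]
    rw [← mul_assoc (star (q : ℍ[ℝ])) (q : ℍ[ℝ]), hq1, one_mul]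
    have hc2 : c ^ 2 = 1 - s ^ 2 := by linarith
    rw [hc2]
    module
  have hinv := integral_haarK_mul_left (n := n) (fun k => inner ℝ (firstCol k 0)
    (star (q : ℍ[ℝ]) * firstCol k j) * (‖firstCol k 0‖ ^ 2) ^ m) (householder v hv)
  simp only [hy0, hyj, inner_neg_left, norm_neg, neg_mul, integral_neg] at hinv
  linarith

/-- Parseval's identity for the orthogonal basis `y`, `-i y`, `-j y`, `-k y` of `ℍ`. -/
theorem sum_inner_units (x y : ℍ[ℝ]) :
    (inner ℝ x (star ((1 : Sp1) : ℍ[ℝ]) * y)) ^ 2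
      + (inner ℝ x (star (unitElt 0 1 0 0 (by norm_num) : ℍ[ℝ]) * y)) ^ 2
      + (inner ℝ x (star (unitElt 0 0 1 0 (by norm_num) : ℍ[ℝ]) * y)) ^ 2
      + (inner ℝ x (star (unitElt 0 0 0 1 (by norm_num) : ℍ[ℝ]) * y)) ^ 2
      = ‖x‖ ^ 2 * ‖y‖ ^ 2 := by
  simp only [Quaternion.inner_def, sq ‖x‖, sq ‖y‖, ← Quaternion.normSq_eq_norm_mul_self,
    Quaternion.normSq_def']
  simp
  ring

/-- The identities of `integral_firstCol_unit` for `q = 1, i, j, k`, added up. -/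
theorem integral_firstCol_other (j : Fin n) (hj : j ≠ 0) (m : ℕ) :
    ((m : ℝ) + 2) * ∫ k : KGroup n, (‖firstCol k 0‖ ^ 2) ^ m * ‖firstCol k j‖ ^ 2 ∂(haarK n)
      = 2 * ∫ k : KGroup n, (‖firstCol k 0‖ ^ 2) ^ (m + 1) ∂(haarK n) := by
  have h0 := fun q => integral_firstCol_unit j hj q m
  have c0 := (continuous_firstCol (n := n) 0)
  have cj := (continuous_firstCol (n := n) j)
  have hint : ∀ q : Sp1, Integrable (fun k : KGroup n =>
      ((‖firstCol k j‖ ^ 2 - ‖firstCol k 0‖ ^ 2) * (‖firstCol k 0‖ ^ 2) ^ m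
      + 2 * m * (inner ℝ (firstCol k 0) (star (q : ℍ[ℝ]) * firstCol k j)) ^ 2
        * (‖firstCol k 0‖ ^ 2) ^ (m - 1))) (haarK n) := fun q =>
    integrable_haarK ((((cj.norm.pow 2).sub (c0.norm.pow 2)).mul ((c0.norm.pow 2).pow m)).add
      ((continuous_const.mul ((c0.inner (continuous_const.mul cj)).pow 2)).mul
        ((c0.norm.pow 2).pow (m - 1))))
  let Q : Fin 4 → Sp1 := ![1, unitElt 0 1 0 0 (by norm_num), unitElt 0 0 1 0 (by norm_num),
    unitElt 0 0 0 1 (by norm_num)]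
  have hsum := integral_finsetSum Finset.univ fun i (_ : i ∈ Finset.univ) => hint (Q i)
  simp only [h0, Finset.sum_const_zero] at hsum
  have i1 : Integrable (fun k : KGroup n => (‖firstCol k 0‖ ^ 2) ^ m * ‖firstCol k j‖ ^ 2)
    (haarK n) := integrable_haarK (((c0.norm.pow 2).pow m).mul (cj.norm.pow 2))
  have i2 : Integrable (fun k : KGroup n => (‖firstCol k 0‖ ^ 2) ^ (m + 1)) (haarK n) :=
    integrable_haarK ((c0.norm.pow 2).pow (m + 1))
  have e : ∀ k : KGroup n, (2 * m + 4 : ℝ) * ((‖firstCol k 0‖ ^ 2) ^ m * ‖firstCol k j‖ ^ 2)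
      - 4 * (‖firstCol k 0‖ ^ 2) ^ (m + 1)
      = ∑ i, ((‖firstCol k j‖ ^ 2 - ‖firstCol k 0‖ ^ 2) * (‖firstCol k 0‖ ^ 2) ^ m
      + 2 * m * (inner ℝ (firstCol k 0) (star (Q i : ℍ[ℝ]) * firstCol k j)) ^ 2
        * (‖firstCol k 0‖ ^ 2) ^ (m - 1)) := by
    intro k
    have hs := sum_inner_units (firstCol k 0) (firstCol k j)
    have hm : (m : ℝ) * (‖firstCol k 0‖ ^ 2 * (‖firstCol k 0‖ ^ 2) ^ (m - 1))
        = m * (‖firstCol k 0‖ ^ 2) ^ m := by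
      cases m with
      | zero => simp
      | succ m => rw [Nat.add_sub_cancel]; ring
    rw [Fin.sum_univ_four]
    simp only [Q, Matrix.cons_val]
    linear_combination (-2 * m * (‖firstCol k 0‖ ^ 2) ^ (m - 1)) * hs
      - 2 * ‖firstCol k j‖ ^ 2 * hm
  have h4 : ∫ k : KGroup n, ((2 * m + 4 : ℝ) * ((‖firstCol k 0‖ ^ 2) ^ m * ‖firstCol k j‖ ^ 2)
      - 4 * (‖firstCol k 0‖ ^ 2) ^ (m + 1)) ∂(haarK n) = 0 := by
    rw [← hsum]
    exact integral_congr_ae (ae_of_all _ fun k => e k)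
  rw [integral_sub (i1.const_mul _) (i2.const_mul _), integral_const_mul,
    integral_const_mul] at h4
  linarith

/-- The recursion for the moments of `|u₀₀|²`, from `∑ |u_{j0}|² = 1` and
`integral_firstCol_other`. -/
theorem moment_firstCol_succ (m : ℕ) :
    ((2 * n + m : ℕ) : ℝ) * ∫ k : KGroup n, (‖firstCol k 0‖ ^ 2) ^ (m + 1) ∂(haarK n)
      = (m + 2) * ∫ k : KGroup n, (‖firstCol k 0‖ ^ 2) ^ m ∂(haarK n) := by
  have hc := fun j => (continuous_firstCol (n := n) j)
  have h1 : ∫ k : KGroup n, (‖firstCol k 0‖ ^ 2) ^ m ∂(haarK n)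
      = ∑ j, ∫ k : KGroup n, (‖firstCol k 0‖ ^ 2) ^ m * ‖firstCol k j‖ ^ 2 ∂(haarK n) := by
    rw [← integral_finsetSum]
    · refine integral_congr_ae (ae_of_all _ fun k => ?_)
      simp only
      rw [← Finset.mul_sum, sum_norm_firstCol, mul_one]
    · exact fun j _ => integrable_haarK ((((hc 0).norm.pow 2).pow m).mul ((hc j).norm.pow 2))
  have h2 : ∀ j ∈ (Finset.univ : Finset (Fin n)).erase 0,
      ∫ k : KGroup n, (‖firstCol k 0‖ ^ 2) ^ m * ‖firstCol k j‖ ^ 2 ∂(haarK n)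
      = 2 / (m + 2) * ∫ k : KGroup n, (‖firstCol k 0‖ ^ 2) ^ (m + 1) ∂(haarK n) := by
    intro j hj
    have := integral_firstCol_other j (Finset.ne_of_mem_erase hj) m
    have hm : (m : ℝ) + 2 ≠ 0 := by positivity
    field_simp
    linarith
  rw [h1, ← Finset.add_sum_erase _ _ (Finset.mem_univ 0), Finset.sum_congr rfl h2,
    Finset.sum_const, Finset.card_erase_of_mem (Finset.mem_univ 0), Finset.card_univ,
    Fintype.card_fin, nsmul_eq_mul, Nat.cast_sub NeZero.one_le]
  simp only [← pow_succ]
  have hm : (m : ℝ) + 2 ≠ 0 := by positivity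
  field_simp
  push_cast
  ring

end FirstColumn

/-! ### Gauss's hypergeometric series -/

section Hypergeometric

/-- The rising factorial `(a)_k = a (a + 1) ⋯ (a + k - 1)`. -/
noncomputable def risingFac (a : ℂ) (k : ℕ) : ℂ := ∏ j ∈ Finset.range k, (a + j)

theorem risingFac_zero (a : ℂ) : risingFac a 0 = 1 := by simp [risingFac]

theorem risingFac_succ (a : ℂ) (k : ℕ) : risingFac a (k + 1) = risingFac a k * (a + k) := by
  simp [risingFac, Finset.prod_range_succ]

theorem risingFac_ne_zero {a : ℂ} (ha : ∀ m : ℕ, a ≠ -m) (k : ℕ) : risingFac a k ≠ 0 :=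
  Finset.prod_ne_zero_iff.2 fun j _ h => ha j (eq_neg_of_add_eq_zero_left h)

/-- The coefficients `(a)_k (b)_k / ((c)_k k!)` of Gauss's hypergeometric series. -/
noncomputable def hypCoeff (a b c : ℂ) (k : ℕ) : ℂ :=
  risingFac a k * risingFac b k / (risingFac c k * k.factorial)

/-- The hypergeometric function `₂F₁(a, b; c; z)` at real `z`. -/
noncomputable def hypF (a b c : ℂ) (z : ℝ) : ℂ := ∑' k, hypCoeff a b c k * (z : ℂ) ^ k

theorem hypCoeff_zero (a b c : ℂ) : hypCoeff a b c 0 = 1 := by simp [hypCoeff, risingFac_zero]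

theorem hypCoeff_succ (a b : ℂ) {c : ℂ} (hc : ∀ m : ℕ, c ≠ -m) (k : ℕ) :
    ((k : ℂ) + 1) * (k + c) * hypCoeff a b c (k + 1) = (k + a) * (k + b) * hypCoeff a b c k := by
  have h1 := risingFac_ne_zero hc k
  have h2 : c + k ≠ 0 := fun h => hc k (eq_neg_of_add_eq_zero_left h)
  have h3 : (k.factorial : ℂ) ≠ 0 := by exact_mod_cast k.factorial_ne_zero
  have h4 : (k : ℂ) + 1 ≠ 0 := by exact_mod_cast k.succ_ne_zero
  rw [hypCoeff, hypCoeff, risingFac_succ, risingFac_succ, risingFac_succ, Nat.factorial_succ]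
  push_cast
  rw [add_comm (k : ℂ) c]
  field_simp
  ring

theorem tendsto_hyp_ratio (a b c : ℂ) :
    Tendsto (fun k : ℕ => ((k : ℂ) + a) * (k + b) / ((k + 1) * (k + c))) atTop (𝓝 1) := by
  have h : ∀ a : ℂ, Tendsto (fun k : ℕ => ((k : ℂ) + a) / k) atTop (𝓝 1) := fun a => by
    have h1 : Tendsto (fun k : ℕ => a / (k : ℂ)) atTop (𝓝 0) :=
      tendsto_const_div_atTop_nhds_zero_nat a
    have h2 := h1.const_add 1
    rw [add_zero] at h2
    refine h2.congr' ?_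
    filter_upwards [eventually_ne_atTop 0] with k hk
    have : (k : ℂ) ≠ 0 := by exact_mod_cast hk
    field_simp
  have h2 := ((h a).mul (h b)).div ((h 1).mul (h c)) (by norm_num)
  simp only [mul_one, div_one] at h2
  refine h2.congr' ?_
  filter_upwards [eventually_ne_atTop 0] with k hk
  have : (k : ℂ) ≠ 0 := by exact_mod_cast hk
  simp only [Pi.div_apply]
  rw [div_mul_div_comm, div_mul_div_comm, div_div_div_cancel_right₀ (mul_ne_zero this this)]

theorem summable_hypCoeff (a b : ℂ) {c : ℂ} (hc : ∀ m : ℕ, c ≠ -m) {z : ℂ} (hz : ‖z‖ < 1) :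
    Summable fun k => ‖hypCoeff a b c k * z ^ k‖ := by
  have hr : ‖z‖ < (1 + ‖z‖) / 2 := by linarith
  refine summable_of_ratio_norm_eventually_le (r := (1 + ‖z‖) / 2) (by linarith) ?_
  have h1 : Tendsto (fun k : ℕ => ‖((k : ℂ) + a) * (k + b) / ((k + 1) * (k + c))‖ * ‖z‖) atTop
      (𝓝 (1 * ‖z‖)) := by
    have := (tendsto_hyp_ratio a b c).norm
    rw [norm_one] at this
    exact this.mul_const _
  rw [one_mul] at h1
  filter_upwards [h1.eventually (eventually_le_nhds hr)] with k hk
  have h2 : (k : ℂ) + c ≠ 0 := fun h => hc k (by linear_combination h)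
  have h4 : (k : ℂ) + 1 ≠ 0 := by exact_mod_cast k.succ_ne_zero
  have e : hypCoeff a b c (k + 1) * z ^ (k + 1)
      = ((k : ℂ) + a) * (k + b) / ((k + 1) * (k + c)) * z * (hypCoeff a b c k * z ^ k) := by
    have := hypCoeff_succ a b hc k
    field_simp
    rw [pow_succ]
    linear_combination (z ^ k * z) * this
  rw [norm_norm, norm_norm, e, norm_mul, norm_mul]
  exact mul_le_mul_of_nonneg_right hk (norm_nonneg _)

theorem choose_eq_risingFac_div_factorial (d : ℂ) (k : ℕ) :
    Ring.choose (d + k - 1) k = risingFac d k / k.factorial := by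
  have h3 : (k.factorial : ℂ) ≠ 0 := by exact_mod_cast k.factorial_ne_zero
  have h : ∀ k : ℕ, Polynomial.eval d (ascPochhammer ℂ k) = risingFac d k := fun k => by
    induction k with
    | zero => simp [risingFac_zero]
    | succ k ih => rw [ascPochhammer_succ_eval, ih, risingFac_succ]
  rw [← Ring.multichoose_eq, eq_div_iff h3, ← h, ← Polynomial.ascPochhammer_smeval_eq_eval,
    ← Ring.factorial_nsmul_multichoose_eq_ascPochhammer, nsmul_eq_mul, mul_comm]

/-- The binomial series. -/
theorem hasSum_binomial (d : ℂ) {z : ℂ} (hz : ‖z‖ < 1) :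
    HasSum (fun k => risingFac d k / k.factorial * z ^ k) (1 / (1 - z) ^ d) := by
  have h := (Complex.one_div_one_sub_cpow_hasFPowerSeriesOnBall_zero d).hasSum (y := z)
    (by simpa [enorm_eq_nnnorm, ← NNReal.coe_lt_one] using hz)
  rw [zero_add] at h
  simpa only [FormalMultilinearSeries.ofScalars_apply_eq, smul_eq_mul,
    choose_eq_risingFac_div_factorial] using h

theorem summable_binomial (d : ℂ) {z : ℂ} (hz : ‖z‖ < 1) :
    Summable fun k => ‖risingFac d k / k.factorial * z ^ k‖ := by
  have h := summable_hypCoeff d 1 (c := 1) (z := z) (fun m h => by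
    have := congrArg Complex.re h
    simp at this
    linarith [m.cast_nonneg (α := ℝ)]) hz
  refine h.congr fun k => ?_
  have h1 : risingFac 1 k ≠ 0 := risingFac_ne_zero (fun m h => by
    have := congrArg Complex.re h
    simp at this
    linarith [m.cast_nonneg (α := ℝ)]) k
  congr 2
  rw [hypCoeff]
  field_simp

theorem risingFac_succ_eq_gammaSeq {s : ℂ} (hs : ∀ m : ℕ, s ≠ -m) {k : ℕ} (hk : k ≠ 0) :
    risingFac s (k + 1) = (k : ℂ) ^ s * k.factorial / Complex.GammaSeq s k := by
  have h1 := risingFac_ne_zero hs (k + 1)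
  have h2 : (k : ℂ) ^ s ≠ 0 := by
    rw [Ne, Complex.cpow_eq_zero_iff]; simp [hk]
  have h3 : (k.factorial : ℂ) ≠ 0 := by exact_mod_cast k.factorial_ne_zero
  change _ = _ / (_ / risingFac s (k + 1))
  field_simp

/-- By the product formula for the Gamma function, `(a)_k (b)_k / ((c)_k (d)_k)` has a limit
when `a + b = c + d`. -/
theorem tendsto_risingFac_ratio {a b c d : ℂ} (ha : ∀ m : ℕ, a ≠ -m) (hb : ∀ m : ℕ, b ≠ -m)
    (hc : ∀ m : ℕ, c ≠ -m) (hd : ∀ m : ℕ, d ≠ -m) (h : a + b = c + d) :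
    Tendsto (fun k => risingFac a k * risingFac b k / (risingFac c k * risingFac d k)) atTop
      (𝓝 (Complex.Gamma c * Complex.Gamma d / (Complex.Gamma a * Complex.Gamma b))) := by
  rw [← tendsto_add_atTop_iff_nat 1]
  have h1 := ((Complex.GammaSeq_tendsto_Gamma c).mul (Complex.GammaSeq_tendsto_Gamma d)).div
    ((Complex.GammaSeq_tendsto_Gamma a).mul (Complex.GammaSeq_tendsto_Gamma b))
    (mul_ne_zero (Complex.Gamma_ne_zero ha) (Complex.Gamma_ne_zero hb))
  refine h1.congr' ?_
  filter_upwards [eventually_ne_atTop 0] with k hk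
  have hk' : (k : ℂ) ≠ 0 := by exact_mod_cast hk
  have h2 : ∀ s : ℂ, (k : ℂ) ^ s ≠ 0 := fun s => by
    rw [Ne, Complex.cpow_eq_zero_iff]; simp [hk]
  have h3 : (k.factorial : ℂ) ≠ 0 := by exact_mod_cast k.factorial_ne_zero
  rw [risingFac_succ_eq_gammaSeq ha hk, risingFac_succ_eq_gammaSeq hb hk,
    risingFac_succ_eq_gammaSeq hc hk, risingFac_succ_eq_gammaSeq hd hk]
  have h4 : (k : ℂ) ^ a * (k : ℂ) ^ b = (k : ℂ) ^ c * (k : ℂ) ^ d := by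
    rw [← Complex.cpow_add _ _ hk', h, Complex.cpow_add _ _ hk']
  simp only [Pi.div_apply]
  rw [div_mul_div_comm, div_mul_div_comm, div_div_div_eq]
  have e1 : (k : ℂ) ^ a * k.factorial * ((k : ℂ) ^ b * k.factorial)
      = (k : ℂ) ^ c * k.factorial * ((k : ℂ) ^ d * k.factorial) := by
    linear_combination ((k.factorial : ℂ) * k.factorial) * h4
  rw [e1, mul_comm (Complex.GammaSeq a k * Complex.GammaSeq b k), mul_div_mul_left _ _ (by
    exact mul_ne_zero (mul_ne_zero (h2 _) h3) (mul_ne_zero (h2 _) h3))]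

theorem norm_add_natCast_ge {c : ℂ} {x : ℝ} (hc : x ≤ c.re) (k : ℕ) : x + k ≤ ‖c + k‖ :=
  calc x + k ≤ (c + k).re := by simp [hc]
    _ ≤ _ := Complex.re_le_norm _

/-- The limit in `tendsto_risingFac_ratio` is approached at the rate `1 / k`. -/
theorem exists_risingFac_ratio_bound {a b c d : ℂ} (ha : ∀ m : ℕ, a ≠ -m) (hb : ∀ m : ℕ, b ≠ -m)
    (hc : 1 ≤ c.re) (hd : ∀ m : ℕ, d ≠ -m) (hd0 : 0 ≤ d.re) (h : a + b = c + d) :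
    ∃ C : ℝ, ∀ k : ℕ, k ≠ 0 →
      ‖risingFac a k * risingFac b k / (risingFac c k * risingFac d k)
        - Complex.Gamma c * Complex.Gamma d / (Complex.Gamma a * Complex.Gamma b)‖ ≤ C / k := by
  have hc' : ∀ m : ℕ, c ≠ -m := fun m hm => by
    rw [hm] at hc; simp at hc; linarith [m.cast_nonneg (α := ℝ)]
  have hlim := tendsto_risingFac_ratio ha hb hc' hd h
  set G := fun k => risingFac a k * risingFac b k / (risingFac c k * risingFac d k) with hG
  set B := Complex.Gamma c * Complex.Gamma d / (Complex.Gamma a * Complex.Gamma b)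
  obtain ⟨M, hM⟩ := hlim.norm.bddAbove_range
  have hM' : ∀ k, ‖G k‖ ≤ M := fun k => hM ⟨k, rfl⟩
  have hstep : ∀ k : ℕ, k ≠ 0 → ‖G (k + 1) - G k‖ ≤
      M * ‖a * b - c * d‖ * (1 / k - 1 / ((k + 1 : ℕ) : ℝ)) := fun k hk => by
    have hk0 : (0 : ℝ) < k := by positivity
    have n1 := norm_add_natCast_ge hc k
    have n2 := norm_add_natCast_ge hd0 k
    have c1 : c + k ≠ 0 := fun h => by rw [h, norm_zero] at n1; linarith
    have d1 : d + k ≠ 0 := fun h => by rw [h, norm_zero] at n2; linarith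
    have e : G (k + 1) - G k = G k * ((a * b - c * d) / ((c + k) * (d + k))) := by
      have r1 := risingFac_ne_zero hc' k
      have r2 := risingFac_ne_zero hd k
      simp only [hG, risingFac_succ]
      field_simp
      linear_combination (risingFac a k * risingFac b k * k) * h
    rw [e, norm_mul, norm_div (a * b - c * d), norm_mul (c + k)]
    have e2 : (1 : ℝ) / k - 1 / ((k + 1 : ℕ) : ℝ) = 1 / ((1 + k) * (0 + k)) := by
      push_cast; field_simp; ring
    rw [e2, mul_assoc, mul_one_div]
    have hM0 : 0 ≤ M := (norm_nonneg _).trans (hM' 0)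
    gcongr
    exact hM' k
  have hM0 : 0 ≤ M := (norm_nonneg _).trans (hM' 0)
  refine ⟨M * ‖a * b - c * d‖, fun k hk => ?_⟩
  have hk0 : (0 : ℝ) < k := by positivity
  have key : ∀ m : ℕ, ‖G (k + m) - G k‖ ≤
      M * ‖a * b - c * d‖ * (1 / k - 1 / ((k + m : ℕ) : ℝ)) := fun m => by
    induction m with
    | zero => simp
    | succ m ih =>
      calc ‖G (k + (m + 1)) - G k‖ = ‖(G (k + m + 1) - G (k + m)) + (G (k + m) - G k)‖ := by
            rw [← add_assoc]; congr 1; ring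
        _ ≤ _ := (norm_add_le _ _).trans (add_le_add (hstep (k + m) (by omega)) ih)
        _ = _ := by rw [← add_assoc]; ring
  have key2 : ∀ m : ℕ, ‖G (m + k) - G k‖ ≤ M * ‖a * b - c * d‖ / k := fun m => by
    rw [add_comm]
    refine (key m).trans ?_
    rw [div_eq_mul_one_div (M * _) (k : ℝ)]
    have h0 : (0 : ℝ) ≤ 1 / ((k + m : ℕ) : ℝ) := by positivity
    exact mul_le_mul_of_nonneg_left (by linarith) (by positivity)
  rw [norm_sub_rev]
  exact le_of_tendsto (((hlim.comp (tendsto_add_atTop_nat k)).sub_const (G k)).norm)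
    (Eventually.of_forall key2)

/-- The coefficients of the binomial series `(1 - z)^{-d}` with `d` purely imaginary are `O(1 /
k)`, by the product formula for the Gamma function. -/
theorem exists_risingFac_div_factorial_bound {d : ℂ} (hd : ∀ m : ℕ, d ≠ -m) (hd0 : d.re = 0) :
    ∃ C : ℝ, 0 ≤ C ∧ ∀ k : ℕ, k ≠ 0 → ‖risingFac d k / k.factorial‖ ≤ C / k := by
  have h1 := ((Complex.GammaSeq_tendsto_Gamma d).inv₀ (Complex.Gamma_ne_zero hd)).norm
  obtain ⟨M, hM⟩ := h1.bddAbove_range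
  have hM' : ∀ k, ‖(Complex.GammaSeq d k)⁻¹‖ ≤ M := fun k => hM ⟨k, rfl⟩
  have hM0 : 0 ≤ M := (norm_nonneg _).trans (hM' 0)
  refine ⟨max M ‖d‖, by positivity, fun k hk => ?_⟩
  obtain ⟨k, rfl⟩ := Nat.exists_eq_succ_of_ne_zero hk
  rcases eq_or_ne k 0 with rfl | hk0
  · simp [risingFac]
  rw [Nat.succ_eq_add_one, risingFac_succ_eq_gammaSeq hd hk0]
  have h3 : (k.factorial : ℝ) ≠ 0 := by exact_mod_cast k.factorial_ne_zero
  have h4 : ‖(k : ℂ) ^ d‖ = 1 := by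
    rw [Complex.norm_natCast_cpow_of_pos (Nat.pos_of_ne_zero hk0), hd0, Real.rpow_zero]
  rw [Nat.factorial_succ, norm_div, norm_div, norm_mul, h4]
  have h5 := hM' k
  rw [norm_inv] at h5
  push_cast
  rw [norm_mul, Complex.norm_natCast]
  have h6 : ‖(k : ℂ) + 1‖ = k + 1 := by
    have := Complex.norm_natCast (k + 1)
    push_cast at this; exact this
  rw [h6]
  calc _ = (‖Complex.GammaSeq d k‖)⁻¹ / ((k : ℝ) + 1) := by field_simp
    _ ≤ _ := by gcongr; exact h5.trans (le_max_left _ _)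

/-- On the unit interval `₂F₁(a, b; c; z)` with `a + b = c + d`, `d` purely imaginary, differs
from `B (1 - z)^{-d}` by a power series with absolutely summable coefficients: the coefficients of
the two series differ by `O(1 / k²)`. -/
theorem exists_hypF_eq {a b c d : ℂ} (ha : ∀ m : ℕ, a ≠ -m) (hb : ∀ m : ℕ, b ≠ -m)
    (hc : 1 ≤ c.re) (hd : ∀ m : ℕ, d ≠ -m) (hd0 : d.re = 0) (h : a + b = c + d) :
    ∃ e : ℕ → ℂ, Summable (fun k => ‖e k‖) ∧ ∀ z : ℝ, |z| < 1 → hypF a b c z =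
      Complex.Gamma c * Complex.Gamma d / (Complex.Gamma a * Complex.Gamma b)
        * (1 / (1 - (z : ℂ)) ^ d) + ∑' k, e k * (z : ℂ) ^ k := by
  have hc' : ∀ m : ℕ, c ≠ -m := fun m hm => by
    rw [hm] at hc; simp at hc; linarith [m.cast_nonneg (α := ℝ)]
  obtain ⟨C, hC⟩ := exists_risingFac_ratio_bound ha hb hc hd hd0.ge h
  obtain ⟨D, hD0, hD⟩ := exists_risingFac_div_factorial_bound hd hd0
  set B := Complex.Gamma c * Complex.Gamma d / (Complex.Gamma a * Complex.Gamma b)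
  refine ⟨fun k => hypCoeff a b c k - B * (risingFac d k / k.factorial), ?_, fun z hz => ?_⟩
  · have hs : Summable fun k : ℕ => D * C * (1 / (k : ℝ) ^ 2) :=
      (Real.summable_one_div_nat_pow.2 one_lt_two).mul_left _
    rw [← summable_nat_add_iff 1] at hs ⊢
    refine Summable.of_nonneg_of_le (fun _ => norm_nonneg _) (fun k => ?_) hs
    have r1 := risingFac_ne_zero hc' (k + 1)
    have r2 := risingFac_ne_zero hd (k + 1)
    have e : hypCoeff a b c (k + 1) - B * (risingFac d (k + 1) / (k + 1).factorial)
        = risingFac d (k + 1) / (k + 1).factorial * (risingFac a (k + 1) * risingFac b (k + 1)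
          / (risingFac c (k + 1) * risingFac d (k + 1)) - B) := by
      rw [hypCoeff]; field_simp
    beta_reduce
    rw [e, norm_mul]
    calc _ ≤ D / ((k + 1 : ℕ) : ℝ) * (C / ((k + 1 : ℕ) : ℝ)) :=
          mul_le_mul (hD _ k.succ_ne_zero) (hC _ k.succ_ne_zero) (norm_nonneg _) (by positivity)
      _ = _ := by field_simp
  · have hz' : ‖(z : ℂ)‖ < 1 := by simpa using hz
    have h1 := (summable_hypCoeff a b hc' hz').of_norm
    have h2 := hasSum_binomial d hz'
    rw [hypF, ← h2.tsum_eq, ← tsum_mul_left, ← Summable.tsum_add (h2.summable.mul_left B)]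
    · exact tsum_congr fun k => by ring
    · exact (h1.sub (h2.summable.mul_left B)).congr fun k => by ring

theorem exists_hypF_bound {a b c d : ℂ} (ha : ∀ m : ℕ, a ≠ -m) (hb : ∀ m : ℕ, b ≠ -m)
    (hc : 1 ≤ c.re) (hd : ∀ m : ℕ, d ≠ -m) (hd0 : d.re = 0) (h : a + b = c + d) :
    ∃ M : ℝ, ∀ z : ℝ, |z| < 1 → ‖hypF a b c z‖ ≤ M := by
  obtain ⟨e, he, hz⟩ := exists_hypF_eq ha hb hc hd hd0 h
  refine ⟨‖Complex.Gamma c * Complex.Gamma d / (Complex.Gamma a * Complex.Gamma b)‖ + ∑' k, ‖e k‖,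
    fun z hz' => ?_⟩
  have h1 : ‖(1 - (z : ℂ)) ^ d‖ = 1 := by
    rw [← Complex.ofReal_one, ← Complex.ofReal_sub, Complex.norm_cpow_eq_rpow_re_of_pos
      (by linarith [(abs_lt.1 hz').2]), hd0, Real.rpow_zero]
  rw [hz z hz']
  refine (norm_add_le _ _).trans (add_le_add ?_ (tsum_of_norm_bounded he.hasSum fun k => ?_))
  · rw [norm_mul _ (1 / _), norm_div 1, h1, norm_one, div_one, mul_one]
  · rw [norm_mul, norm_pow, Complex.norm_real, Real.norm_eq_abs]
    exact mul_le_of_le_one_right (norm_nonneg _) (pow_le_one₀ (abs_nonneg _) hz'.le)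

theorem continuousOn_hypF {a b c d : ℂ} (ha : ∀ m : ℕ, a ≠ -m) (hb : ∀ m : ℕ, b ≠ -m)
    (hc : 1 ≤ c.re) (hd : ∀ m : ℕ, d ≠ -m) (hd0 : d.re = 0) (h : a + b = c + d) :
    ContinuousOn (hypF a b c) (Set.Ioo (-1) 1) := by
  obtain ⟨e, he, hz⟩ := exists_hypF_eq ha hb hc hd hd0 h
  have h1 : ContinuousOn (fun z : ℝ => ∑' k, e k * (z : ℂ) ^ k) (Set.Ioo (-1) 1) := by
    refine continuousOn_tsum (fun k => by fun_prop) he fun k z hz => ?_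
    rw [norm_mul, norm_pow, Complex.norm_real, Real.norm_eq_abs]
    exact mul_le_of_le_one_right (norm_nonneg _) (pow_le_one₀ (abs_nonneg _) (abs_lt.2 hz).le)
  have h2 : ContinuousOn (fun z : ℝ => 1 / (1 - (z : ℂ)) ^ d) (Set.Ioo (-1) 1) := by
    have hs : ∀ z ∈ Set.Ioo (-1 : ℝ) 1, 1 - (z : ℂ) ∈ Complex.slitPlane := fun z hz =>
      Or.inl (by simpa using hz.2)
    refine continuousOn_const.div (ContinuousOn.cpow_const (by fun_prop) hs) fun z hz => ?_
    rw [Ne, Complex.cpow_eq_zero_iff]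
    exact fun h => Complex.slitPlane_ne_zero (hs z hz) h.1
  exact ((continuousOn_const.mul h2).add h1).congr fun z hz' => hz z (abs_lt.2 hz')

theorem exists_tendsto_hypF {a b c d : ℂ} (ha : ∀ m : ℕ, a ≠ -m) (hb : ∀ m : ℕ, b ≠ -m)
    (hc : 1 ≤ c.re) (hd : ∀ m : ℕ, d ≠ -m) (hd0 : d.re = 0) (h : a + b = c + d) :
    ∃ A : ℂ, Tendsto (fun z : ℝ => hypF a b c z -
      Complex.Gamma c * Complex.Gamma d / (Complex.Gamma a * Complex.Gamma b)
        * (1 / (1 - (z : ℂ)) ^ d)) (𝓝[<] 1) (𝓝 A) := by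
  obtain ⟨e, he, hz⟩ := exists_hypF_eq ha hb hc hd hd0 h
  have hnear : ∀ᶠ z : ℝ in 𝓝[<] 1, |z| < 1 := by
    filter_upwards [Ioo_mem_nhdsLT (show (0 : ℝ) < 1 by norm_num)] with z hz
    rw [abs_lt]; constructor <;> linarith [hz.1, hz.2]
  refine ⟨∑' k, e k, ?_⟩
  have h1 : Tendsto (fun z : ℝ => ∑' k, e k * (z : ℂ) ^ k) (𝓝[<] 1) (𝓝 (∑' k, e k)) := by
    refine tendsto_tsum_of_dominated_convergence he (fun k => ?_) ?_
    · have : Continuous fun z : ℝ => e k * (z : ℂ) ^ k := by fun_prop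
      have h2 := this.tendsto 1
      simp only [Complex.ofReal_one, one_pow, mul_one] at h2
      exact h2.mono_left nhdsWithin_le_nhds
    · filter_upwards [hnear] with z hz k
      rw [norm_mul, norm_pow, Complex.norm_real, Real.norm_eq_abs]
      exact mul_le_of_le_one_right (norm_nonneg _) (pow_le_one₀ (abs_nonneg _) hz.le)
  refine h1.congr' ?_
  filter_upwards [hnear] with z hz'
  rw [hz z hz']; ring

end Hypergeometric

/-! ### Euler's transformation and the connection formula -/

section Euler

open PowerSeries in
/-- The hypergeometric operator `x (1 - x) f'' + (c - (a + b + 1) x) f' - a b f` on coefficients;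
its kernel is given by the recursion of the hypergeometric series. -/
theorem coeff_hypergeometric_operator (a b c : ℂ) (f : PowerSeries ℂ) (k : ℕ) :
    coeff k (X * (derivative ℂ (derivative ℂ f)) - X * (X * (derivative ℂ (derivative ℂ f)))
      + C c * derivative ℂ f - X * (C (a + b + 1) * derivative ℂ f) - C (a * b) * f)
    = (k + 1) * (k + c) * coeff (k + 1) f - (k + a) * (k + b) * coeff k f := by
  rcases k with _ | _ | k <;>
  · simp only [LinearMap.map_sub, LinearMap.map_add, coeff_C_mul, coeff_derivative,
      coeff_succ_X_mul, coeff_zero_X_mul]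
    push_cast; ring

/-- A product solving the hypergeometric equation: if `P` is the binomial series `(1 - x)^{-e}`,
`e = a + b - c`, and `S` solves the equation with parameters `c - a`, `c - b`, `c`, then `P S`
solves the equation with parameters `a`, `b`, `c`. -/
theorem hypergeometric_operator_mul {R : Type*} [CommRing R] (a b c x P P1 P2 S S1 S2 : R)
    (h1 : (1 - x) * P1 = (a + b - c) * P) (h2 : (1 - x) * P2 = (a + b - c + 1) * P1)
    (hS : x * S2 - x * (x * S2) + c * S1 - x * (((c - a) + (c - b) + 1) * S1)
      - (c - a) * (c - b) * S = 0) :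
    (1 - x) * (x * (P2 * S + 2 * (P1 * S1) + P * S2) - x * (x * (P2 * S + 2 * (P1 * S1) + P * S2))
      + c * (P1 * S + P * S1) - x * ((a + b + 1) * (P1 * S + P * S1)) - a * b * (P * S)) = 0 := by
  linear_combination (x * (1 - x) * S) * h2 +
    (x * (a + b - c + 1) * S + 2 * x * (1 - x) * S1 + (c - (a + b + 1) * x) * S) * h1
    + (1 - x) * P * hS

open PowerSeries in
/-- Euler's transformation, at the level of power series. -/
theorem binomial_mul_hypergeometric (a b : ℂ) {c : ℂ} (hc : ∀ m : ℕ, c ≠ -m) :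
    (mk fun k => risingFac (a + b - c) k / k.factorial) * mk (hypCoeff (c - a) (c - b) c)
      = mk (hypCoeff a b c) := by
  set e := a + b - c with he
  set P : PowerSeries ℂ := mk fun k => risingFac e k / k.factorial
  set S : PowerSeries ℂ := mk (hypCoeff (c - a) (c - b) c)
  have h1 : (1 - X) * derivative ℂ P = C e * P := by
    have key : ∀ k : ℕ, risingFac e (k + 1) / (k + 1).factorial * ((k : ℂ) + 1)
        = (e + k) * (risingFac e k / k.factorial) := fun k => by
      have h3 : (k.factorial : ℂ) ≠ 0 := by exact_mod_cast k.factorial_ne_zero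
      have h4 : (k : ℂ) + 1 ≠ 0 := by exact_mod_cast k.succ_ne_zero
      rw [risingFac_succ, Nat.factorial_succ]
      push_cast
      field_simp
    ext k
    match k with
    | 0 =>
      simp only [sub_mul, one_mul, map_sub, coeff_zero_X_mul, coeff_C_mul, coeff_derivative, P,
        coeff_mk]
      rw [key 0]; push_cast; ring
    | k + 1 =>
      simp only [sub_mul, one_mul, map_sub, coeff_succ_X_mul, coeff_C_mul, coeff_derivative, P,
        coeff_mk]
      rw [key (k + 1)]; push_cast; ring
  have h2 : (1 - X) * derivative ℂ (derivative ℂ P) = (C e + 1) * derivative ℂ P := by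
    have := congrArg (derivative ℂ) h1
    simp only [Derivation.leibniz, map_sub, Derivation.map_one_eq_zero, smul_eq_mul,
      derivative_X, derivative_C] at this
    linear_combination this
  have hS : X * derivative ℂ (derivative ℂ S) - X * (X * derivative ℂ (derivative ℂ S))
      + C c * derivative ℂ S - X * (((C c - C a) + (C c - C b) + 1) * derivative ℂ S)
      - (C c - C a) * (C c - C b) * S = 0 := by
    ext k
    have h3 := coeff_hypergeometric_operator (c - a) (c - b) c S k
    simp only [map_add, map_sub, map_mul, map_one] at h3 ⊢
    rw [h3, coeff_mk, coeff_mk, hypCoeff_succ _ _ hc]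
    simp
  have hT := hypergeometric_operator_mul (C a) (C b) (C c) X P _ _ S _ _
    (by rw [h1, he]; simp) (by rw [h2, he]; simp) hS
  have hne : (1 - X : PowerSeries ℂ) ≠ 0 := fun h => by
    have := congrArg (coeff 0) h
    simp at this
  have hE := (mul_eq_zero.1 hT).resolve_left hne
  have hrec : ∀ k : ℕ, ((k : ℂ) + 1) * (k + c) * coeff (k + 1) (P * S)
      = (k + a) * (k + b) * coeff k (P * S) := fun k => by
    rw [← sub_eq_zero, ← coeff_hypergeometric_operator a b c (P * S) k, ← map_zero (coeff k), ← hE]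
    congr 1
    simp only [Derivation.leibniz, map_add, smul_eq_mul, map_mul, map_one]
    ring
  ext k
  rw [coeff_mk]
  induction k with
  | zero =>
    rw [coeff_mul]
    simp [P, S, hypCoeff_zero, risingFac_zero]
  | succ k ih =>
    have h2 : (k : ℂ) + c ≠ 0 := fun h => hc k (by linear_combination h)
    have h4 : (k : ℂ) + 1 ≠ 0 := by exact_mod_cast k.succ_ne_zero
    refine mul_left_cancel₀ (mul_ne_zero h4 h2) ?_
    rw [hrec, ih, hypCoeff_succ _ _ hc]

/-- Euler's transformation `F(a, b; c; z) = (1 - z)^{c - a - b} F(c - a, c - b; c; z)`. -/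
theorem hypF_euler (a b : ℂ) {c : ℂ} (hc : ∀ m : ℕ, c ≠ -m) {z : ℝ} (hz : |z| < 1) :
    hypF a b c z = 1 / (1 - (z : ℂ)) ^ (a + b - c) * hypF (c - a) (c - b) c z := by
  have hz' : ‖(z : ℂ)‖ < 1 := by simpa using hz
  rw [← (hasSum_binomial _ hz').tsum_eq, hypF, hypF,
    tsum_mul_tsum_eq_tsum_sum_antidiagonal_of_summable_norm (summable_binomial _ hz')
      (summable_hypCoeff _ _ hc hz')]
  refine tsum_congr fun k => ?_
  have := congrArg (PowerSeries.coeff k) (binomial_mul_hypergeometric a b hc)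
  rw [PowerSeries.coeff_mul, PowerSeries.coeff_mk] at this
  rw [← this, Finset.sum_mul]
  refine Finset.sum_congr rfl fun p hp => ?_
  rw [PowerSeries.coeff_mk, PowerSeries.coeff_mk, ← Finset.HasAntidiagonal.mem_antidiagonal.1 hp,
    pow_add]
  ring

/-- Asymptotics of `₂F₁(a, b; c; z)` as `z → 1` for `a + b = c + d` with `d ≠ 0` purely imaginary.
The constant term is determined by comparison with Euler's transformation. -/
theorem tendsto_hypF_one {a b c d : ℂ} (ha : ∀ m : ℕ, a ≠ -m) (hb : ∀ m : ℕ, b ≠ -m)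
    (ha' : ∀ m : ℕ, c - a ≠ -m) (hb' : ∀ m : ℕ, c - b ≠ -m)
    (hc : 1 ≤ c.re) (hd : d ≠ 0) (hd0 : d.re = 0) (h : a + b = c + d) :
    Tendsto (fun z : ℝ => hypF a b c z -
      (Complex.Gamma c * Complex.Gamma d / (Complex.Gamma a * Complex.Gamma b)
        * (1 / (1 - (z : ℂ)) ^ d)
      + Complex.Gamma c * Complex.Gamma (-d) / (Complex.Gamma (c - a) * Complex.Gamma (c - b))))
      (𝓝[<] 1) (𝓝 0) := by
  have hc' : ∀ m : ℕ, c ≠ -m := fun m hm => by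
    rw [hm] at hc; simp at hc; linarith [m.cast_nonneg (α := ℝ)]
  have hI : d = d.im * Complex.I := by
    apply Complex.ext <;> simp [hd0]
  have him : d.im ≠ 0 := fun h => hd (by rw [hI, h]; simp)
  have hdm : ∀ m : ℕ, d ≠ -m := fun m hm => him (by rw [hm]; simp)
  have hdm' : ∀ m : ℕ, -d ≠ -m := fun m hm => him (by
    have := congrArg Complex.im hm; simpa using this)
  obtain ⟨A, hA⟩ := exists_tendsto_hypF ha hb hc hdm hd0 h
  obtain ⟨A', hA'⟩ := exists_tendsto_hypF ha' hb' hc hdm' (by simp [hd0])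
    (show c - a + (c - b) = c + -d by linear_combination -h)
  set B := Complex.Gamma c * Complex.Gamma d / (Complex.Gamma a * Complex.Gamma b)
  set B' := Complex.Gamma c * Complex.Gamma (-d) / (Complex.Gamma (c - a) * Complex.Gamma (c - b))
  -- along `1 - z = exp (-s)` the factor `(1 - z)^{-d}` is the oscillation `exp (d s)`
  have hexp : ∀ (s : ℝ) (d : ℂ), (1 - ((1 - Real.exp (-s) : ℝ) : ℂ)) ^ d = Complex.exp (-(s * d)) :=
    fun s d => by
      rw [show (1 - ((1 - Real.exp (-s) : ℝ) : ℂ)) = ((Real.exp (-s) : ℝ) : ℂ) by push_cast; ring,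
        Complex.cpow_def_of_ne_zero (by exact_mod_cast (Real.exp_pos _).ne'),
        ← Complex.ofReal_log (Real.exp_pos _).le, Real.log_exp]
      congr 1; push_cast; ring
  have hz : Tendsto (fun s : ℝ => 1 - Real.exp (-s)) atTop (𝓝[<] 1) := by
    refine tendsto_nhdsWithin_iff.2 ⟨?_, Eventually.of_forall fun s => by
      simp [Real.exp_pos]⟩
    have := Real.tendsto_exp_neg_atTop_nhds_zero.const_sub 1
    simpa using this
  have hEuler : ∀ᶠ s : ℝ in atTop, hypF a b c (1 - Real.exp (-s)) =
      Complex.exp (s * d) * hypF (c - a) (c - b) c (1 - Real.exp (-s)) := by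
    filter_upwards [eventually_gt_atTop 0] with s hs
    rw [hypF_euler a b hc' (z := 1 - Real.exp (-s)), show a + b - c = d by linear_combination h,
      hexp, one_div, ← Complex.exp_neg, neg_neg]
    have := Real.exp_pos (-s)
    have : Real.exp (-s) < 1 := by simpa using hs
    rw [abs_lt]; constructor <;> linarith
  have hnorm : ∀ s : ℝ, ‖Complex.exp (s * d)‖ = 1 := fun s => by
    rw [Complex.norm_exp]; simp [hd0]
  -- the two expansions of the same function
  have hdiff : Tendsto (fun s : ℝ => (B - A') * Complex.exp (s * d) + (A - B')) atTop (𝓝 0) := by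
    have l1 := hA.comp hz
    have l2 := hA'.comp hz
    have l3 : Tendsto (fun s : ℝ => Complex.exp (s * d) *
        (hypF (c - a) (c - b) c (1 - Real.exp (-s)) -
          B' * (1 / (1 - ((1 - Real.exp (-s) : ℝ) : ℂ)) ^ (-d)) - A')) atTop (𝓝 0) := by
      have l4 := (l2.sub_const A').norm
      rw [sub_self, norm_zero] at l4
      refine squeeze_zero_norm (fun s => ?_) l4
      rw [norm_mul, hnorm, one_mul]; rfl
    have l5 := (l3.sub (l1.sub_const A))
    rw [sub_self, sub_zero] at l5
    refine l5.congr' ?_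
    filter_upwards [hEuler] with s hs
    simp only [Function.comp_apply]
    rw [hs, hexp, hexp, one_div, one_div, ← Complex.exp_neg, ← Complex.exp_neg]
    simp only [neg_neg, mul_neg]
    rw [Complex.exp_neg]
    have := Complex.exp_ne_zero (s * d)
    field_simp
    ring
  -- an oscillation plus a constant tends to zero only if the constant vanishes: it is evaluated
  -- where the oscillation is `1` and where it is `-1`
  have hAB : A = B' := by
    have hx : ∀ x : ℝ, Tendsto (fun m : ℕ => (x + m * (2 * Real.pi)) / |d.im|) atTop atTop :=
      fun x => by
        refine Tendsto.atTop_div_const (abs_pos.2 him) ?_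
        refine tendsto_atTop_add_const_left _ _ ?_
        exact tendsto_natCast_atTop_atTop.atTop_mul_const (by positivity)
    have key : ∀ (x : ℝ) (ε : ℂ), Complex.exp (x * Complex.I) = ε →
        Complex.exp (-(x * Complex.I)) = ε →
        (B - A') * ε + (A - B') = 0 := fun x ε h1 h2 => by
      refine tendsto_nhds_unique (Tendsto.congr (fun m => ?_) tendsto_const_nhds)
        (hdiff.comp (hx x))
      simp only [Function.comp_apply]
      congr 2
      have hper : ∀ y : ℂ, Complex.exp (y + m * (2 * Real.pi * Complex.I)) = Complex.exp y :=
        Complex.exp_periodic.nat_mul m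
      have hper' : ∀ y : ℂ, Complex.exp (y - m * (2 * Real.pi * Complex.I)) = Complex.exp y :=
        fun _ => Complex.exp_periodic.sub_nat_mul_eq m
      have hc0 : (d.im : ℂ) ≠ 0 := by exact_mod_cast him
      rcases lt_or_gt_of_ne him with h0 | h0
      · rw [abs_of_neg h0, ← h2, ← hper']
        congr 1
        nth_rw 2 [hI]
        push_cast
        field_simp
        ring
      · rw [abs_of_pos h0, ← h1, ← hper]
        congr 1
        nth_rw 2 [hI]
        push_cast
        field_simp
    have k0 := key 0 1 (by simp) (by simp)
    have k1 := key Real.pi (-1) (by simp) (by rw [Complex.exp_neg]; simp)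
    linear_combination (k0 + k1) / 2
  rw [← hAB]
  have := hA.sub_const A
  rw [sub_self] at this
  exact this.congr fun z => by ring

end Euler

/-! ### A generating function on the unit circle -/

section CircleIntegral

theorem integral_exp_int (m : ℤ) :
    ∫ θ in (-Real.pi)..Real.pi, Complex.exp ((m : ℂ) * Complex.I * θ)
      = if m = 0 then 2 * (Real.pi : ℂ) else 0 := by
  split_ifs with h
  · simp [h]; ring
  · have hc : (m : ℂ) * Complex.I ≠ 0 := mul_ne_zero (by exact_mod_cast h) Complex.I_ne_zero
    rw [integral_exp_mul_complex hc, div_eq_zero_iff]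
    left
    rw [sub_eq_zero]
    have := Complex.exp_periodic.int_mul m ((m : ℂ) * Complex.I * ((-Real.pi : ℝ) : ℂ))
    rw [← this]
    congr 1; push_cast; ring

/-- The first Fourier coefficient of a product `G(e^{iθ}) H(e^{-iθ})` of power series. -/
theorem integral_exp_mul_series (g h : ℕ → ℂ) (hg : Summable fun k => ‖g k‖)
    (hh : Summable fun k => ‖h k‖) :
    ∫ θ in (-Real.pi)..Real.pi, Complex.exp (θ * Complex.I) *
      ((∑' j, g j * Complex.exp (θ * Complex.I) ^ j)
        * ∑' k, h k * Complex.exp (-(θ * Complex.I)) ^ k)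
      = 2 * Real.pi * ∑' j, g j * h (j + 1) := by
  have hn : ∀ (θ : ℝ), ‖Complex.exp (θ * Complex.I)‖ = 1 := Complex.norm_exp_ofReal_mul_I
  have hn' : ∀ (θ : ℝ), ‖Complex.exp (-(θ * Complex.I))‖ = 1 := fun θ => by
    rw [← neg_mul, ← Complex.ofReal_neg]; exact hn _
  have hs : Summable fun p : ℕ × ℕ => ‖g p.1‖ * ‖h p.2‖ :=
    hg.mul_of_nonneg hh (fun _ => norm_nonneg _) fun _ => norm_nonneg _
  set F : ℕ × ℕ → ℝ → ℂ := fun p θ => g p.1 * h p.2 *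
    Complex.exp (((1 + p.1 - p.2 : ℤ) : ℂ) * Complex.I * θ) with hF
  have hFn : ∀ p θ, ‖F p θ‖ = ‖g p.1‖ * ‖h p.2‖ := fun p θ => by
    rw [hF]
    simp only [norm_mul]
    rw [Complex.norm_exp]
    simp
  have hsum : ∀ θ : ℝ, HasSum (fun p => F p θ) (Complex.exp (θ * Complex.I) *
      ((∑' j, g j * Complex.exp (θ * Complex.I) ^ j)
        * ∑' k, h k * Complex.exp (-(θ * Complex.I)) ^ k)) := fun θ => by
    have hg' : Summable fun j => ‖g j * Complex.exp (θ * Complex.I) ^ j‖ := by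
      simpa only [norm_mul, norm_pow, hn, one_pow, mul_one] using hg
    have hh' : Summable fun j => ‖h j * Complex.exp (-(θ * Complex.I)) ^ j‖ := by
      simpa only [norm_mul, norm_pow, hn', one_pow, mul_one] using hh
    rw [tsum_mul_tsum_of_summable_norm hg' hh', ← tsum_mul_left]
    have : ∀ p : ℕ × ℕ, Complex.exp (θ * Complex.I) * (g p.1 * Complex.exp (θ * Complex.I) ^ p.1 *
        (h p.2 * Complex.exp (-(θ * Complex.I)) ^ p.2)) = F p θ := fun p => by
      rw [hF, ← Complex.exp_nat_mul, ← Complex.exp_nat_mul]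
      have : Complex.exp (((1 + p.1 - p.2 : ℤ) : ℂ) * Complex.I * θ)
          = Complex.exp (θ * Complex.I) * Complex.exp (p.1 * (θ * Complex.I))
            * Complex.exp (p.2 * -(θ * Complex.I)) := by
        rw [← Complex.exp_add, ← Complex.exp_add]; congr 1; push_cast; ring
      beta_reduce
      rw [this]; ring
    simp only [this]
    refine Summable.hasSum (Summable.of_norm ?_)
    simpa only [hFn] using hs
  have hint := intervalIntegral.hasSum_integral_of_dominated_convergence
    (μ := volume) (a := -Real.pi) (b := Real.pi) (F := F) (fun p _ => ‖g p.1‖ * ‖h p.2‖)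
    (fun p => by
      have : Continuous (F p) := by fun_prop
      exact this.aestronglyMeasurable)
    (fun p => Eventually.of_forall fun θ _ => (hFn p θ).le)
    (Eventually.of_forall fun θ _ => hs) (by simp)
    (Eventually.of_forall fun θ _ => hsum θ)
  rw [← hint.tsum_eq]
  have hterm : ∀ p : ℕ × ℕ, ∫ θ in (-Real.pi)..Real.pi, F p θ
      = if p.2 = p.1 + 1 then 2 * Real.pi * (g p.1 * h p.2) else 0 := fun p => by
    rw [hF]
    simp only [intervalIntegral.integral_const_mul]
    rw [integral_exp_int]
    by_cases hp : p.2 = p.1 + 1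
    · rw [if_pos hp, if_pos (by omega)]; ring
    · rw [if_neg hp, if_neg (by omega), mul_zero]
  simp only [hterm]
  rw [← tsum_mul_left]
  have hinj : Function.Injective fun j : ℕ => (j, j + 1) := fun a b h => congrArg Prod.fst h
  rw [← hinj.tsum_eq]
  · exact tsum_congr fun j => by simp
  · intro p hp
    rw [Function.mem_support] at hp
    by_cases h2 : p.2 = p.1 + 1
    · exact ⟨p.1, by ext <;> simp [h2]⟩
    · rw [if_neg h2] at hp; exact absurd rfl hp

variable {V : Type*} [NormedAddCommGroup V] [InnerProductSpace ℂ V] {ν : ℕ}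
  {τ : Representation ℂ Sp1 V}

/-- The function `(1 - r e^{iθ})^{-b} (1 - r e^{-iθ})^{-a}`. -/
noncomputable def circleKernel (a b : ℂ) (r θ : ℝ) : ℂ :=
  1 / (1 - r * Complex.exp (θ * Complex.I)) ^ b * (1 / (1 - r * Complex.exp (-(θ * Complex.I))) ^ a)

theorem re_one_sub_circle_pos {r : ℝ} (hr0 : 0 ≤ r) (hr1 : r < 1) (θ : ℝ) :
    0 < (1 - r * Complex.exp (θ * Complex.I)).re := by
  rw [Complex.sub_re, Complex.one_re, Complex.re_ofReal_mul, Complex.exp_ofReal_mul_I_re]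
  nlinarith [Real.cos_le_one θ]

/-- The character formula, in the form in which it enters Weyl's integration formula. -/
theorem IsTau.sin_mul_tauChar_arg (hτ : IsTau ν τ) (a b : ℂ) (hab : a - b = ν + 1) {r : ℝ}
    (hr0 : 0 ≤ r) (hr1 : r < 1) (θ : ℝ) :
    (r : ℂ) * Real.sin θ * (Complex.exp (-(a + b + 1) *
      Real.log ‖1 - r * Complex.exp (θ * Complex.I)‖)
      * tauChar τ (circleElt (1 - r * Complex.exp (θ * Complex.I)).arg))
      = (circleKernel a b r (-θ) - circleKernel a b r θ) / (2 * Complex.I) := by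
  have hpos := re_one_sub_circle_pos hr0 hr1 θ
  have hconj : 1 - r * Complex.exp (-(θ * Complex.I))
      = (starRingEnd ℂ) (1 - r * Complex.exp (θ * Complex.I)) := by
    rw [map_sub, map_mul, map_one, Complex.conj_ofReal, ← Complex.exp_conj, map_mul,
      Complex.conj_ofReal, Complex.conj_I, mul_neg]
  have him : (1 - r * Complex.exp (θ * Complex.I)).im = -(r * Real.sin θ) := by
    rw [Complex.sub_im, Complex.one_im, Complex.im_ofReal_mul, Complex.exp_ofReal_mul_I_im,
      zero_sub]
  set ζ := 1 - r * Complex.exp (θ * Complex.I) with hζ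
  have hζ0 : ζ ≠ 0 := fun h => by rw [h] at hpos; simp at hpos
  have hζ0' : (starRingEnd ℂ) ζ ≠ 0 := by simpa using hζ0
  have harg : ζ.arg ≠ Real.pi := by
    intro h
    have := Complex.arg_eq_pi_iff.1 h
    linarith [this.1]
  have hlog : Complex.log ζ = Real.log ‖ζ‖ + ζ.arg * Complex.I := rfl
  have hlog' : Complex.log ((starRingEnd ℂ) ζ) = Real.log ‖ζ‖ - ζ.arg * Complex.I := by
    rw [Complex.log_conj _ harg, hlog]
    simp [sub_eq_add_neg]
  have hk1 : circleKernel a b r θ = Complex.exp (-(a + b) * Real.log ‖ζ‖)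
      * Complex.exp ((ν + 1) * ζ.arg * Complex.I) := by
    rw [circleKernel, ← hζ, hconj, Complex.cpow_def_of_ne_zero hζ0,
      Complex.cpow_def_of_ne_zero hζ0', hlog, hlog', one_div, one_div, ← Complex.exp_neg,
      ← Complex.exp_neg, ← Complex.exp_add, ← Complex.exp_add, ← hab]
    congr 1; ring
  have hk2 : circleKernel a b r (-θ) = Complex.exp (-(a + b) * Real.log ‖ζ‖)
      * Complex.exp (-((ν + 1) * ζ.arg * Complex.I)) := by
    rw [circleKernel, Complex.ofReal_neg, neg_mul, neg_neg, ← hζ, hconj,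
      Complex.cpow_def_of_ne_zero hζ0,
      Complex.cpow_def_of_ne_zero hζ0', hlog, hlog', one_div, one_div, ← Complex.exp_neg,
      ← Complex.exp_neg, ← Complex.exp_add, ← Complex.exp_add, ← hab]
    congr 1; ring
  have hch := hτ.sin_mul_tauChar ζ.arg
  have hsin : (r : ℂ) * Real.sin θ = -(‖ζ‖ * Real.sin ζ.arg) := by
    rw [← Complex.ofReal_mul, ← Complex.ofReal_mul, ← Complex.ofReal_neg]
    congr 1
    rw [Complex.sin_arg, mul_div_cancel₀ _ (norm_ne_zero_iff.2 hζ0), him, neg_neg]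
  have hR : Complex.exp (-(a + b) * Real.log ‖ζ‖)
      = ‖ζ‖ * Complex.exp (-(a + b + 1) * Real.log ‖ζ‖) := by
    have : ((‖ζ‖ : ℝ) : ℂ) = Complex.exp (Real.log ‖ζ‖) := by
      rw [← Complex.ofReal_exp, Real.exp_log (norm_pos_iff.2 hζ0)]
    rw [this]
    rw [← Complex.exp_add]; congr 1; ring
  have hs : ((Real.sin ((ν + 1) * ζ.arg) : ℝ) : ℂ) = (Complex.exp (-((ν + 1) * ζ.arg * Complex.I))
      - Complex.exp ((ν + 1) * ζ.arg * Complex.I)) * Complex.I / 2 := by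
    rw [Complex.ofReal_sin, Complex.sin]
    push_cast
    rw [neg_mul]
  rw [hk1, hk2, hR, hsin]
  calc _ = -(‖ζ‖ : ℂ) * Complex.exp (-(a + b + 1) * Real.log ‖ζ‖)
        * (Real.sin ζ.arg * tauChar τ (circleElt ζ.arg)) := by ring
    _ = _ := by
      rw [hch, hs]
      have : Complex.I ≠ 0 := Complex.I_ne_zero
      field_simp
      rw [Complex.I_sq]
      ring

theorem circleKernel_eq_series (a b : ℂ) {r : ℝ} (hr0 : 0 ≤ r) (hr1 : r < 1) (θ : ℝ) :
    circleKernel a b r θ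
      = (∑' j, (risingFac b j / j.factorial * (r : ℂ) ^ j) * Complex.exp (θ * Complex.I) ^ j)
      * ∑' k, (risingFac a k / k.factorial * (r : ℂ) ^ k) * Complex.exp (-(θ * Complex.I)) ^ k := by
  have hn : ‖(r : ℂ) * Complex.exp (θ * Complex.I)‖ < 1 := by
    rw [norm_mul, Complex.norm_exp_ofReal_mul_I]; simpa [abs_of_nonneg hr0] using hr1
  have hn' : ‖(r : ℂ) * Complex.exp (-(θ * Complex.I))‖ < 1 := by
    rw [norm_mul, ← neg_mul, ← Complex.ofReal_neg, Complex.norm_exp_ofReal_mul_I]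
    simpa [abs_of_nonneg hr0] using hr1
  rw [circleKernel, ← (hasSum_binomial b hn).tsum_eq, ← (hasSum_binomial a hn').tsum_eq]
  simp only [mul_pow, mul_assoc]

theorem continuous_circleKernel (a b : ℂ) {r : ℝ} (hr0 : 0 ≤ r) (hr1 : r < 1) :
    Continuous (circleKernel a b r) := by
  have hs : ∀ θ : ℝ, 1 - r * Complex.exp (θ * Complex.I) ∈ Complex.slitPlane := fun θ =>
    Or.inl (re_one_sub_circle_pos hr0 hr1 θ)
  have hs' : ∀ θ : ℝ, 1 - r * Complex.exp (-(θ * Complex.I)) ∈ Complex.slitPlane := fun θ => by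
    have := hs (-θ)
    rwa [Complex.ofReal_neg, neg_mul] at this
  have h : ∀ (d : ℂ) (f : ℝ → ℂ), Continuous f → (∀ θ, f θ ∈ Complex.slitPlane) →
      Continuous fun θ => 1 / f θ ^ d := fun d f hf hs => by
    refine continuous_const.div (hf.cpow continuous_const hs) fun θ => ?_
    rw [Ne, Complex.cpow_eq_zero_iff]
    exact fun h => Complex.slitPlane_ne_zero (hs θ) h.1
  exact (h b _ (by fun_prop) hs).mul (h a _ (by fun_prop) hs')

theorem risingFac_two (k : ℕ) : risingFac 2 k = (k + 1).factorial := by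
  induction k with
  | zero => simp [risingFac_zero]
  | succ k ih =>
    rw [risingFac_succ, ih, Nat.factorial_succ (k + 1)]; push_cast; ring

/-- The antisymmetrised first Fourier coefficient of the kernel. Its `k`-th term is that of
`F(a, b; 2; r²)` because `(a)_{k+1} (b)_k - (a)_k (b)_{k+1} = (a - b) (a)_k (b)_k`. -/
theorem integral_exp_mul_circleKernel (a b : ℂ) {r : ℝ} (hr0 : 0 ≤ r) (hr1 : r < 1) :
    ∫ θ in (-Real.pi)..Real.pi, Complex.exp (θ * Complex.I) *
      (circleKernel a b r θ - circleKernel a b r (-θ))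
      = 2 * Real.pi * ((a - b) * r * hypF a b 2 (r ^ 2)) := by
  have hn : ‖(r : ℂ)‖ < 1 := by simpa [abs_of_nonneg hr0] using hr1
  have hs : ∀ d : ℂ, Summable fun k => ‖risingFac d k / k.factorial * (r : ℂ) ^ k‖ :=
    fun d => summable_binomial d hn
  have hs' : ∀ d e : ℂ, Summable fun k => (risingFac d k / k.factorial * (r : ℂ) ^ k)
      * (risingFac e (k + 1) / (k + 1).factorial * (r : ℂ) ^ (k + 1)) := fun d e => by
    have h1 := ((summable_nat_add_iff 1).2 (hs e))
    refine Summable.of_norm ?_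
    simp only [norm_mul (_ * _ ^ _)]
    have h2 : ∀ k, ‖risingFac e (k + 1) / (k + 1).factorial * (r : ℂ) ^ (k + 1)‖ ≤ _ := fun k =>
      h1.le_tsum k fun _ _ => norm_nonneg _
    exact Summable.of_nonneg_of_le (fun _ => mul_nonneg (norm_nonneg _) (norm_nonneg _))
      (fun k => mul_le_mul_of_nonneg_left (h2 k) (norm_nonneg _)) ((hs d).mul_right _)
  have e1 := integral_exp_mul_series _ _ (hs b) (hs a)
  have e2 := integral_exp_mul_series _ _ (hs a) (hs b)
  have e3 : ∀ θ : ℝ, circleKernel a b r (-θ)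
      = (∑' j, (risingFac a j / j.factorial * (r : ℂ) ^ j) * Complex.exp (θ * Complex.I) ^ j)
      * ∑' k, (risingFac b k / k.factorial * (r : ℂ) ^ k)
        * Complex.exp (-(θ * Complex.I)) ^ k := fun θ => by
    rw [circleKernel_eq_series a b hr0 hr1, mul_comm, Complex.ofReal_neg, neg_mul, neg_neg]
  simp only [← circleKernel_eq_series a b hr0 hr1] at e1
  simp only [← e3] at e2
  have hc := continuous_circleKernel a b hr0 hr1
  simp only [mul_sub]
  rw [intervalIntegral.integral_sub, e1, e2, ← mul_sub, ← Summable.tsum_sub (hs' b a) (hs' a b),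
    hypF]
  · congr 1
    rw [← tsum_mul_left]
    refine tsum_congr fun k => ?_
    have h1 : (k.factorial : ℂ) ≠ 0 := by exact_mod_cast k.factorial_ne_zero
    have h2 : ((k + 1).factorial : ℂ) ≠ 0 := by exact_mod_cast (k + 1).factorial_ne_zero
    rw [hypCoeff, risingFac_two, risingFac_succ, risingFac_succ]
    push_cast
    field_simp
    ring
  · exact Continuous.intervalIntegrable (by fun_prop) _ _
  · exact Continuous.intervalIntegrable (by fun_prop) _ _

end CircleIntegral

/-! ### Averages over `Sp(1)` -/

section RadTau

variable {V : Type*} [NormedAddCommGroup V] [InnerProductSpace ℂ V] {ν : ℕ}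
  {τ : Representation ℂ Sp1 V}

/-- The operator `|q|^{-μ} τ(q / |q|)`, homogeneous of degree `-μ` in the quaternion `q ≠ 0`. -/
noncomputable def radTau (τ : Representation ℂ Sp1 V) (μ : ℂ) (q : ℍ[ℝ]) : V →ₗ[ℂ] V :=
  Complex.exp (-μ * Real.log ‖q‖) • τ (quatSgn q)

theorem radTau_apply (μ : ℂ) (q : ℍ[ℝ]) (v : V) :
    radTau τ μ q v = Complex.exp (-μ * Real.log ‖q‖) • τ (quatSgn q) v := rfl

theorem radTau_mul_left (μ : ℂ) {q : ℍ[ℝ]} (hq : q ≠ 0) (p : Sp1) (v : V) :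
    radTau τ μ (p * q) v = τ p (radTau τ μ q v) := by
  rw [radTau_apply, radTau_apply, norm_mul, norm_Sp1, one_mul, quatSgn_mul_left hq, map_mul,
    map_smul]
  rfl

theorem radTau_mul_right (μ : ℂ) {q : ℍ[ℝ]} (hq : q ≠ 0) (p : Sp1) (v : V) :
    radTau τ μ (q * p) v = radTau τ μ q (τ p v) := by
  rw [radTau_apply, radTau_apply, norm_mul, norm_Sp1, mul_one, quatSgn_mul_right hq, map_mul]
  rfl

theorem radTau_real_smul (μ : ℂ) {q : ℍ[ℝ]} (hq : q ≠ 0) {r : ℝ} (hr : 0 < r) (v : V) :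
    radTau τ μ (r • q) v = Complex.exp (-μ * Real.log r) • radTau τ μ q v := by
  rw [radTau_apply, radTau_apply, quatSgn_real_smul hr hq, smul_smul, ← Complex.exp_add, norm_smul,
    Real.norm_of_nonneg hr.le, Real.log_mul hr.ne' (norm_ne_zero_iff.2 hq)]
  congr 2; push_cast; ring

theorem continuous_quatSgn_comp {X : Type*} [TopologicalSpace X] {f : X → ℍ[ℝ]} (hf : Continuous f)
    (h0 : ∀ x, f x ≠ 0) : Continuous fun x => quatSgn (f x) :=
  continuous_iff_continuousAt.2 fun x =>
    ContinuousAt.comp (f := f) (continuousAt_quatSgn (h0 x)) hf.continuousAt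

theorem IsTau.continuous_radTau (hτ : IsTau ν τ) (μ : ℂ) {X : Type*} [TopologicalSpace X]
    {f : X → ℍ[ℝ]} (hf : Continuous f) (h0 : ∀ x, f x ≠ 0) (v : V) :
    Continuous fun x => radTau τ μ (f x) v := by
  have h1 : Continuous fun x => Real.log ‖f x‖ :=
    hf.norm.log fun x => norm_ne_zero_iff.2 (h0 x)
  have h2 := hτ.continuous_apply (continuous_quatSgn_comp hf h0) (continuous_const (y := v))
  have h3 : Continuous fun x => Complex.exp (-μ * Real.log ‖f x‖) := by fun_prop
  exact h3.smul h2

theorem one_sub_smul_ne_zero {q : ℍ[ℝ]} (hq : ‖q‖ ≤ 1) {r : ℝ} (hr0 : 0 ≤ r) (hr1 : r < 1) :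
    1 - r • q ≠ 0 := fun h => by
  have h1 : ‖r • q‖ = 1 := by rw [← sub_eq_zero.1 h, norm_one]
  rw [norm_smul, Real.norm_of_nonneg hr0] at h1
  nlinarith [norm_nonneg q]

variable {n : ℕ}

/-- The trace of the average of `|1 - r q|^{-μ} τ(sgn (1 - r q))`, by Weyl's integration formula. -/
theorem IsTau.integral_trace_radTau (hτ : IsTau ν τ) (a b : ℂ) (hab : a - b = ν + 1) {r : ℝ}
    (hr0 : 0 < r) (hr1 : r < 1) :
    ∫ k : KGroup n, LinearMap.trace ℂ V (radTau τ (a + b + 1) (1 - r • (sp1Part k : ℍ[ℝ])))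
      ∂(haarK n) = (ν + 1) * hypF a b 2 (r ^ 2) := by
  -- `|1 - r q|` as a function of `x = Re q ∈ [-1, 1]`, extended so as to vanish nowhere on `ℝ`
  obtain ⟨s, hs⟩ : ∃ s : ℝ → ℝ,
      s = fun x => Real.sqrt (max (1 - 2 * r * x + r ^ 2) ((1 - r) ^ 2)) :=
    ⟨_, rfl⟩
  have hs0 : ∀ x, s x ≠ 0 := fun x => by
    rw [hs]
    exact (Real.sqrt_pos.2 (lt_max_of_lt_right (by nlinarith))).ne'
  have hs1 : ∀ x, x ≤ 1 → s x = Real.sqrt (1 - 2 * r * x + r ^ 2) := fun x hx => by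
    rw [hs]; beta_reduce; rw [max_eq_left (by nlinarith)]
  have hsc : Continuous s := by rw [hs]; fun_prop
  -- the class function as a function of the real part
  set f : ℝ → ℂ := fun x => Complex.exp (-(a + b + 1) * Real.log (s x)) *
    tauChar τ (circleElt (Real.arccos ((1 - r * x) / s x))) with hf
  have hfc : Continuous f := by
    have h1 : Continuous fun x => Real.log (s x) := hsc.log hs0
    have h2 : Continuous fun x => Real.arccos ((1 - r * x) / s x) :=
      Real.continuous_arccos.comp ((by fun_prop : Continuous fun x => 1 - r * x).div hsc hs0)
    exact (Continuous.cexp (by fun_prop)).mul ((continuous_circle_char hτ).comp h2)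
  have hfk : ∀ k : KGroup n, LinearMap.trace ℂ V (radTau τ (a + b + 1) (1 - r • (sp1Part k : ℍ[ℝ])))
      = f (sp1Part k : ℍ[ℝ]).re := fun k => by
    set q := sp1Part k
    have hne : 1 - r • (q : ℍ[ℝ]) ≠ 0 := one_sub_smul_ne_zero (norm_Sp1 q).le hr0.le hr1
    have hnorm : ‖1 - r • (q : ℍ[ℝ])‖ = s (q : ℍ[ℝ]).re := by
      rw [hs1 _ ((abs_le.1 (norm_re_Sp1_le q)).2), eq_comm,
        Real.sqrt_eq_iff_mul_self_eq_of_pos (norm_pos_iff.2 hne),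
        ← Quaternion.normSq_eq_norm_mul_self, Quaternion.normSq_def']
      simp
      linear_combination r ^ 2 * Sp1_coord_sq q
    have hre : (quatSgn (1 - r • (q : ℍ[ℝ])) : ℍ[ℝ]).re
        = (1 - r * (q : ℍ[ℝ]).re) / s (q : ℍ[ℝ]).re := by
      rw [quatSgn_coe hne, hnorm]
      simp [div_eq_inv_mul]
    rw [radTau, map_smul, hnorm, smul_eq_mul]
    change _ * tauChar τ _ = _
    rw [tauChar_eq_circle, hre]
  have hfθ : ∀ θ : ℝ, f (Real.cos θ) = Complex.exp (-(a + b + 1) *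
      Real.log ‖1 - r * Complex.exp (θ * Complex.I)‖)
      * tauChar τ (circleElt (1 - r * Complex.exp (θ * Complex.I)).arg) := fun θ => by
    have hpos := re_one_sub_circle_pos hr0.le hr1 θ
    have hre : (1 - r * Complex.exp (θ * Complex.I)).re = 1 - r * Real.cos θ := by
      rw [Complex.sub_re, Complex.one_re, Complex.re_ofReal_mul, Complex.exp_ofReal_mul_I_re]
    have him : (1 - r * Complex.exp (θ * Complex.I)).im = -(r * Real.sin θ) := by
      rw [Complex.sub_im, Complex.one_im, Complex.im_ofReal_mul, Complex.exp_ofReal_mul_I_im,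
        zero_sub]
    set ζ := 1 - r * Complex.exp (θ * Complex.I) with hζ
    have hζ0 : ζ ≠ 0 := fun h => by rw [h] at hpos; simp at hpos
    have hnorm : ‖ζ‖ = s (Real.cos θ) := by
      rw [hs1 _ (Real.cos_le_one θ), eq_comm,
        Real.sqrt_eq_iff_mul_self_eq_of_pos (norm_pos_iff.2 hζ0), ← sq, ← Complex.normSq_eq_norm_sq,
        Complex.normSq_apply, hre, him]
      linear_combination r ^ 2 * Real.sin_sq_add_cos_sq θ
    rw [hnorm, hf, tauChar_eq_circle (circleElt ζ.arg)]
    have : (circleElt ζ.arg : ℍ[ℝ]).re = (1 - r * Real.cos θ) / s (Real.cos θ) := by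
      change Real.cos ζ.arg = _
      rw [Complex.cos_arg hζ0, hre, hnorm]
    rw [this]
  simp only [hfk]
  rw [weyl_integration f hfc]
  have hck := continuous_circleKernel a b hr0.le hr1
  set D : ℝ → ℂ := fun θ => Complex.exp (θ * Complex.I) *
    (circleKernel a b r θ - circleKernel a b r (-θ)) with hD
  have hDc : Continuous D := by fun_prop
  have hint : ∀ θ : ℝ, f (Real.cos θ) * (Real.sin θ : ℂ) ^ 2 = (4 * r : ℂ)⁻¹ * (D θ + D (-θ)) :=
      fun θ => by
    have h1 := hτ.sin_mul_tauChar_arg a b hab hr0.le hr1 θ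
    rw [← hfθ] at h1
    have h2 : (Real.sin θ : ℂ) = (Complex.exp (-(θ * Complex.I))
        - Complex.exp (θ * Complex.I)) * Complex.I / 2 := by
      rw [Complex.ofReal_sin, Complex.sin, neg_mul]
    have hr : (r : ℂ) ≠ 0 := by exact_mod_cast hr0.ne'
    have h3 : f (Real.cos θ) * (Real.sin θ : ℂ) ^ 2
        = (r : ℂ)⁻¹ * (Real.sin θ * (r * Real.sin θ * f (Real.cos θ))) := by
      field_simp
    rw [h3, h1, h2, hD]
    have hI : Complex.I ≠ 0 := Complex.I_ne_zero
    simp only [Complex.ofReal_neg, neg_mul, neg_neg]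
    field_simp
    ring
  have hDint : ∫ θ in (-Real.pi)..Real.pi, D (-θ) = ∫ θ in (-Real.pi)..Real.pi, D θ := by
    rw [intervalIntegral.integral_comp_neg, neg_neg]
  simp only [hint]
  have hDc' : Continuous fun θ => D (-θ) := hDc.comp continuous_neg
  rw [intervalIntegral.integral_const_mul, intervalIntegral.integral_add
    (hDc.intervalIntegrable _ _) (hDc'.intervalIntegrable _ _)]
  rw [hDint, integral_exp_mul_circleKernel a b hr0.le hr1, hab]
  have hr : (r : ℂ) ≠ 0 := by exact_mod_cast hr0.ne'
  have hpi : (Real.pi : ℂ) ≠ 0 := by exact_mod_cast Real.pi_ne_zero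
  field_simp
  ring

theorem hypF_zero (a b c : ℂ) : hypF a b c 0 = 1 := by
  rw [hypF, tsum_eq_single 0 fun k hk => by simp [hk]]
  simp [hypCoeff_zero]

/-- The average over `Sp(1)` of `|1 - r q|^{-μ} τ(sgn (1 - r q))` is a scalar by Schur's lemma. -/
theorem IsTau.integral_radTau (hτ : IsTau ν τ) (a b : ℂ) (hab : a - b = ν + 1) {r : ℝ}
    (hr0 : 0 ≤ r) (hr1 : r < 1) (v : V) :
    ∫ k : KGroup n, radTau τ (a + b + 1) (1 - r • (sp1Part k : ℍ[ℝ])) v ∂(haarK n)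
      = hypF a b 2 (r ^ 2) • v := by
  have := hτ.finiteDimensional
  have : CompleteSpace V := FiniteDimensional.complete ℂ V
  rcases hr0.eq_or_lt with rfl | hr0
  · have h1 : quatSgn 1 = 1 := by
      have := quatSgn_smul_Sp1 one_pos 1
      rwa [one_smul] at this
    simp [radTau_apply, hypF_zero, h1]
  have hne : ∀ k : KGroup n, 1 - r • (sp1Part k : ℍ[ℝ]) ≠ 0 := fun k =>
    one_sub_smul_ne_zero (norm_Sp1 _).le hr0.le hr1
  have hq : Continuous fun k : KGroup n => (sp1Part k : ℍ[ℝ]) :=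
    continuous_subtype_val.comp continuous_sp1Part
  rw [hτ.integral_apply_eq _ fun v => hτ.continuous_radTau _ (by fun_prop) hne v,
    hτ.integral_trace_radTau a b hab hr0 hr1]
  · have h0 : (ν : ℂ) + 1 ≠ 0 := by exact_mod_cast Nat.succ_ne_zero ν
    rw [inv_mul_cancel_left₀ h0]
  · intro p v
    rw [← integral_haarK_conj _ (ofSp1 p)]
    refine integral_congr_ae (Eventually.of_forall fun k => ?_)
    have e : 1 - r • (sp1Part (ofSp1 p * k * (ofSp1 p)⁻¹) : ℍ[ℝ])
        = p * ((1 - r • (sp1Part k : ℍ[ℝ])) * (p⁻¹ : Sp1)) := by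
      have hp : (p : ℍ[ℝ]) * (p⁻¹ : Sp1) = 1 := congrArg Subtype.val (mul_inv_cancel p)
      rw [map_mul, map_mul, map_inv, sp1Part_ofSp1, Submonoid.coe_mul, Submonoid.coe_mul, sub_mul,
        mul_sub, one_mul, hp, smul_mul_assoc, mul_smul_comm, mul_assoc]
    beta_reduce
    have hne' : (1 - r • (sp1Part k : ℍ[ℝ])) * (p⁻¹ : Sp1) ≠ 0 :=
      mul_ne_zero (hne k) (norm_ne_zero_iff.1 (by rw [norm_Sp1]; exact one_ne_zero))
    rw [e, radTau_mul_left _ hne', radTau_mul_right _ (hne k)]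
    congr 2
    have := apply_inv_apply (τ := τ) p⁻¹ v
    rwa [inv_inv] at this

end RadTau

/-! ### The spherical function -/

section SphericalFunction

variable {V : Type*} [NormedAddCommGroup V] [InnerProductSpace ℂ V] {ν : ℕ}
  {τ : Representation ℂ Sp1 V} {n : ℕ} [NeZero n]

/-- The quaternion `u₀₀ q⁻¹` attached to `k = (u, q) ∈ K`. -/
noncomputable def cornerRatio (k : KGroup n) : ℍ[ℝ] := firstCol k 0 * ((sp1Part k)⁻¹ : Sp1)

theorem continuous_cornerRatio : Continuous (cornerRatio : KGroup n → ℍ[ℝ]) :=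
  (continuous_firstCol 0).mul (continuous_subtype_val.comp continuous_sp1Part.inv)

theorem norm_cornerRatio (k : KGroup n) : ‖cornerRatio k‖ = ‖firstCol k 0‖ := by
  rw [cornerRatio, norm_mul, norm_Sp1, mul_one]

theorem norm_firstCol_le_one (k : KGroup n) : ‖firstCol k 0‖ ≤ 1 := by
  have h1 : ‖firstCol k 0‖ ^ 2 ≤ 1 := sum_norm_firstCol k ▸
    Finset.single_le_sum (f := fun i => ‖firstCol k i‖ ^ 2) (fun _ _ => sq_nonneg _)
      (Finset.mem_univ 0)
  exact (sq_le_one_iff₀ (norm_nonneg _)).1 h1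

theorem cornerRatio_ofSp1_mul (l : Sp1) (k : KGroup n) :
    cornerRatio (ofSp1 l⁻¹ * k) = cornerRatio k * l := by
  rw [cornerRatio, cornerRatio, firstCol, firstCol, spnMat_mul, spnMat_ofSp1, one_mul, map_mul,
    sp1Part_ofSp1, mul_inv_rev, inv_inv, Submonoid.coe_mul, mul_assoc]

theorem risingFac_natCast_ne_zero {m : ℕ} (hm : m ≠ 0) (k : ℕ) : risingFac (m : ℂ) k ≠ 0 :=
  risingFac_ne_zero (fun j h => by
    have h1 : ((m + j : ℕ) : ℂ) = 0 := by push_cast; rw [h]; ring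
    have h2 : m + j = 0 := by exact_mod_cast h1
    omega) k

/-- The moments of `|u₀₀|²`. -/
theorem moment_firstCol (m : ℕ) :
    ((∫ k : KGroup n, (‖firstCol k 0‖ ^ 2) ^ m ∂(haarK n) : ℝ) : ℂ)
      = risingFac 2 m / risingFac ((2 * n : ℕ) : ℂ) m := by
  have hn := NeZero.ne n
  induction m with
  | zero => simp [risingFac_zero]
  | succ m ih =>
    have h := moment_firstCol_succ (n := n) m
    have h2 := congrArg (fun x : ℝ => (x : ℂ)) h
    simp only [Complex.ofReal_mul, ih] at h2
    have h3 := risingFac_natCast_ne_zero (m := 2 * n) (by omega) m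
    have h4 : ((2 * n : ℕ) : ℂ) + m ≠ 0 := by
      have : ((2 * n + m : ℕ) : ℂ) ≠ 0 := by exact_mod_cast (by omega : 2 * n + m ≠ 0)
      simpa using this
    rw [risingFac_succ, risingFac_succ, eq_div_iff (mul_ne_zero h3 h4)]
    push_cast at h2 h3 h4 ⊢
    field_simp at h2
    linear_combination h2

/-- The moments `(2)_m / (2n)_m` of `|u₀₀|²` replace the parameter `2` by `2n`, term by term. -/
theorem integral_hypF_firstCol (a b : ℂ) {r : ℝ} (hr0 : 0 ≤ r) (hr1 : r < 1) :
    ∫ k : KGroup n, hypF a b 2 ((r * ‖firstCol k 0‖) ^ 2) ∂(haarK n)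
      = hypF a b ((2 * n : ℕ) : ℂ) (r ^ 2) := by
  have hr2 : ‖((r ^ 2 : ℝ) : ℂ)‖ < 1 := by
    rw [Complex.norm_real, Real.norm_of_nonneg (sq_nonneg r)]; nlinarith
  have hc2 : ∀ m : ℕ, (2 : ℂ) ≠ -m := fun m h => by
    have h1 : ((2 + m : ℕ) : ℂ) = 0 := by push_cast; rw [h]; ring
    have h2 : 2 + m = 0 := by exact_mod_cast h1
    omega
  have hs := summable_hypCoeff a b hc2 hr2
  have hcont := (continuous_firstCol (n := n) 0).norm
  have hint := hasSum_integral_of_dominated_convergence (μ := haarK n)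
    (F := fun (j : ℕ) (k : KGroup n) => hypCoeff a b 2 j * (((r * ‖firstCol k 0‖) ^ 2 : ℝ) : ℂ) ^ j)
    (f := fun k => hypF a b 2 ((r * ‖firstCol k 0‖) ^ 2))
    (fun j _ => ‖hypCoeff a b 2 j * ((r ^ 2 : ℝ) : ℂ) ^ j‖)
    (fun j => by
      have : Continuous fun k : KGroup n =>
        hypCoeff a b 2 j * (((r * ‖firstCol k 0‖) ^ 2 : ℝ) : ℂ) ^ j := by fun_prop
      exact this.aestronglyMeasurable)
    (fun j => Eventually.of_forall fun k => by
      have h1 := norm_firstCol_le_one k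
      have h0 := norm_nonneg (firstCol k 0)
      rw [norm_mul, norm_mul, norm_pow, norm_pow, Complex.norm_real, Complex.norm_real,
        Real.norm_of_nonneg (sq_nonneg _), Real.norm_of_nonneg (sq_nonneg _)]
      refine mul_le_mul_of_nonneg_left (pow_le_pow_left₀ (sq_nonneg _) ?_ _) (norm_nonneg _)
      exact pow_le_pow_left₀ (by positivity) (mul_le_of_le_one_right hr0 h1) _)
    (Eventually.of_forall fun k => hs) (by simp)
    (Eventually.of_forall fun k => by
      refine (summable_hypCoeff a b hc2 ?_).of_norm.hasSum
      have h1 := norm_firstCol_le_one k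
      have h0 := norm_nonneg (firstCol k 0)
      rw [Complex.norm_real, Real.norm_of_nonneg (sq_nonneg _)]
      have : r * ‖firstCol k 0‖ < 1 := by nlinarith
      have h2 : 0 ≤ r * ‖firstCol k 0‖ := by positivity
      nlinarith)
  rw [← hint.tsum_eq, hypF]
  refine tsum_congr fun j => ?_
  have e : ∀ k : KGroup n, (((r * ‖firstCol k 0‖) ^ 2 : ℝ) : ℂ) ^ j
      = ((r ^ 2 : ℝ) : ℂ) ^ j * (((‖firstCol k 0‖ ^ 2) ^ j : ℝ) : ℂ) := fun k => by
    push_cast; rw [mul_pow, mul_pow]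
  simp only [e]
  rw [integral_const_mul, integral_const_mul, integral_complex_ofReal, moment_firstCol]
  have h2 := risingFac_natCast_ne_zero (m := 2) (by omega) j
  have h3 := risingFac_natCast_ne_zero (m := 2 * n) (by have := NeZero.ne n; omega) j
  rw [hypCoeff, hypCoeff]
  push_cast at h2 h3 ⊢
  field_simp

/-- Left translation by `Sp(1)` multiplies `u₀₀ q⁻¹` on the right by a unit quaternion. The
average over these translations is given by `IsTau.integral_radTau`, the remaining one, over
`|u₀₀|`, by `integral_hypF_firstCol`. -/
theorem IsTau.integral_radTau_cornerRatio (hτ : IsTau ν τ) (a b : ℂ) (hab : a - b = ν + 1) {r : ℝ}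
    (hr0 : 0 ≤ r) (hr1 : r < 1) (v : V) :
    ∫ k : KGroup n, radTau τ (a + b + 1) (1 - r • cornerRatio k) v ∂(haarK n)
      = hypF a b ((2 * n : ℕ) : ℂ) (r ^ 2) • v := by
  have := hτ.finiteDimensional
  have : CompleteSpace V := FiniteDimensional.complete ℂ V
  have hle : ∀ k : KGroup n, ‖cornerRatio k‖ ≤ 1 := fun k =>
    (norm_cornerRatio k).trans_le (norm_firstCol_le_one k)
  have hq : Continuous fun k : KGroup n => (sp1Part k : ℍ[ℝ]) :=
    continuous_subtype_val.comp continuous_sp1Part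
  set F : KGroup n → KGroup n → V := fun l k =>
    radTau τ (a + b + 1) (1 - r • (cornerRatio k * (sp1Part l : ℍ[ℝ]))) v with hF
  have hFc : Continuous (Function.uncurry F) := by
    refine hτ.continuous_radTau _ ?_ (fun p => ?_) v
    · have h1 : Continuous fun p : KGroup n × KGroup n => cornerRatio p.2 :=
        continuous_cornerRatio.comp continuous_snd
      have h2 : Continuous fun p : KGroup n × KGroup n => (sp1Part p.1 : ℍ[ℝ]) :=
        hq.comp continuous_fst
      fun_prop
    · refine one_sub_smul_ne_zero ?_ hr0 hr1
      rw [norm_mul, norm_Sp1, mul_one]; exact hle _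
  have h1 : ∀ l : KGroup n, ∫ k, F l k ∂(haarK n)
      = ∫ k, radTau τ (a + b + 1) (1 - r • cornerRatio k) v ∂(haarK n) := fun l => by
    refine (integral_congr_ae (Eventually.of_forall fun k => ?_)).trans (integral_haarK_mul_left
      (fun k => radTau τ (a + b + 1) (1 - r • cornerRatio k) v) (ofSp1 (sp1Part l)⁻¹))
    simp only [hF, cornerRatio_ofSp1_mul]
  have h2 : ∀ k : KGroup n, ∫ l, F l k ∂(haarK n) = hypF a b 2 ((r * ‖firstCol k 0‖) ^ 2) • v :=
      fun k => by
    rw [← hτ.integral_radTau (n := n) a b hab (by positivity)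
      (by nlinarith [norm_firstCol_le_one k, norm_nonneg (firstCol k 0)]),
      ← integral_haarK_mul_left (fun l => F l k) (ofSp1 (quatSgn (cornerRatio k))⁻¹)]
    have hw : cornerRatio k * ((quatSgn (cornerRatio k))⁻¹ : Sp1) = ‖cornerRatio k‖ • 1 := by
      have h := congrArg (· * (((quatSgn (cornerRatio k))⁻¹ : Sp1) : ℍ[ℝ]))
        (norm_smul_quatSgn (cornerRatio k))
      have hp : (quatSgn (cornerRatio k) : ℍ[ℝ]) * ((quatSgn (cornerRatio k))⁻¹ : Sp1) = 1 :=
        congrArg Subtype.val (mul_inv_cancel (quatSgn (cornerRatio k)))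
      beta_reduce at h
      rw [← h, smul_mul_assoc, hp]
    refine integral_congr_ae (Eventually.of_forall fun l => ?_)
    simp only [hF, map_mul, sp1Part_ofSp1, Submonoid.coe_mul]
    rw [← mul_assoc, hw, smul_mul_assoc, one_mul, norm_cornerRatio, mul_smul]
  have h3 : ∫ l, ∫ k, F l k ∂(haarK n) ∂(haarK n) = ∫ k, ∫ l, F l k ∂(haarK n) ∂(haarK n) :=
    integral_integral_swap_of_hasCompactSupport hFc (HasCompactSupport.of_compactSpace _)
  simp only [h1, h2] at h3
  rw [integral_const, probReal_univ, one_smul] at h3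
  rw [h3, integral_smul_const, integral_hypF_firstCol a b hr0 hr1]

/-- The Iwasawa data of `a_{-s} k`, as they enter the integral of the spherical function. -/
theorem nullEntry_aElt_mul (s : ℝ) (k : KGroup n) :
    nullEntry (aElt n (-s) * ofK k) * ((sp1Part k)⁻¹ : Sp1)
      = Real.cosh s • (1 - Real.tanh s • cornerRatio k) := by
  have hp : (sp1Part k : ℍ[ℝ]) * ((sp1Part k)⁻¹ : Sp1) = 1 :=
    congrArg Subtype.val (mul_inv_cancel (sp1Part k))
  have h1 : toMat (aElt n (-s) * ofK k) (Sum.inr ()) (Sum.inl 0)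
      = -(Real.sinh s • firstCol k 0) := by
    rw [toMat_mul, toMat_aElt, toMat_ofK, Matrix.mul_apply, Fintype.sum_sum_type]
    simp [aMat, kMat, firstCol, spnMat, Quaternion.coe_mul_eq_smul]
  have h2 : toMat (aElt n (-s) * ofK k) (Sum.inr ()) (Sum.inr ())
      = Real.cosh s • (sp1Part k : ℍ[ℝ]) := by
    rw [toMat_mul, toMat_aElt, toMat_ofK, Matrix.mul_apply, Fintype.sum_sum_type]
    simp [aMat, kMat, sp1Part, Quaternion.coe_mul_eq_smul]
    rfl
  have hc := (Real.cosh_pos s).ne'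
  rw [nullEntry_eq, h1, h2, add_mul, smul_mul_assoc, hp, neg_mul, smul_mul_assoc, smul_sub,
    smul_smul, Real.tanh_eq_sinh_div_cosh, mul_div_cancel₀ _ hc, cornerRatio]
  abel

/-- The spherical function in terms of the corner entry `Y` of its argument: `Φ(y) = |Y|^{-(iλ+ρ)}
F(a, b; 2n; 1 - |Y|^{-2}) τ(Y / |Y|)⁻¹`. For `y = k₁ a_s k₂` one has `|Y| = cosh s`, and the
argument of `F` is `tanh² s`. -/
theorem IsTau.sphericalFn_eq (hτ : IsTau ν τ) (lam : ℂ) (k₁ k₂ : KGroup n) {s : ℝ} (hs : 0 ≤ s)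
    {y : Spn1 n} (hy : y = ofK k₁ * aElt n s * ofK k₂) (v : V) :
    sphericalFn τ lam y v = (Complex.exp (-(Complex.I * lam + rho n) * Real.log ‖cornerEntry y‖)
      * hypF ((Complex.I * lam + rho n + ν) / 2) ((Complex.I * lam + rho n - ν - 2) / 2)
          ((2 * n : ℕ) : ℂ) (1 - (‖cornerEntry y‖ ^ 2)⁻¹)) •
      τ (quatSgn (cornerEntry y))⁻¹ v := by
  have := hτ.finiteDimensional
  have : CompleteSpace V := FiniteDimensional.complete ℂ V
  set a := (Complex.I * lam + rho n + ν) / 2 with ha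
  set b := (Complex.I * lam + rho n - ν - 2) / 2 with hb
  set μ := Complex.I * lam + rho n with hμ
  have hμab : a + b + 1 = μ := by rw [ha, hb]; ring
  have hab : a - b = ν + 1 := by rw [ha, hb]; ring
  have hr0 : 0 ≤ Real.tanh s := by
    rw [Real.tanh_eq_sinh_div_cosh]
    exact div_nonneg (Real.sinh_nonneg_iff.2 hs) (Real.cosh_pos s).le
  have hr1 : Real.tanh s < 1 := Real.tanh_lt_one s
  have hne : ∀ k : KGroup n, 1 - Real.tanh s • cornerRatio k ≠ 0 := fun k =>
    one_sub_smul_ne_zero ((norm_cornerRatio k).trans_le (norm_firstCol_le_one k)) hr0 hr1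
  have hint : ∀ k, Complex.exp (-μ * iwasawaH (y⁻¹ * ofK (k₁ * k))) •
      extK n τ (iwasawaK (y⁻¹ * ofK (k₁ * k)) * (k₁ * k)⁻¹) v
      = Complex.exp (-μ * Real.log (Real.cosh s)) • τ (sp1Part k₂⁻¹)
        (radTau τ μ (1 - Real.tanh s • cornerRatio k) (τ (sp1Part k₁⁻¹) v)) := fun k => by
    have e1 : y⁻¹ * ofK (k₁ * k) = ofK k₂⁻¹ * (aElt n (-s) * ofK k) := by
      rw [hy, map_mul, map_inv, aElt_neg]; group
    have e2 : sp1Part (iwasawaK (y⁻¹ * ofK (k₁ * k))) = sp1Part k₂⁻¹ *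
        quatSgn (nullEntry (aElt n (-s) * ofK k)) := by
      have h3 := iwasawaK_snd (y⁻¹ * ofK (k₁ * k))
      rw [e1] at h3 ⊢
      have h4 := nullEntry_ofK_mul k₂⁻¹ (aElt n (-s) * ofK k)
      rw [h4] at h3
      exact h3.trans (quatSgn_mul_left (nullEntry_ne_zero _) _)
    have e3 : iwasawaH (y⁻¹ * ofK (k₁ * k)) = Real.log ‖nullEntry (aElt n (-s) * ofK k)‖ := by
      rw [iwasawaH_eq_log, e1, nullEntry_ofK_mul, norm_mul, norm_Sp1, one_mul]
    have e4 : Complex.exp (-μ * Real.log (Real.cosh s)) • τ (sp1Part k₂⁻¹)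
        (radTau τ μ (1 - Real.tanh s • cornerRatio k) (τ (sp1Part k₁⁻¹) v))
        = τ (sp1Part k₂⁻¹) (radTau τ μ (nullEntry (aElt n (-s) * ofK k)
          * ((sp1Part k)⁻¹ : Sp1)) (τ (sp1Part k₁⁻¹) v)) := by
      rw [nullEntry_aElt_mul, radTau_real_smul μ (hne k) (Real.cosh_pos s), map_smul]
    rw [e4, extK_apply, map_mul sp1Part, e2, e3, mul_inv_rev, map_mul sp1Part k⁻¹,
      radTau_mul_right _ (nullEntry_ne_zero _), radTau_apply, map_smul, map_inv sp1Part k]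
    simp only [map_mul, Module.End.mul_apply]
  rw [sphericalFn, ← integral_haarK_mul_left _ k₁]
  rw [integral_congr_ae (Eventually.of_forall hint), integral_smul]
  have hcont : Continuous fun k : KGroup n =>
      radTau τ μ (1 - Real.tanh s • cornerRatio k) (τ (sp1Part k₁⁻¹) v) := by
    have := continuous_cornerRatio (n := n)
    exact hτ.continuous_radTau _ (by fun_prop) hne _
  have h5 := (LinearMap.toContinuousLinearMap (τ (sp1Part k₂⁻¹))).integral_comp_comm
    (integrable_haarK hcont)
  simp only [LinearMap.coe_toContinuousLinearMap'] at h5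
  rw [h5, ← hμab, hτ.integral_radTau_cornerRatio a b hab hr0 hr1]
  have hY : cornerEntry y = Real.cosh s • ((sp1Part k₁ * sp1Part k₂ : Sp1) : ℍ[ℝ]) := by
    rw [hy, cornerEntry_cartan]; rfl
  have hYn : ‖cornerEntry y‖ = Real.cosh s := by
    rw [hY, norm_smul, norm_Sp1, mul_one, Real.norm_of_nonneg (Real.cosh_pos s).le]
  have hz : Real.tanh s ^ 2 = 1 - (Real.cosh s ^ 2)⁻¹ := by
    have hc := (Real.cosh_pos s).ne'
    rw [Real.tanh_eq_sinh_div_cosh, div_pow, Real.sinh_sq]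
    field_simp
  rw [map_smul, smul_smul, hYn, hY, quatSgn_smul_Sp1 (Real.cosh_pos s), hz, mul_inv_rev,
    map_mul τ, map_inv sp1Part, map_inv sp1Part]
  rfl

end SphericalFunction

/-! ### Polar coordinates and the function spaces -/

section Polar

variable {n : ℕ}

theorem continuous_toMat : Continuous (toMat : Spn1 n → QMat n) :=
  Units.continuous_val.comp continuous_subtype_val

theorem continuous_cornerEntry : Continuous (cornerEntry : Spn1 n → ℍ[ℝ]) :=
  (continuous_apply_apply (Sum.inr ()) (Sum.inr ())).comp continuous_toMat

theorem continuous_kMat : Continuous (kMat : KGroup n → QMat n) := by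
  have h1 : Continuous fun k : KGroup n => spnMat k := continuous_spnMat
  have h2 : Continuous fun k : KGroup n => (sp1Part k : ℍ[ℝ]) :=
    continuous_subtype_val.comp continuous_sp1Part
  exact h1.matrix_fromBlocks continuous_const continuous_const
    (Continuous.matrix_diagonal (continuous_pi fun _ => h2))

theorem continuous_ofK : Continuous (ofK : KGroup n → Spn1 n) := by
  have h : Continuous fun k : KGroup n => ((ofK k : Spn1 n) : (QMat n)ˣ) :=
    Units.continuous_iff.2 ⟨continuous_kMat, continuous_kMat.comp continuous_inv⟩
  exact h.subtype_mk _

theorem continuous_weight : Continuous (weight n) := by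
  unfold weight
  have h1 := Real.continuous_sinh
  have h2 := Real.continuous_cosh
  fun_prop

variable [NeZero n]

theorem continuous_aMat : Continuous (aMat n) := by
  have hc : Continuous fun t : ℝ => ((Real.cosh t : ℝ) : ℍ[ℝ]) :=
    Quaternion.continuous_coe.comp Real.continuous_cosh
  have hs : Continuous fun t : ℝ => ((Real.sinh t : ℝ) : ℍ[ℝ]) :=
    Quaternion.continuous_coe.comp Real.continuous_sinh
  refine Continuous.matrix_fromBlocks ?_ ?_ ?_ ?_
  · exact Continuous.matrix_diagonal (continuous_pi fun i => by split_ifs <;> fun_prop)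
  · exact continuous_pi fun i => continuous_pi fun j => by
      simp only [Matrix.of_apply]; split_ifs <;> fun_prop
  · exact continuous_pi fun i => continuous_pi fun j => by
      simp only [Matrix.of_apply]; split_ifs <;> fun_prop
  · exact Continuous.matrix_diagonal (continuous_pi fun i => by fun_prop)

theorem continuous_aElt : Continuous (aElt n) := by
  have h : Continuous fun t : ℝ => ((aElt n t : Spn1 n) : (QMat n)ˣ) :=
    Units.continuous_iff.2 ⟨continuous_aMat, continuous_aMat.comp continuous_neg⟩
  exact h.subtype_mk _

theorem continuous_polar :
    Continuous fun p : KGroup n × ℝ × KGroup n => ofK p.1 * aElt n p.2.1 * ofK p.2.2 :=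
  ((continuous_ofK.comp continuous_fst).mul
    (continuous_aElt.comp (continuous_fst.comp continuous_snd))).mul
    (continuous_ofK.comp (continuous_snd.comp continuous_snd))

/-- The Cartan decomposition `G = K A K`, as a property. A choice of `k₁(x)`, `k₂(x)` for all `x`
provides it. -/
def HasCartan (n : ℕ) [NeZero n] : Prop :=
  ∀ x : Spn1 n, ∃ (k₁ k₂ : KGroup n) (t : ℝ), x = ofK k₁ * aElt n t * ofK k₂

theorem cartanA_eq_arcosh (hC : HasCartan n) (x : Spn1 n) :
    cartanA x = Real.arcosh ‖cornerEntry x‖ := by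
  rw [← cosh_cartanA (hC x), Real.arcosh_cosh (cartanA_spec (hC x)).1]

theorem continuous_cartanA (hC : HasCartan n) : Continuous (cartanA : Spn1 n → ℝ) := by
  rw [show (cartanA : Spn1 n → ℝ) = _ from funext (cartanA_eq_arcosh hC)]
  exact Real.continuousOn_arcosh.comp_continuous continuous_cornerEntry.norm one_le_norm_cornerEntry

/-- The Cartan projection maps the invariant measure to `(2 sinh t)^{4n-1} (2 cosh t)^3 dt` on
`(0, ∞)`. -/
theorem map_cartanA_haarG (hC : HasCartan n) : Measure.map cartanA (haarG n)
    = (volume.restrict (Set.Ioi (0 : ℝ))).withDensity fun t => ENNReal.ofReal (weight n t) := by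
  rw [haarG, Measure.map_map (continuous_cartanA hC).measurable continuous_polar.measurable]
  set W := (volume.restrict (Set.Ioi (0 : ℝ))).withDensity fun t => ENNReal.ofReal (weight n t)
  have hpos : ∀ᵐ t ∂W, 0 ≤ t := by
    refine (withDensity_absolutelyContinuous _ _).ae_le ?_
    filter_upwards [ae_restrict_mem measurableSet_Ioi] with t ht using le_of_lt ht
  have hpos' : ∀ᵐ p ∂((haarK n).prod (W.prod (haarK n))), 0 ≤ p.2.1 :=
    Measure.quasiMeasurePreserving_snd.ae (Measure.quasiMeasurePreserving_fst.ae hpos)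
  have h1 : (cartanA ∘ fun p : KGroup n × ℝ × KGroup n => ofK p.1 * aElt n p.2.1 * ofK p.2.2)
      =ᵐ[(haarK n).prod (W.prod (haarK n))] (Prod.fst ∘ Prod.snd) := by
    filter_upwards [hpos'] with p hp using cartanA_eq hp
  rw [Measure.map_congr h1, ← Measure.map_map measurable_fst measurable_snd, Measure.map_snd_prod,
    measure_univ, one_smul, Measure.map_fst_prod, measure_univ, one_smul]

/-- The density of the invariant measure is at most `8 e^{2ρt}`. -/
theorem weight_mul_exp_le {t : ℝ} (ht : 0 ≤ t) :
    weight n t * Real.exp (-(2 * n + 1) * t) ^ 2 ≤ 8 := by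
  have h1 : 2 * Real.sinh t ≤ Real.exp t := by
    rw [Real.sinh_eq]; linarith [Real.exp_pos (-t)]
  have h0 : 0 ≤ 2 * Real.sinh t := by linarith [Real.sinh_nonneg_iff.2 ht]
  have h2 : 2 * Real.cosh t ≤ 2 * Real.exp t := by
    have : Real.exp (-t) ≤ Real.exp t := Real.exp_le_exp.2 (by linarith)
    rw [Real.cosh_eq]; linarith
  have h3 : 0 ≤ 2 * Real.cosh t := by linarith [Real.cosh_pos t]
  calc weight n t * Real.exp (-(2 * n + 1) * t) ^ 2
      ≤ (Real.exp t ^ (4 * n - 1) * (2 * Real.exp t) ^ 3) * Real.exp (-(2 * n + 1) * t) ^ 2 := by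
        unfold weight; gcongr
    _ = 8 * (Real.exp t ^ (4 * n - 1) * Real.exp t ^ 3 * Real.exp (-(2 * n + 1) * t) ^ 2) := by ring
    _ = 8 := by
      rw [← pow_add, ← Real.exp_nat_mul, ← Real.exp_nat_mul, ← Real.exp_add]
      have hn := NeZero.one_le (n := n)
      have : ((4 * n - 1 + 3 : ℕ) : ℝ) = 4 * n + 2 := by
        rw [show 4 * n - 1 + 3 = 4 * n + 2 by omega]; push_cast; ring
      rw [this]
      rw [show (4 * (n : ℝ) + 2) * t + ((2 : ℕ) : ℝ) * (-(2 * n + 1) * t) = 0 by push_cast; ring,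
        Real.exp_zero, mul_one]

/-- A function of size `e^{-ρ t}` has mean square of the size of the interval of radii. -/
theorem lintegral_enorm_sq_le {E : Type*} [NormedAddCommGroup E] (hC : HasCartan n)
    {F : Spn1 n → E} {m : ℝ} {I : Set ℝ}
    (hI : MeasurableSet I)
    (hF : ∀ x, cartanA x ∈ I → ‖F x‖ ≤ m * Real.exp (-(2 * n + 1) * cartanA x)) :
    ∫⁻ x in cartanA ⁻¹' I, ‖F x‖ₑ ^ 2 ∂(haarG n)
      ≤ ENNReal.ofReal (8 * m ^ 2) * volume (I ∩ Set.Ioi 0) := by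
  have hm := (continuous_cartanA hC).measurable
  set f : ℝ → ℝ≥0∞ := fun t => ENNReal.ofReal ((m * Real.exp (-(2 * n + 1) * t)) ^ 2) with hf
  have hfm : Measurable f := by fun_prop
  have hw : Measurable fun t => ENNReal.ofReal (weight n t) :=
    continuous_weight.measurable.ennreal_ofReal
  calc ∫⁻ x in cartanA ⁻¹' I, ‖F x‖ₑ ^ 2 ∂(haarG n)
      ≤ ∫⁻ x in cartanA ⁻¹' I, f (cartanA x) ∂(haarG n) := by
        refine setLIntegral_mono' (hm hI) fun x hx => ?_
        rw [hf, ← ofReal_norm, ← ENNReal.ofReal_pow (norm_nonneg _)]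
        exact ENNReal.ofReal_le_ofReal (pow_le_pow_left₀ (norm_nonneg _) (hF x hx) 2)
    _ = ∫⁻ t in I, f t ∂(Measure.map cartanA (haarG n)) := (setLIntegral_map hI hfm hm).symm
    _ = ∫⁻ t in I ∩ Set.Ioi 0, ENNReal.ofReal (weight n t) * f t := by
        rw [map_cartanA_haarG hC, restrict_withDensity hI, Measure.restrict_restrict hI,
          lintegral_withDensity_eq_lintegral_mul _ hw hfm]
        rfl
    _ ≤ ∫⁻ t in I ∩ Set.Ioi 0, ENNReal.ofReal (8 * m ^ 2) := by
        refine setLIntegral_mono' (hI.inter measurableSet_Ioi) fun t ht => ?_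
        have ht0 : 0 ≤ t := le_of_lt ht.2
        have h0 : 0 ≤ weight n t := by
          have := Real.sinh_nonneg_iff.2 ht0
          have := (Real.cosh_pos t).le
          unfold weight; positivity
        rw [hf, ← ENNReal.ofReal_mul h0]
        refine ENNReal.ofReal_le_ofReal ?_
        nlinarith [weight_mul_exp_le (n := n) ht0, sq_nonneg m]
    _ = _ := setLIntegral_const _ _

theorem ball_eq (R : ℝ) : ball n R = cartanA ⁻¹' Set.Iio R := rfl

theorem volume_Iio_inter_Ioi (R : ℝ) : volume (Set.Iio R ∩ Set.Ioi (0 : ℝ)) = ENNReal.ofReal R := by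
  rw [Set.inter_comm, Set.Ioi_inter_Iio, Real.volume_Ioo, sub_zero]

theorem haarG_ball_lt_top (hC : HasCartan n) (R : ℝ) : haarG n (ball n R) < ∞ := by
  have hm := (continuous_cartanA hC).measurable
  rw [ball_eq, ← Measure.map_apply hm measurableSet_Iio, map_cartanA_haarG hC,
    withDensity_apply _ measurableSet_Iio, Measure.restrict_restrict measurableSet_Iio,
    Set.inter_comm, Set.Ioi_inter_Iio]
  have h : IntegrableOn (weight n) (Set.Ioo 0 R) :=
    (continuous_weight.integrableOn_Icc).mono_set Set.Ioo_subset_Icc_self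
  exact h.lintegral_lt_top

theorem ae_cartanA_pos (hC : HasCartan n) : ∀ᵐ x ∂(haarG n), 0 < cartanA x := by
  have hm := (continuous_cartanA hC).measurable
  refine ae_of_ae_map hm.aemeasurable ?_
  rw [map_cartanA_haarG hC]
  exact (withDensity_absolutelyContinuous _ _).ae_le (ae_restrict_mem measurableSet_Ioi)

variable {V : Type*} [NormedAddCommGroup V]

/-- A function of size `e^{-ρt}` has finite `B*`-norm: its mean square over `A_j` is `O(2^j)`. -/
theorem bStarNorm_lt_top (hC : HasCartan n) {F : Spn1 n → V} {m : ℝ}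
    (hF : ∀ x, ‖F x‖ ≤ m * Real.exp (-(2 * n + 1) * cartanA x)) : bStarNorm F < ∞ := by
  refine lt_of_le_of_lt (iSup_le fun j => ?_)
    (ENNReal.ofReal_lt_top (r := (8 * m ^ 2) ^ (1 / 2 : ℝ)))
  have hsub : shell n j ⊆ cartanA ⁻¹' Set.Iio ((2 : ℝ) ^ j) := by
    intro x hx
    unfold shell at hx
    split_ifs at hx with hj
    · rw [hj, pow_zero]; exact hx
    · exact hx.2
  have h1 : ∫⁻ g in shell n j, ‖F g‖ₑ ^ 2 ∂(haarG n) ≤ ENNReal.ofReal (8 * m ^ 2 * 2 ^ j) := by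
    refine (lintegral_mono_set hsub).trans
      ((lintegral_enorm_sq_le hC measurableSet_Iio fun x _ => hF x).trans_eq ?_)
    rw [volume_Iio_inter_Ioi, ← ENNReal.ofReal_mul (by positivity)]
  refine (mul_le_mul_right (ENNReal.rpow_le_rpow h1 (by norm_num)) _).trans_eq ?_
  rw [ENNReal.ofReal_rpow_of_nonneg (by positivity) (by norm_num),
    ← ENNReal.ofReal_mul (by positivity)]
  congr 1
  rw [Real.mul_rpow (by positivity) (by positivity), mul_left_comm, ← Real.rpow_natCast 2 j,
    ← Real.rpow_mul (by norm_num), ← Real.rpow_add (by norm_num),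
    show -(j : ℝ) / 2 + j * (1 / 2) = 0 by ring, Real.rpow_zero, mul_one]

theorem memBStar_of_bound [InnerProductSpace ℂ V] (hC : HasCartan n)
    {τ : Representation ℂ Sp1 V} {F : Spn1 n → V} {m : ℝ}
    (hcov : ∀ᵐ g ∂(haarG n), ∀ k : KGroup n, F (g * ofK k) = extK n τ k⁻¹ (F g))
    (hmeas : AEStronglyMeasurable F (haarG n))
    (hF : ∀ x, ‖F x‖ ≤ m * Real.exp (-(2 * n + 1) * cartanA x)) : MemBStar τ F := by
  refine ⟨⟨hcov, fun R => ?_⟩, bStarNorm_lt_top hC hF⟩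
  have : IsFiniteMeasure ((haarG n).restrict (ball n R)) :=
    ⟨by rw [Measure.restrict_apply_univ]; exact haarG_ball_lt_top hC R⟩
  have hm0 : 0 ≤ m := by
    have := (norm_nonneg _).trans (hF 1)
    exact nonneg_of_mul_nonneg_left this (Real.exp_pos _)
  refine MemLp.of_bound hmeas.restrict m (Eventually.of_forall fun x => (hF x).trans ?_)
  refine mul_le_of_le_one_right hm0 (Real.exp_le_one_iff.2 ?_)
  have h0 := (cartanA_spec (hC x)).1
  have : (0 : ℝ) ≤ 2 * n + 1 := by positivity
  nlinarith

/-- A difference which is `O(e^{-ρt})` everywhere and `o(e^{-ρt})` uniformly in the `K`-components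
has mean square `o(R)` over `B(R)`. -/
theorem asympEq_of_bound (hC : HasCartan n) {F₁ F₂ : Spn1 n → V} {m : ℝ}
    (hF : ∀ x, ‖F₁ x - F₂ x‖ ≤ m * Real.exp (-(2 * n + 1) * cartanA x))
    (hlim : ∀ ε > 0, ∃ T : ℝ, ∀ x, T ≤ cartanA x →
      ‖F₁ x - F₂ x‖ ≤ ε * Real.exp (-(2 * n + 1) * cartanA x)) : AsympEq F₁ F₂ := by
  unfold AsympEq
  rw [ENNReal.tendsto_nhds_zero]
  intro δ hδ
  obtain ⟨d, hd0, hd⟩ : ∃ d : ℝ, 0 < d ∧ ENNReal.ofReal d ≤ δ := by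
    rcases eq_or_ne δ ∞ with rfl | h
    · exact ⟨1, one_pos, le_top⟩
    · exact ⟨δ.toReal, ENNReal.toReal_pos hδ.ne' h, ENNReal.ofReal_toReal_le⟩
  obtain ⟨T, hT⟩ := hlim (Real.sqrt (d / 16)) (by positivity)
  filter_upwards [eventually_gt_atTop 0, eventually_ge_atTop (8 * m ^ 2 * max T 0 / (d / 2))]
    with R hR hR2
  have hbound : ∫⁻ g in ball n R, ‖F₁ g - F₂ g‖ₑ ^ 2 ∂(haarG n)
      ≤ ENNReal.ofReal (8 * m ^ 2 * max T 0) + ENNReal.ofReal (d / 2 * R) := by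
    have hsub : ball n R ⊆ cartanA ⁻¹' Set.Iio (max T 0) ∪ cartanA ⁻¹' Set.Ico (max T 0) R := by
      intro x hx
      rcases lt_or_ge (cartanA x) (max T 0) with h | h
      · exact Or.inl h
      · exact Or.inr ⟨h, hx⟩
    refine (lintegral_mono_set hsub).trans ((lintegral_union_le _ _ _).trans (add_le_add ?_ ?_))
    · refine (lintegral_enorm_sq_le hC measurableSet_Iio fun x _ => hF x).trans_eq ?_
      rw [volume_Iio_inter_Ioi, ← ENNReal.ofReal_mul (by positivity)]
    · refine (lintegral_enorm_sq_le hC measurableSet_Ico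
        fun x hx => hT x ((le_max_left _ _).trans hx.1)).trans ?_
      rw [Real.sq_sqrt (by positivity), show 8 * (d / 16) = d / 2 by ring,
        ENNReal.ofReal_mul (by positivity)]
      gcongr
      rw [← volume_Iio_inter_Ioi]
      exact measure_mono (Set.inter_subset_inter_left _ fun t ht => ht.2)
  refine le_trans ?_ hd
  refine (mul_le_mul_right hbound _).trans ?_
  rw [← ENNReal.ofReal_add (by positivity) (by positivity), ← ENNReal.ofReal_mul (by positivity)]
  refine ENNReal.ofReal_le_ofReal ?_
  rw [div_le_iff₀ (by positivity)] at hR2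
  rw [one_div, inv_mul_le_iff₀ hR]
  nlinarith

end Polar

/-! ### The corner entry of `g⁻¹ x` -/

section Asymptotics

variable {V : Type*} [NormedAddCommGroup V] [InnerProductSpace ℂ V] {ν : ℕ}
  {τ : Representation ℂ Sp1 V} {n : ℕ}

theorem cornerEntry_mul_ofK (x : Spn1 n) (k : KGroup n) :
    cornerEntry (x * ofK k) = cornerEntry x * (sp1Part k : ℍ[ℝ]) := by
  rw [cornerEntry, toMat_mul, toMat_ofK, Matrix.mul_apply, Fintype.sum_sum_type]
  simp [kMat]
  rfl

/-- The element `diag (1, …, 1, -1)` of `G`. -/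
noncomputable def reflElt (n : ℕ) : Spn1 n :=
  ⟨⟨formJ n, formJ n, formJ_mul_self, formJ_mul_self⟩, by
    change (formJ n)ᴴ * formJ n * formJ n = formJ n
    rw [formJ_conjTranspose, formJ_mul_self, one_mul]⟩

theorem toMat_reflElt : toMat (reflElt n) = formJ n := rfl

theorem reflElt_mul_ofK (k : KGroup n) : reflElt n * ofK k = ofK k * reflElt n := by
  apply toMat_injective
  rw [toMat_mul, toMat_mul, toMat_ofK, toMat_reflElt, kMat, formJ, Matrix.fromBlocks_multiply,
    Matrix.fromBlocks_multiply]
  simp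

theorem reflElt_mul_self : reflElt n * reflElt n = 1 := by
  apply toMat_injective
  rw [toMat_mul, toMat_reflElt, formJ_mul_self, toMat_one]

theorem reflElt_conj_mul_ofK (x : Spn1 n) (k : KGroup n) :
    reflElt n * (x * ofK k) * reflElt n = reflElt n * x * reflElt n * ofK k := by
  rw [mul_assoc _ (reflElt n), reflElt_mul_ofK]
  simp only [mul_assoc]

/-- The coefficient `Γ(2n) Γ(iλ) / (Γ(a) Γ(b))` of the connection formula; it is
`2^{iλ-ρ} c_ν(λ)`. -/
noncomputable def connCoeff (n ν : ℕ) (lam : ℂ) : ℂ :=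
  Complex.Gamma ((2 * n : ℕ) : ℂ) * Complex.Gamma (Complex.I * lam)
    / (Complex.Gamma ((Complex.I * lam + rho n + ν) / 2)
      * Complex.Gamma ((Complex.I * lam + rho n - ν - 2) / 2))

theorem cFn_eq (ν : ℕ) (lam : ℂ) :
    cFn n ν lam = Complex.exp (Real.log 2 * (rho n - Complex.I * lam)) * connCoeff n ν lam := by
  have h : rho n - 1 = ((2 * n : ℕ) : ℂ) := by rw [rho]; push_cast; ring
  rw [cFn, connCoeff, Complex.cpow_def_of_ne_zero two_ne_zero, h, Complex.ofReal_log zero_le_two]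
  push_cast
  ring

variable [NeZero n]

theorem reflElt_mul_aElt (t : ℝ) : reflElt n * aElt n t = aElt n (-t) * reflElt n := by
  apply toMat_injective
  rw [toMat_mul, toMat_mul, toMat_aElt, toMat_aElt, toMat_reflElt, formJ_mul_aMat]

theorem reflElt_conj_cartan (k₁ k₂ : KGroup n) (t : ℝ) :
    reflElt n * (ofK k₁ * aElt n t * ofK k₂) * reflElt n = ofK k₁ * aElt n (-t) * ofK k₂ := by
  rw [← mul_assoc, ← mul_assoc, reflElt_mul_ofK, mul_assoc (ofK k₁), reflElt_mul_aElt,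
    mul_assoc _ (ofK k₂), ← reflElt_mul_ofK, mul_assoc (ofK k₁), mul_assoc (aElt n (-t)),
    ← mul_assoc (reflElt n), reflElt_mul_self, one_mul, mul_assoc]

/-- The difference of the two entries in the last row of `h` whose sum is `nullEntry h`. -/
noncomputable def oppEntry (h : Spn1 n) : ℍ[ℝ] :=
  toMat h (Sum.inr ()) (Sum.inr ()) - toMat h (Sum.inr ()) (Sum.inl 0)

/-- For `h = g⁻¹ k₁` this is the corner entry of `g⁻¹ x`, `x = k₁ a_t k₂`; its leading part
carries the Iwasawa data of `g⁻¹ k₁`. -/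
theorem cornerEntry_mul_cartan (h : Spn1 n) (k : KGroup n) (t : ℝ) :
    cornerEntry (h * aElt n t * ofK k) = (Real.exp t / 2) •
      ((nullEntry h + Real.exp (-2 * t) • oppEntry h) * (sp1Part k : ℍ[ℝ])) := by
  have h1 : cornerEntry (h * aElt n t) = Real.sinh t • toMat h (Sum.inr ()) (Sum.inl 0)
      + Real.cosh t • toMat h (Sum.inr ()) (Sum.inr ()) := by
    rw [cornerEntry, toMat_mul, toMat_aElt, Matrix.mul_apply, Fintype.sum_sum_type]
    simp [aMat, Quaternion.mul_coe_eq_smul]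
  have e : Real.exp (-t) = Real.exp t * Real.exp (-2 * t) := by
    rw [← Real.exp_add]; congr 1; ring
  have hc : Real.cosh t = Real.exp t / 2 * (1 + Real.exp (-2 * t)) := by
    rw [Real.cosh_eq, e]; ring
  have hs : Real.sinh t = Real.exp t / 2 * (1 - Real.exp (-2 * t)) := by
    rw [Real.sinh_eq, e]; ring
  rw [cornerEntry_mul_ofK, h1, hc, hs, ← smul_mul_assoc, nullEntry_eq, oppEntry]
  congr 1
  module

/-- For `δ > 0` this is a nonzero multiple of the corner entry of `h a_t`, `e^{-2t} = δ`. -/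
theorem nullEntry_add_ne_zero (h : Spn1 n) {δ : ℝ} (hδ : 0 ≤ δ) :
    nullEntry h + δ • oppEntry h ≠ 0 := by
  rcases hδ.eq_or_lt with rfl | hδ
  · simpa using nullEntry_ne_zero h
  · intro h0
    have := cornerEntry_mul_cartan h 1 (-(Real.log δ) / 2)
    rw [show -2 * (-(Real.log δ) / 2) = Real.log δ by ring, Real.exp_log hδ, h0, zero_mul,
      smul_zero] at this
    exact cornerEntry_ne_zero _ this

theorem continuous_nullEntry : Continuous (nullEntry : Spn1 n → ℍ[ℝ]) := by
  rw [show (nullEntry : Spn1 n → ℍ[ℝ]) = _ from funext nullEntry_eq]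
  exact ((continuous_apply_apply _ _).comp continuous_toMat).add
    ((continuous_apply_apply _ _).comp continuous_toMat)

theorem continuous_oppEntry : Continuous (oppEntry : Spn1 n → ℍ[ℝ]) :=
  ((continuous_apply_apply _ _).comp continuous_toMat).sub
    ((continuous_apply_apply _ _).comp continuous_toMat)

/-- The entries `nullEntry h + δ • oppEntry h` for `h = g⁻¹ k`, jointly in `δ ∈ [0, 1]` and `k`. -/
theorem continuous_nullEntry_add (g : Spn1 n) :
    Continuous fun p : unitInterval × KGroup n =>
      nullEntry (g⁻¹ * ofK p.2) + (p.1 : ℝ) • oppEntry (g⁻¹ * ofK p.2) := by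
  have h : Continuous fun p : unitInterval × KGroup n => g⁻¹ * ofK p.2 :=
    continuous_const.mul (continuous_ofK.comp continuous_snd)
  have h1 := continuous_nullEntry.comp h
  have h2 := continuous_oppEntry.comp h
  exact h1.add ((continuous_subtype_val.comp continuous_fst).smul h2)

theorem exists_norm_nullEntry_add_ge (g : Spn1 n) : ∃ c : ℝ, 0 < c ∧ ∀ (k : KGroup n) (δ : ℝ),
    0 ≤ δ → δ ≤ 1 → c ≤ ‖nullEntry (g⁻¹ * ofK k) + δ • oppEntry (g⁻¹ * ofK k)‖ := by
  obtain ⟨f, hf⟩ : ∃ f : unitInterval × KGroup n → ℍ[ℝ], f = fun p =>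
    nullEntry (g⁻¹ * ofK p.2) + (p.1 : ℝ) • oppEntry (g⁻¹ * ofK p.2) := ⟨_, rfl⟩
  have hfc : Continuous f := hf ▸ continuous_nullEntry_add g
  have hf0 : ∀ p, f p ≠ 0 := fun p => by rw [hf]; exact nullEntry_add_ne_zero _ p.1.2.1
  obtain ⟨p, hp⟩ : ∃ p, ∀ q, ‖f p‖ ≤ ‖f q‖ := by
    obtain ⟨p, -, hp⟩ := isCompact_univ.exists_isMinOn Set.univ_nonempty hfc.norm.continuousOn
    exact ⟨p, isMinOn_univ_iff.1 hp⟩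
  refine ⟨‖f p‖, norm_pos_iff.2 (hf0 p), fun k δ h0 h1 => ?_⟩
  have h := hp (⟨δ, h0, h1⟩, k)
  nth_rw 2 [hf] at h
  exact h

/-- The corner entry of `g⁻¹ k a_t` and its leading part, both without the factor `e^t / 2`, give
values of `radTau` that approach each other uniformly in `k`: these are the values at `δ =
e^{-2t}` and at `δ = 0` of a continuous function on the compact space `[0, 1] × K`. -/
theorem IsTau.exists_radTau_sub_le (hτ : IsTau ν τ) (g : Spn1 n) (μ : ℂ) (v : V) {ε : ℝ}
    (hε : 0 < ε) : ∃ T : ℝ, 0 ≤ T ∧ ∀ (k : KGroup n) (t : ℝ), T ≤ t →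
      ‖radTau τ μ (star (nullEntry (g⁻¹ * ofK k) + Real.exp (-2 * t) • oppEntry (g⁻¹ * ofK k))) v
        - radTau τ μ (star (nullEntry (g⁻¹ * ofK k))) v‖ ≤ ε := by
  have := hτ.finiteDimensional
  obtain ⟨F, hF⟩ : ∃ F : C(unitInterval × KGroup n, V), ∀ p, F p = radTau τ μ (star
      (nullEntry (g⁻¹ * ofK p.2) + (p.1 : ℝ) • oppEntry (g⁻¹ * ofK p.2))) v :=
    ⟨⟨_, hτ.continuous_radTau μ (continuous_nullEntry_add g).star
      (fun p => star_ne_zero.2 (nullEntry_add_ne_zero _ p.1.2.1)) v⟩, fun _ => rfl⟩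
  have hproj : Tendsto (fun t : ℝ => Set.projIcc (0 : ℝ) 1 zero_le_one (Real.exp (-2 * t))) atTop
      (𝓝 0) := by
    have h1 : Tendsto (fun t : ℝ => Real.exp (-2 * t)) atTop (𝓝 0) :=
      Real.tendsto_exp_atBot.comp (tendsto_id.const_mul_atTop_of_neg (by norm_num))
    have h2 := (continuous_projIcc (h := zero_le_one (α := ℝ))).tendsto 0
    rw [Set.projIcc_left] at h2
    exact h2.comp h1
  have h3 := (F.curry.continuous.tendsto 0).comp hproj
  obtain ⟨T, hT⟩ := eventually_atTop.1 (Metric.tendsto_nhds.1 h3 ε hε)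
  refine ⟨max T 0, le_max_right _ _, fun k t ht => ?_⟩
  have ht0 : 0 ≤ t := (le_max_right _ _).trans ht
  have h4 := hT t ((le_max_left _ _).trans ht)
  rw [dist_eq_norm] at h4
  have h5 := (ContinuousMap.norm_coe_le_norm _ k).trans h4.le
  have hmem : Real.exp (-2 * t) ∈ Set.Icc (0 : ℝ) 1 :=
    ⟨(Real.exp_pos _).le, Real.exp_le_one_iff.2 (by linarith)⟩
  rw [ContinuousMap.sub_apply, Function.comp_apply, ContinuousMap.curry_apply,
    ContinuousMap.curry_apply, Set.projIcc_of_mem _ hmem, hF, hF] at h5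
  have h0 : ((0 : unitInterval) : ℝ) = 0 := rfl
  simp only [h0, zero_smul, add_zero] at h5
  exact h5

theorem quatSgn_star {q : ℍ[ℝ]} (hq : q ≠ 0) : quatSgn (star q) = (quatSgn q)⁻¹ := by
  have h : star q = ‖q‖ • (((quatSgn q)⁻¹ : Sp1) : ℍ[ℝ]) := by
    conv_lhs => rw [← norm_smul_quatSgn q]
    rw [Sp1_inv_coe]
    ext <;> simp
  rw [h, quatSgn_smul_Sp1 (norm_pos_iff.2 hq)]

theorem IsTau.norm_radTau (hτ : IsTau ν τ) (μ : ℂ) (q : ℍ[ℝ]) (v : V) :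
    ‖radTau τ μ q v‖ = Real.exp (-μ.re * Real.log ‖q‖) * ‖v‖ := by
  rw [radTau_apply, norm_smul, hτ.norm_map, Complex.norm_exp]
  simp

theorem IsTau.norm_radTau_le (hτ : IsTau ν τ) {μ : ℂ} (hμ : 0 ≤ μ.re) {q : ℍ[ℝ]} {t c : ℝ}
    (hc : 0 < c) (hq : Real.exp t / 2 * c ≤ ‖q‖) (v : V) :
    ‖radTau τ μ q v‖ ≤ Real.exp (-μ.re * Real.log (c / 2)) * ‖v‖ * Real.exp (-μ.re * t) := by
  have he := Real.exp_pos t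
  have h1 : t + Real.log (c / 2) ≤ Real.log ‖q‖ := by
    rw [← Real.log_exp t, ← Real.log_mul he.ne' (by positivity)]
    exact Real.log_le_log (by positivity) (by linarith)
  rw [hτ.norm_radTau, mul_right_comm, ← Real.exp_add]
  refine mul_le_mul_of_nonneg_right (Real.exp_le_exp.2 ?_) (norm_nonneg _)
  nlinarith

theorem radTau_star_mul (μ : ℂ) {q : ℍ[ℝ]} (hq : q ≠ 0) (p : Sp1) (v : V) :
    radTau τ μ (star (q * p)) v = τ p⁻¹ (radTau τ μ (star q) v) := by
  rw [star_mul, ← Sp1_inv_coe, radTau_mul_left μ (star_ne_zero.2 hq)]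

theorem radTau_star_smul (μ : ℂ) {q : ℍ[ℝ]} (hq : q ≠ 0) {r : ℝ} (hr : 0 < r) (v : V) :
    radTau τ μ (star (r • q)) v = Complex.exp (-μ * Real.log r) • radTau τ μ (star q) v := by
  rw [← radTau_real_smul μ (star_ne_zero.2 hq) hr]
  congr 2
  ext <;> simp

end Asymptotics

/-! ### Leading term and boundary values -/

section Conclusion

variable {V : Type*} [NormedAddCommGroup V] [InnerProductSpace ℂ V] {ν : ℕ}
  {τ : Representation ℂ Sp1 V} {n : ℕ}

/-- The sum of the two waves `connCoeff (±λ) |q|^{-(ρ ∓ iλ)} τ(q / |q|)⁻¹ v`. At the corner entry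
of `g⁻¹ x` it is the principal part of the spherical function; at the leading part of that entry
it is the asymptotic expansion claimed. -/
noncomputable def leadingTerm (τ : Representation ℂ Sp1 V) (n ν : ℕ) (lam : ℂ) (v : V) (q : ℍ[ℝ]) :
    V :=
  connCoeff n ν lam • radTau τ (rho n - Complex.I * lam) (star q) v
    + connCoeff n ν (-lam) • radTau τ (rho n + Complex.I * lam) (star q) v

theorem leadingTerm_eq (lam : ℂ) (v : V) (q : ℍ[ℝ]) :
    leadingTerm τ n ν lam v q = (connCoeff n ν lam
      * Complex.exp (2 * (Complex.I * lam) * Real.log ‖q‖) + connCoeff n ν (-lam)) •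
      radTau τ (rho n + Complex.I * lam) (star q) v := by
  have h : radTau τ (rho n - Complex.I * lam) (star q) v
      = Complex.exp (2 * (Complex.I * lam) * Real.log ‖q‖) •
        radTau τ (rho n + Complex.I * lam) (star q) v := by
    rw [radTau_apply, radTau_apply, norm_star, smul_smul, ← Complex.exp_add]
    congr 2; ring
  rw [leadingTerm, h, add_smul, mul_smul]

theorem leadingTerm_mul (lam : ℂ) (v : V) {q : ℍ[ℝ]} (hq : q ≠ 0) (p : Sp1) :
    leadingTerm τ n ν lam v (q * p) = τ p⁻¹ (leadingTerm τ n ν lam v q) := by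
  rw [leadingTerm, leadingTerm, radTau_star_mul _ hq, radTau_star_mul _ hq, map_add, map_smul,
    map_smul]

variable [NeZero n]

theorem ne_neg_natCast_of_im {z : ℂ} (hz : z.im ≠ 0) (m : ℕ) : z ≠ -m := fun h => hz (by simp [h])

/-- The hypergeometric factor of the spherical function at radius `arcosh y`. -/
noncomputable def hypRadial (n ν : ℕ) (lam : ℂ) (y : ℝ) : ℂ :=
  hypF ((Complex.I * lam + rho n + ν) / 2) ((Complex.I * lam + rho n - ν - 2) / 2)
    ((2 * n : ℕ) : ℂ) (1 - (y ^ 2)⁻¹)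

/-- The parameters of `hypRadial` satisfy the hypotheses of the results on the hypergeometric
series; all nonvanishing conditions follow from `λ ≠ 0` being real. -/
theorem hyp_parameters (n ν : ℕ) [NeZero n] {lam : ℝ} (hlam : lam ≠ 0) :
    (∀ m : ℕ, (Complex.I * lam + rho n + ν) / 2 ≠ -m) ∧
    (∀ m : ℕ, (Complex.I * lam + rho n - ν - 2) / 2 ≠ -m) ∧ 1 ≤ (((2 * n : ℕ) : ℂ)).re ∧
    (∀ m : ℕ, Complex.I * lam ≠ -m) ∧ (Complex.I * lam).re = 0 ∧
    (Complex.I * lam + rho n + ν) / 2 + (Complex.I * lam + rho n - ν - 2) / 2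
      = ((2 * n : ℕ) : ℂ) + Complex.I * lam := by
  refine ⟨ne_neg_natCast_of_im ?_, ne_neg_natCast_of_im ?_, ?_, ne_neg_natCast_of_im ?_, ?_, ?_⟩
  · simpa [rho] using hlam
  · simpa [rho] using hlam
  · have hn := NeZero.one_le (n := n)
    rw [Complex.natCast_re]
    exact_mod_cast (by omega : 1 ≤ 2 * n)
  · simpa using hlam
  · simp
  · rw [rho]; push_cast; ring

theorem hypRadial_arg_mem {y : ℝ} (hy : 1 ≤ y) : 1 - (y ^ 2)⁻¹ ∈ Set.Ioo (-1 : ℝ) 1 := by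
  have h1 : (y ^ 2)⁻¹ ≤ 1 := inv_le_one_of_one_le₀ (by nlinarith)
  have h2 : 0 < (y ^ 2)⁻¹ := by positivity
  constructor <;> linarith

theorem exists_hypRadial_bound (ν : ℕ) {lam : ℝ} (hlam : lam ≠ 0) :
    ∃ M : ℝ, ∀ y : ℝ, 1 ≤ y → ‖hypRadial n ν lam y‖ ≤ M := by
  obtain ⟨ha, hb, hc, hd, hd0, h⟩ := hyp_parameters n ν hlam
  obtain ⟨M, hM⟩ := exists_hypF_bound ha hb hc hd hd0 h
  exact ⟨M, fun y hy => hM _ (abs_lt.2 (hypRadial_arg_mem hy))⟩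

theorem continuousOn_hypRadial (ν : ℕ) {lam : ℝ} (hlam : lam ≠ 0) :
    ContinuousOn (hypRadial n ν lam) (Set.Ici 1) := by
  obtain ⟨ha, hb, hc, hd, hd0, h⟩ := hyp_parameters n ν hlam
  refine (continuousOn_hypF ha hb hc hd hd0 h).comp (t := Set.Ioo (-1) 1) ?_
    fun y hy => hypRadial_arg_mem hy
  refine continuousOn_const.sub (ContinuousOn.inv₀ (by fun_prop) fun y hy => ?_)
  have : (1 : ℝ) ≤ y := hy
  positivity

/-- The connection formula, as an asymptotic expansion at infinity. -/
theorem tendsto_hypRadial (ν : ℕ) {lam : ℝ} (hlam : lam ≠ 0) :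
    Tendsto (fun y : ℝ => hypRadial n ν lam y - (connCoeff n ν lam
      * Complex.exp (2 * (Complex.I * lam) * Real.log y) + connCoeff n ν (-lam))) atTop (𝓝 0) := by
  obtain ⟨ha, hb, hc, hd, hd0, h⟩ := hyp_parameters n ν hlam
  have hca : ((2 * n : ℕ) : ℂ) - (Complex.I * lam + rho n + ν) / 2
      = (Complex.I * (-lam) + rho n - ν - 2) / 2 := by rw [rho]; push_cast; ring
  have hcb : ((2 * n : ℕ) : ℂ) - (Complex.I * lam + rho n - ν - 2) / 2
      = (Complex.I * (-lam) + rho n + ν) / 2 := by rw [rho]; push_cast; ring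
  have hlim := tendsto_hypF_one ha hb
    (by rw [hca]; exact ne_neg_natCast_of_im (by simpa [rho] using hlam))
    (by rw [hcb]; exact ne_neg_natCast_of_im (by simpa [rho] using hlam)) hc
    (by simpa using hlam) hd0 h
  have hz : Tendsto (fun y : ℝ => 1 - (y ^ 2)⁻¹) atTop (𝓝[<] 1) := by
    refine tendsto_nhdsWithin_iff.2 ⟨?_, ?_⟩
    · have h1 : Tendsto (fun y : ℝ => (y ^ 2)⁻¹) atTop (𝓝 0) :=
        (tendsto_pow_atTop two_ne_zero).inv_tendsto_atTop
      simpa using h1.const_sub 1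
    · filter_upwards [eventually_gt_atTop 0] with y hy
      have : 0 < (y ^ 2)⁻¹ := by positivity
      simp only [Set.mem_Iio]; linarith
  refine (hlim.comp hz).congr' ?_
  filter_upwards [eventually_gt_atTop 0] with y hy
  have e : (1 : ℂ) / (1 - ((1 - (y ^ 2)⁻¹ : ℝ) : ℂ)) ^ (Complex.I * lam)
      = Complex.exp (2 * (Complex.I * lam) * Real.log y) := by
    have h1 : (1 : ℂ) - ((1 - (y ^ 2)⁻¹ : ℝ) : ℂ) = (((y ^ 2)⁻¹ : ℝ) : ℂ) := by push_cast; ring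
    have h2 : (0 : ℝ) < (y ^ 2)⁻¹ := by positivity
    rw [h1, Complex.cpow_def_of_ne_zero (by exact_mod_cast h2.ne'), ← Complex.ofReal_log h2.le,
      Real.log_inv, Real.log_pow, one_div, ← Complex.exp_neg]
    congr 1; push_cast; ring
  rw [Function.comp_apply, e, hca, hcb, hypRadial, connCoeff, connCoeff,
    mul_comm (Complex.Gamma ((Complex.I * (-lam) + rho n + ν) / 2)), mul_neg]

/-- `IsTau.sphericalFn_eq`, with the conjugate of the corner entry absorbing the inverse. -/
theorem IsTau.sphericalFn_eq_radTau (hτ : IsTau ν τ) (hC : HasCartan n) (lam : ℂ) (y : Spn1 n)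
    (v : V) : sphericalFn τ lam y v = hypRadial n ν lam ‖cornerEntry y‖ •
      radTau τ (rho n + Complex.I * lam) (star (cornerEntry y)) v := by
  obtain ⟨h0, k₁, k₂, h⟩ := cartanA_spec (hC y)
  rw [hτ.sphericalFn_eq lam k₁ k₂ h0 h, radTau_apply, norm_star,
    quatSgn_star (cornerEntry_ne_zero y), smul_smul, mul_comm, add_comm (rho n), hypRadial]

/-- One summand of the asymptotic expansion, with the boundary value `f^g_{λ,v}` in terms of the
entry of `g⁻¹ k₁` that determines its Iwasawa components. -/
theorem extK_cFn_fgv (ν : ℕ) (l : ℂ) (g : Spn1 n) (v : V) (k₁ k₂ : KGroup n) (t : ℝ) :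
    extK n τ k₂⁻¹ ((cFn n ν l * Complex.exp ((Complex.I * l - rho n) * t)) • fgv τ l g v k₁)
      = connCoeff n ν l • radTau τ (rho n - Complex.I * l)
        (star ((Real.exp t / 2) • (nullEntry (g⁻¹ * ofK k₁) * (sp1Part k₂ : ℍ[ℝ])))) v := by
  have h0 := nullEntry_ne_zero (g⁻¹ * ofK k₁)
  have he : Real.log (Real.exp t / 2) = t - Real.log 2 := by
    rw [Real.log_div (Real.exp_pos t).ne' two_ne_zero, Real.log_exp]
  have hp : nullEntry (g⁻¹ * ofK k₁) * (sp1Part k₂ : ℍ[ℝ]) ≠ 0 :=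
    mul_ne_zero h0 (norm_ne_zero_iff.1 (by rw [norm_Sp1]; exact one_ne_zero))
  have hf : fgv τ l g v k₁
      = radTau τ (rho n - Complex.I * l) (star (nullEntry (g⁻¹ * ofK k₁))) v := by
    have h1 : sp1Part (iwasawaK (g⁻¹ * ofK k₁))⁻¹ = quatSgn (star (nullEntry (g⁻¹ * ofK k₁))) := by
      rw [quatSgn_star h0, map_inv]
      exact congrArg _ (iwasawaK_snd _)
    rw [fgv, extK_apply, h1, radTau_apply, iwasawaH_eq_log, norm_star, neg_sub]
  rw [radTau_star_smul _ hp (div_pos (Real.exp_pos t) two_pos), radTau_star_mul _ h0, map_smul,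
    extK_apply, map_inv sp1Part, hf, smul_smul, cFn_eq, he]
  congr 1
  rw [mul_right_comm, ← Complex.exp_add, mul_comm]
  congr 2
  push_cast; ring

theorem cartanA_mul_ofK (hC : HasCartan n) (x : Spn1 n) (k : KGroup n) :
    cartanA (x * ofK k) = cartanA x := by
  rw [cartanA_eq_arcosh hC, cartanA_eq_arcosh hC, cornerEntry_mul_ofK, norm_mul, norm_Sp1, mul_one]

/-- For `x = k₁ a_t k₂` with `t > 0` this is the product of `nullEntry (g⁻¹ k₁)` and the
`Sp(1)`-component of `k₂`, expressed through entries that depend continuously on `x`: conjugation by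
`reflElt n` turns `a_t` into `a_{-t}`, and the two corner entries `(e^t P + e^{-t} P') / 2` and
`(e^{-t} P + e^t P') / 2` determine `P`. -/
noncomputable def boundaryEntry (g x : Spn1 n) : ℍ[ℝ] :=
  (2 * Real.sinh (cartanA x))⁻¹ •
    (cornerEntry (g⁻¹ * x) - cornerEntry (g⁻¹ * (reflElt n * x * reflElt n)))
  + (2 * Real.cosh (cartanA x))⁻¹ •
    (cornerEntry (g⁻¹ * x) + cornerEntry (g⁻¹ * (reflElt n * x * reflElt n)))

theorem boundaryEntry_eq (g : Spn1 n) {x : Spn1 n} {k₁ k₂ : KGroup n}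
    (hx : x = ofK k₁ * aElt n (cartanA x) * ofK k₂) (ht : 0 < cartanA x) :
    boundaryEntry g x = nullEntry (g⁻¹ * ofK k₁) * (sp1Part k₂ : ℍ[ℝ]) := by
  set t := cartanA x with htdef
  have h1 : cornerEntry (g⁻¹ * x) = cornerEntry (g⁻¹ * ofK k₁ * aElt n t * ofK k₂) := by
    conv_lhs => rw [hx]
    simp only [mul_assoc]
  have h2 : cornerEntry (g⁻¹ * (reflElt n * x * reflElt n))
      = cornerEntry (g⁻¹ * ofK k₁ * aElt n (-t) * ofK k₂) := by
    conv_lhs => rw [hx]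
    rw [reflElt_conj_cartan]
    simp only [mul_assoc]
  have e1 : Real.exp (-2 * t) = Real.exp (-t) * Real.exp (-t) := by
    rw [← Real.exp_add]; congr 1; ring
  have e2 : Real.exp (-2 * -t) = Real.exp t * Real.exp t := by
    rw [← Real.exp_add]; congr 1; ring
  have e3 : Real.exp t * Real.exp (-t) = 1 := by rw [← Real.exp_add]; simp
  have hlt : Real.exp (-t) < Real.exp t := Real.exp_lt_exp.2 (by linarith)
  have hs : 2 * Real.sinh t = Real.exp t - Real.exp (-t) := by rw [Real.sinh_eq]; ring
  have hc : 2 * Real.cosh t = Real.exp t + Real.exp (-t) := by rw [Real.cosh_eq]; ring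
  have y1 : cornerEntry (g⁻¹ * x)
      = (Real.exp t / 2) • (nullEntry (g⁻¹ * ofK k₁) * (sp1Part k₂ : ℍ[ℝ]))
        + (Real.exp (-t) / 2) • (oppEntry (g⁻¹ * ofK k₁) * (sp1Part k₂ : ℍ[ℝ])) := by
    rw [h1, cornerEntry_mul_cartan, e1, add_mul, smul_mul_assoc, smul_add, smul_smul]
    congr 2
    linear_combination (Real.exp (-t) / 2) * e3
  have y2 : cornerEntry (g⁻¹ * (reflElt n * x * reflElt n))
      = (Real.exp (-t) / 2) • (nullEntry (g⁻¹ * ofK k₁) * (sp1Part k₂ : ℍ[ℝ]))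
        + (Real.exp t / 2) • (oppEntry (g⁻¹ * ofK k₁) * (sp1Part k₂ : ℍ[ℝ])) := by
    rw [h2, cornerEntry_mul_cartan, e2, add_mul, smul_mul_assoc, smul_add, smul_smul]
    congr 2
    linear_combination (Real.exp t / 2) * e3
  have hs0 : Real.exp t - Real.exp (-t) ≠ 0 := by linarith
  have hc0 : Real.exp t + Real.exp (-t) ≠ 0 := by positivity
  rw [boundaryEntry, ← htdef, y1, y2, hs, hc]
  generalize nullEntry (g⁻¹ * ofK k₁) * (sp1Part k₂ : ℍ[ℝ]) = A
  generalize oppEntry (g⁻¹ * ofK k₁) * (sp1Part k₂ : ℍ[ℝ]) = B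
  generalize Real.exp t = u at *
  generalize Real.exp (-t) = w at *
  match_scalars
  · field_simp; ring
  · field_simp; ring

theorem boundaryEntry_mul_ofK (hC : HasCartan n) (g x : Spn1 n) (k : KGroup n) :
    boundaryEntry g (x * ofK k) = boundaryEntry g x * (sp1Part k : ℍ[ℝ]) := by
  rw [boundaryEntry, boundaryEntry, cartanA_mul_ofK hC, reflElt_conj_mul_ofK, ← mul_assoc g⁻¹ x,
    ← mul_assoc g⁻¹ _ (ofK k), cornerEntry_mul_ofK, cornerEntry_mul_ofK]
  simp only [add_mul, sub_mul, smul_mul_assoc]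

theorem continuousOn_boundaryEntry (hC : HasCartan n) (g : Spn1 n) :
    ContinuousOn (boundaryEntry g) {x | 0 < cartanA x} := by
  have hc := continuous_cartanA hC
  have h1 : Continuous fun x : Spn1 n => cornerEntry (g⁻¹ * x) :=
    continuous_cornerEntry.comp (continuous_const.mul continuous_id)
  have h2 : Continuous fun x : Spn1 n => cornerEntry (g⁻¹ * (reflElt n * x * reflElt n)) :=
    continuous_cornerEntry.comp
      (continuous_const.mul ((continuous_const.mul continuous_id).mul continuous_const))
  have h3 : ContinuousOn (fun x => (2 * Real.sinh (cartanA x))⁻¹) {x : Spn1 n | 0 < cartanA x} :=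
    ContinuousOn.inv₀ (continuous_const.mul (Real.continuous_sinh.comp hc)).continuousOn
      fun x hx => mul_ne_zero two_ne_zero (Real.sinh_pos_iff.2 hx).ne'
  have h4 : Continuous fun x : Spn1 n => (2 * Real.cosh (cartanA x))⁻¹ :=
    Continuous.inv₀ (continuous_const.mul (Real.continuous_cosh.comp hc))
      fun x => mul_ne_zero two_ne_zero (Real.cosh_pos _).ne'
  exact (h3.smul (h1.sub h2).continuousOn).add (h4.smul (h1.add h2)).continuousOn

end Conclusion

/-! ### The asymptotic expansion -/

section Main

variable {V : Type*} [NormedAddCommGroup V] [InnerProductSpace ℂ V] {ν : ℕ}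
  {τ : Representation ℂ Sp1 V} {n : ℕ}

theorem rho_add_re (n : ℕ) (lam : ℝ) : (rho n + Complex.I * lam).re = 2 * n + 1 := by
  simp [rho]

theorem rho_sub_re (n : ℕ) (lam : ℝ) : (rho n - Complex.I * lam).re = 2 * n + 1 := by
  simp [rho]

theorem mul_Sp1_ne_zero {q : ℍ[ℝ]} (hq : q ≠ 0) (p : Sp1) : q * (p : ℍ[ℝ]) ≠ 0 :=
  mul_ne_zero hq (norm_ne_zero_iff.1 (by rw [norm_Sp1]; exact one_ne_zero))

theorem IsTau.norm_radTau_star_sub (hτ : IsTau ν τ) (μ : ℂ) {p p' : ℍ[ℝ]} (hp : p ≠ 0)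
    (hp' : p' ≠ 0) (q : Sp1) (t : ℝ) (v : V) :
    ‖radTau τ μ (star ((Real.exp t / 2) • (p * (q : ℍ[ℝ])))) v
      - radTau τ μ (star ((Real.exp t / 2) • (p' * (q : ℍ[ℝ])))) v‖
      = Real.exp (μ.re * Real.log 2) * ‖radTau τ μ (star p) v - radTau τ μ (star p') v‖
        * Real.exp (-μ.re * t) := by
  have hr : 0 < Real.exp t / 2 := by positivity
  have he : Real.log (Real.exp t / 2) = t - Real.log 2 := by
    rw [Real.log_div (Real.exp_pos t).ne' two_ne_zero, Real.log_exp]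
  rw [radTau_star_smul _ (mul_Sp1_ne_zero hp q) hr, radTau_star_smul _ (mul_Sp1_ne_zero hp' q) hr,
    radTau_star_mul _ hp, radTau_star_mul _ hp', ← smul_sub, ← map_sub, norm_smul, hτ.norm_map, he,
    mul_right_comm, ← Real.exp_add, Complex.norm_exp]
  congr 2
  simp only [Complex.mul_re, Complex.neg_re, Complex.ofReal_re, Complex.ofReal_im, mul_zero,
    sub_zero]
  ring

theorem IsTau.norm_leadingTerm_le (hτ : IsTau ν τ) (lam : ℝ) {q : ℍ[ℝ]} {t c : ℝ}
    (hc : 0 < c) (hq : Real.exp t / 2 * c ≤ ‖q‖) (v : V) :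
    ‖leadingTerm τ n ν lam v q‖ ≤ (‖connCoeff n ν lam‖ + ‖connCoeff n ν (-lam)‖) *
      (Real.exp (-(2 * n + 1) * Real.log (c / 2)) * ‖v‖) * Real.exp (-(2 * n + 1) * t) := by
  have hpos : (0 : ℝ) ≤ 2 * n + 1 := by positivity
  have h1 := hτ.norm_radTau_le (μ := rho n - Complex.I * lam) (by rw [rho_sub_re]; exact hpos) hc
    (q := star q) (by rwa [norm_star]) v
  have h2 := hτ.norm_radTau_le (μ := rho n + Complex.I * lam) (by rw [rho_add_re]; exact hpos) hc
    (q := star q) (by rwa [norm_star]) v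
  rw [rho_sub_re] at h1
  rw [rho_add_re] at h2
  rw [leadingTerm]
  refine (norm_add_le _ _).trans ?_
  rw [norm_smul, norm_smul, mul_assoc, add_mul]
  exact add_le_add (mul_le_mul_of_nonneg_left h1 (norm_nonneg _))
    (mul_le_mul_of_nonneg_left h2 (norm_nonneg _))

theorem IsTau.continuous_leadingTerm (hτ : IsTau ν τ) (lam : ℂ) {X : Type*} [TopologicalSpace X]
    {f : X → ℍ[ℝ]} (hf : Continuous f) (h0 : ∀ x, f x ≠ 0) (v : V) :
    Continuous fun x => leadingTerm τ n ν lam v (f x) :=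
  ((hτ.continuous_radTau _ hf.star (fun x => star_ne_zero.2 (h0 x)) v).const_smul _).add
    ((hτ.continuous_radTau _ hf.star (fun x => star_ne_zero.2 (h0 x)) v).const_smul _)

variable [NeZero n]

/-- The corner entry of `g⁻¹ x` for `x = k₁ a_t k₂`. -/
theorem cornerEntry_inv_mul (g : Spn1 n) {x : Spn1 n} {k₁ k₂ : KGroup n} {t : ℝ}
    (hx : x = ofK k₁ * aElt n t * ofK k₂) :
    cornerEntry (g⁻¹ * x) = (Real.exp t / 2) • ((nullEntry (g⁻¹ * ofK k₁)
      + Real.exp (-2 * t) • oppEntry (g⁻¹ * ofK k₁)) * (sp1Part k₂ : ℍ[ℝ])) := by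
  rw [hx, ← cornerEntry_mul_cartan]
  simp only [mul_assoc]

theorem exists_norm_cornerEntry_ge (hC : HasCartan n) (g : Spn1 n) : ∃ c : ℝ, 0 < c ∧
    ∀ x : Spn1 n, Real.exp (cartanA x) / 2 * c ≤ ‖cornerEntry (g⁻¹ * x)‖ := by
  obtain ⟨c, hc0, hc⟩ := exists_norm_nullEntry_add_ge g
  refine ⟨c, hc0, fun x => ?_⟩
  obtain ⟨h0, k₁, k₂, hx⟩ := cartanA_spec (hC x)
  rw [cornerEntry_inv_mul g hx, norm_smul, norm_mul, norm_Sp1, mul_one,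
    Real.norm_of_nonneg (by positivity)]
  exact mul_le_mul_of_nonneg_left
    (hc k₁ _ (Real.exp_pos _).le (Real.exp_le_one_iff.2 (by linarith))) (by positivity)

theorem exists_norm_boundary_ge (g : Spn1 n) : ∃ c : ℝ, 0 < c ∧ ∀ (k₁ k₂ : KGroup n) (t : ℝ),
    Real.exp t / 2 * c
      ≤ ‖(Real.exp t / 2) • (nullEntry (g⁻¹ * ofK k₁) * (sp1Part k₂ : ℍ[ℝ]))‖ := by
  obtain ⟨c, hc0, hc⟩ := exists_norm_nullEntry_add_ge g
  refine ⟨c, hc0, fun k₁ k₂ t => ?_⟩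
  rw [norm_smul, norm_mul, norm_Sp1, mul_one, Real.norm_of_nonneg (by positivity)]
  refine mul_le_mul_of_nonneg_left ?_ (by positivity)
  simpa using hc k₁ 0 le_rfl zero_le_one

theorem IsTau.exists_norm_sphericalFn_le (hτ : IsTau ν τ) (hC : HasCartan n) {lam : ℝ}
    (hlam : lam ≠ 0) (g : Spn1 n) (v : V) : ∃ m : ℝ, ∀ x,
      ‖sphericalFn τ lam (g⁻¹ * x) v‖ ≤ m * Real.exp (-(2 * n + 1) * cartanA x) := by
  obtain ⟨c, hc0, hc⟩ := exists_norm_cornerEntry_ge hC g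
  obtain ⟨M, hM⟩ := exists_hypRadial_bound (n := n) ν hlam
  have hpos : (0 : ℝ) ≤ 2 * n + 1 := by positivity
  refine ⟨M * (Real.exp (-(2 * n + 1) * Real.log (c / 2)) * ‖v‖), fun x => ?_⟩
  have h2 := hτ.norm_radTau_le (μ := rho n + Complex.I * lam) (by rw [rho_add_re]; exact hpos) hc0
    (q := star (cornerEntry (g⁻¹ * x))) (by rw [norm_star]; exact hc x) v
  rw [rho_add_re] at h2
  have h3 := hM _ (one_le_norm_cornerEntry (g⁻¹ * x))
  rw [hτ.sphericalFn_eq_radTau hC, norm_smul, mul_assoc]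
  exact mul_le_mul h3 h2 (norm_nonneg _) ((norm_nonneg _).trans h3)

theorem IsTau.continuous_sphericalFn (hτ : IsTau ν τ) (hC : HasCartan n) {lam : ℝ}
    (hlam : lam ≠ 0) (g : Spn1 n) (v : V) : Continuous fun x => sphericalFn τ lam (g⁻¹ * x) v := by
  have h1 : Continuous fun x : Spn1 n => cornerEntry (g⁻¹ * x) :=
    continuous_cornerEntry.comp (continuous_const.mul continuous_id)
  simp only [hτ.sphericalFn_eq_radTau hC]
  exact ((continuousOn_hypRadial ν hlam).comp_continuous h1.norm
    fun x => one_le_norm_cornerEntry _).smul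
    (hτ.continuous_radTau _ h1.star (fun x => star_ne_zero.2 (cornerEntry_ne_zero _)) v)

theorem IsTau.memBStar_sphericalFn (hτ : IsTau ν τ) (hC : HasCartan n) {lam : ℝ}
    (hlam : lam ≠ 0) (g : Spn1 n) (v : V) :
    MemBStar τ fun x : Spn1 n => sphericalFn τ lam (g⁻¹ * x) v := by
  have := hτ.finiteDimensional
  have := FiniteDimensional.proper ℂ V
  obtain ⟨m, hm⟩ := hτ.exists_norm_sphericalFn_le hC hlam g v
  refine memBStar_of_bound hC (Eventually.of_forall fun x k => ?_)
    (hτ.continuous_sphericalFn hC hlam g v).aestronglyMeasurable hm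
  rw [hτ.sphericalFn_eq_radTau hC, hτ.sphericalFn_eq_radTau hC, ← mul_assoc, cornerEntry_mul_ofK,
    norm_mul, norm_Sp1, mul_one, radTau_star_mul _ (cornerEntry_ne_zero _), extK_apply, map_smul,
    map_inv sp1Part]

/-- The asymptotic expansion belongs to `B*`. Measurability and covariance hold for an arbitrary
choice of `k₁`, `k₂` because the values do not depend on it almost everywhere. -/
theorem IsTau.memBStar_leadingTerm (hτ : IsTau ν τ) (hC : HasCartan n) (lam : ℝ)
    (g : Spn1 n) (v : V) (k₁ k₂ : Spn1 n → KGroup n)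
    (hk : ∀ x, x = ofK (k₁ x) * aElt n (cartanA x) * ofK (k₂ x)) :
    MemBStar τ fun x : Spn1 n => leadingTerm τ n ν lam v
      ((Real.exp (cartanA x) / 2) • (nullEntry (g⁻¹ * ofK (k₁ x)) * (sp1Part (k₂ x) : ℍ[ℝ]))) := by
  have := hτ.finiteDimensional
  have := FiniteDimensional.proper ℂ V
  obtain ⟨c, hc0, hc⟩ := exists_norm_boundary_ge g
  set F : Spn1 n → V := fun x => leadingTerm τ n ν lam v
    ((Real.exp (cartanA x) / 2) • (nullEntry (g⁻¹ * ofK (k₁ x)) * (sp1Part (k₂ x) : ℍ[ℝ]))) with hF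
  -- off the null set `K`, the value does not depend on the choice of `k₁` and `k₂`
  have hF' : ∀ x, 0 < cartanA x → F x = leadingTerm τ n ν lam v
      ((Real.exp (cartanA x) / 2) • boundaryEntry g x) := fun x hx => by
    rw [boundaryEntry_eq g (hk x) hx]
  have hne : ∀ x, 0 < cartanA x → (Real.exp (cartanA x) / 2) • boundaryEntry g x ≠ 0 :=
      fun x hx => by
    rw [boundaryEntry_eq g (hk x) hx]
    exact smul_ne_zero (by positivity) (mul_Sp1_ne_zero (nullEntry_ne_zero _) _)
  have hpos : MeasurableSet {x : Spn1 n | 0 < cartanA x} :=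
    measurableSet_lt measurable_const (continuous_cartanA hC).measurable
  refine memBStar_of_bound hC (m := (‖connCoeff n ν lam‖ + ‖connCoeff n ν (-lam)‖) *
    (Real.exp (-(2 * n + 1) * Real.log (c / 2)) * ‖v‖)) ?_ ?_
    fun x => hτ.norm_leadingTerm_le lam hc0 (hc _ _ _) v
  · filter_upwards [ae_cartanA_pos hC] with x hx k
    rw [hF' _ (by rw [cartanA_mul_ofK hC]; exact hx), hF' x hx, cartanA_mul_ofK hC,
      boundaryEntry_mul_ofK hC, ← smul_mul_assoc, leadingTerm_mul _ _ (hne x hx), extK_apply,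
      map_inv sp1Part]
  · have hcont : ContinuousOn F {x : Spn1 n | 0 < cartanA x} := by
      have h1 : ContinuousOn (fun x : Spn1 n => (Real.exp (cartanA x) / 2) • boundaryEntry g x)
          {x | 0 < cartanA x} :=
        (((Real.continuous_exp.comp (continuous_cartanA hC)).div_const 2).continuousOn).smul
          (continuousOn_boundaryEntry hC g)
      refine ContinuousOn.congr ?_ hF'
      rw [continuousOn_iff_continuous_domRestrict] at h1 ⊢
      exact hτ.continuous_leadingTerm lam h1 (fun x => hne x.1 x.2) v
    have h2 := hcont.aestronglyMeasurable hpos (μ := haarG n)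
    rwa [Measure.restrict_eq_self_of_ae_mem (s := {x : Spn1 n | 0 < cartanA x})
      (ae_cartanA_pos hC)] at h2

/-- The difference of the spherical function and the leading term decays faster than `e^{-ρ t}`,
uniformly in the `K`-components. -/
theorem IsTau.exists_norm_sub_le (hτ : IsTau ν τ) (hC : HasCartan n) {lam : ℝ} (hlam : lam ≠ 0)
    (g : Spn1 n) (v : V) (k₁ k₂ : Spn1 n → KGroup n)
    (hk : ∀ x, x = ofK (k₁ x) * aElt n (cartanA x) * ofK (k₂ x)) {ε : ℝ} (hε : 0 < ε) :
    ∃ T : ℝ, ∀ x : Spn1 n, T ≤ cartanA x → ‖sphericalFn τ lam (g⁻¹ * x) v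
      - leadingTerm τ n ν lam v ((Real.exp (cartanA x) / 2) •
        (nullEntry (g⁻¹ * ofK (k₁ x)) * (sp1Part (k₂ x) : ℍ[ℝ])))‖
      ≤ ε * Real.exp (-(2 * n + 1) * cartanA x) := by
  obtain ⟨c, hc0, hc⟩ := exists_norm_cornerEntry_ge hC g
  have hpos : (0 : ℝ) ≤ 2 * n + 1 := by positivity
  set D := Real.exp (-(2 * n + 1) * Real.log (c / 2)) * ‖v‖ with hD
  set E := Real.exp ((2 * n + 1) * Real.log 2) with hE
  set A := ‖connCoeff n ν lam‖ with hA
  set B := ‖connCoeff n ν (-lam)‖ with hB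
  have hD0 : 0 ≤ D := by positivity
  have hA0 : 0 ≤ A := norm_nonneg _
  have hB0 : 0 ≤ B := norm_nonneg _
  have hE0 : 0 < E := Real.exp_pos _
  -- the shares of `ε` allotted to the remainder of the connection formula and to the two waves
  set ε₁ := ε / (2 * (D + 1)) with hε₁
  set ε₂ := ε / (2 * ((A + B) * E + 1)) with hε₂
  have hp₁ : 0 < ε₁ := by positivity
  have hp₂ : 0 < ε₂ := by positivity
  obtain ⟨Y, hY⟩ := eventually_atTop.1 (Metric.tendsto_nhds.1 (tendsto_hypRadial (n := n) ν hlam)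
    ε₁ hp₁)
  obtain ⟨T₁, hT₁0, hT₁⟩ := hτ.exists_radTau_sub_le g (rho n - Complex.I * lam) v hp₂
  obtain ⟨T₂, hT₂0, hT₂⟩ := hτ.exists_radTau_sub_le g (rho n + Complex.I * lam) v hp₂
  obtain ⟨T₃, hT₃⟩ : ∃ T₃ : ℝ, ∀ t, T₃ ≤ t → Y ≤ Real.exp t / 2 * c := by
    have h : Tendsto (fun t : ℝ => Real.exp t / 2 * c) atTop atTop :=
      (Real.tendsto_exp_atTop.atTop_div_const two_pos).atTop_mul_const hc0
    exact eventually_atTop.1 (h.eventually_ge_atTop Y)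
  refine ⟨max (max T₁ T₂) T₃, fun x hx => ?_⟩
  have hx₁ : T₁ ≤ cartanA x := (le_max_left _ _).trans ((le_max_left _ _).trans hx)
  have hx₂ : T₂ ≤ cartanA x := (le_max_right _ _).trans ((le_max_left _ _).trans hx)
  have hx₃ : T₃ ≤ cartanA x := (le_max_right _ _).trans hx
  set t := cartanA x with ht
  set y := cornerEntry (g⁻¹ * x) with hy
  set p := nullEntry (g⁻¹ * ofK (k₁ x)) with hp
  set q := sp1Part (k₂ x)
  have hyx := cornerEntry_inv_mul g (hk x)
  rw [← hy, ← hp, ← ht] at hyx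
  set p' := p + Real.exp (-2 * t) • oppEntry (g⁻¹ * ofK (k₁ x)) with hp'
  have hp0 : p ≠ 0 := nullEntry_ne_zero _
  have hp'0 : p' ≠ 0 := nullEntry_add_ne_zero _ (Real.exp_pos _).le
  -- the remainder of the connection formula
  have hconn : ‖sphericalFn τ lam (g⁻¹ * x) v - leadingTerm τ n ν lam v y‖
      ≤ ε / 2 * Real.exp (-(2 * n + 1) * t) := by
    have h1 := hY ‖y‖ ((hT₃ t hx₃).trans (hc x))
    rw [dist_zero_right] at h1
    have h2 := hτ.norm_radTau_le (μ := rho n + Complex.I * lam) (by rw [rho_add_re]; exact hpos) hc0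
      (q := star y) (by rw [norm_star]; exact hc x) v
    rw [rho_add_re] at h2
    rw [hτ.sphericalFn_eq_radTau hC, leadingTerm_eq, ← sub_smul, norm_smul]
    calc _ ≤ ε₁ * (D * Real.exp (-(2 * n + 1) * t)) :=
          mul_le_mul h1.le h2 (norm_nonneg _) hp₁.le
      _ = ε₁ * D * Real.exp (-(2 * n + 1) * t) := by ring
      _ ≤ _ := by
        refine mul_le_mul_of_nonneg_right ?_ (Real.exp_pos _).le
        rw [hε₁, div_mul_eq_mul_div, div_le_div_iff₀ (by positivity) two_pos]
        nlinarith
  -- the passage from the corner entry to its leading part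
  have hlead : ‖leadingTerm τ n ν lam v y
      - leadingTerm τ n ν lam v ((Real.exp t / 2) • (p * (q : ℍ[ℝ])))‖
      ≤ ε / 2 * Real.exp (-(2 * n + 1) * t) := by
    have e1 := hτ.norm_radTau_star_sub (rho n - Complex.I * lam) hp'0 hp0 q t v
    have e2 := hτ.norm_radTau_star_sub (rho n + Complex.I * lam) hp'0 hp0 q t v
    rw [← hyx, rho_sub_re] at e1
    rw [← hyx, rho_add_re] at e2
    have b1 := hT₁ (k₁ x) t hx₁
    have b2 := hT₂ (k₁ x) t hx₂
    rw [← hp, ← hp'] at b1 b2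
    have hx0 := Real.exp_pos (-(2 * (n : ℝ) + 1) * t)
    rw [leadingTerm, leadingTerm, add_sub_add_comm, ← smul_sub, ← smul_sub]
    refine (norm_add_le _ _).trans ?_
    rw [norm_smul, norm_smul, e1, e2]
    calc _ ≤ A * (E * ε₂ * Real.exp (-(2 * n + 1) * t))
          + B * (E * ε₂ * Real.exp (-(2 * n + 1) * t)) := by gcongr
      _ = ((A + B) * E) * ε₂ * Real.exp (-(2 * n + 1) * t) := by ring
      _ ≤ _ := by
        refine mul_le_mul_of_nonneg_right ?_ hx0.le
        have hAB : 0 ≤ (A + B) * E := by positivity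
        rw [hε₂, ← mul_div_assoc, div_le_div_iff₀ (by positivity) two_pos]
        nlinarith
  calc _ = ‖(sphericalFn τ lam (g⁻¹ * x) v - leadingTerm τ n ν lam v y)
        + (leadingTerm τ n ν lam v y
          - leadingTerm τ n ν lam v ((Real.exp t / 2) • (p * (q : ℍ[ℝ]))))‖ := by
        rw [sub_add_sub_cancel]
    _ ≤ ε / 2 * Real.exp (-(2 * n + 1) * t) + ε / 2 * Real.exp (-(2 * n + 1) * t) :=
        (norm_add_le _ _).trans (add_le_add hconn hlead)
    _ = _ := by ring

theorem IsTau.asympEq_leadingTerm (hτ : IsTau ν τ) (hC : HasCartan n) {lam : ℝ} (hlam : lam ≠ 0)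
    (g : Spn1 n) (v : V) (k₁ k₂ : Spn1 n → KGroup n)
    (hk : ∀ x, x = ofK (k₁ x) * aElt n (cartanA x) * ofK (k₂ x)) :
    AsympEq (fun x => sphericalFn τ lam (g⁻¹ * x) v)
      (fun x => leadingTerm τ n ν lam v ((Real.exp (cartanA x) / 2) •
        (nullEntry (g⁻¹ * ofK (k₁ x)) * (sp1Part (k₂ x) : ℍ[ℝ])))) := by
  obtain ⟨m, hm⟩ := hτ.exists_norm_sphericalFn_le hC hlam g v
  obtain ⟨c, hc0, hc⟩ := exists_norm_boundary_ge g
  refine asympEq_of_bound hC (m := m + (‖connCoeff n ν lam‖ + ‖connCoeff n ν (-lam)‖) *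
    (Real.exp (-(2 * n + 1) * Real.log (c / 2)) * ‖v‖)) (fun x => (norm_sub_le _ _).trans ?_)
    fun ε hε => hτ.exists_norm_sub_le hC hlam g v k₁ k₂ hk hε
  rw [add_mul]
  exact add_le_add (hm x) (hτ.norm_leadingTerm_le lam hc0 (hc _ _ _) v)

/-- The right-hand side of the asymptotic expansion as a value of `leadingTerm`. -/
theorem extK_sum_eq_leadingTerm (ν : ℕ) (lam : ℂ) (g : Spn1 n) (v : V) (k₁ k₂ : KGroup n)
    (t : ℝ) : extK n τ k₂⁻¹ (∑ s ∈ ({1, -1} : Finset ℤ), (cFn n ν (s * lam) *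
        Complex.exp ((Complex.I * (s * lam) - rho n) * t)) • fgv τ (s * lam) g v k₁)
      = leadingTerm τ n ν lam v
        ((Real.exp t / 2) • (nullEntry (g⁻¹ * ofK k₁) * (sp1Part k₂ : ℍ[ℝ]))) := by
  rw [map_sum, Finset.sum_pair (by decide), extK_cFn_fgv, extK_cFn_fgv, leadingTerm]
  simp only [Int.cast_one, one_mul, Int.cast_neg, neg_mul, mul_neg, sub_neg_eq_add]

end Main

end QHyp

theorem mainTheorem7 (n : ℕ) [NeZero n] (ν : ℕ)
    {V : Type*} [NormedAddCommGroup V] [InnerProductSpace ℂ V]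
    (τ : Representation ℂ QHyp.Sp1 V) (hτ : QHyp.IsTau ν τ)
    (lam : ℝ) (hlam : lam ≠ 0) (g : QHyp.Spn1 n) (v : V)
    (k₁ k₂ : QHyp.Spn1 n → QHyp.KGroup n)
    (hk : ∀ x, x = QHyp.ofK (k₁ x) * QHyp.aElt n (QHyp.cartanA x) * QHyp.ofK (k₂ x)) :
    QHyp.MemBStar τ (fun x : QHyp.Spn1 n => QHyp.sphericalFn τ lam (g⁻¹ * x) v) ∧
    QHyp.MemBStar τ (fun x : QHyp.Spn1 n => QHyp.extK n τ (k₂ x)⁻¹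
      (∑ s ∈ ({1, -1} : Finset ℤ), (QHyp.cFn n ν (s * lam) *
        Complex.exp ((Complex.I * (s * lam) - QHyp.rho n) * QHyp.cartanA x)) •
          QHyp.fgv τ (s * lam) g v (k₁ x))) ∧
    QHyp.AsympEq (fun x : QHyp.Spn1 n => QHyp.sphericalFn τ lam (g⁻¹ * x) v)
      (fun x : QHyp.Spn1 n => QHyp.extK n τ (k₂ x)⁻¹
        (∑ s ∈ ({1, -1} : Finset ℤ), (QHyp.cFn n ν (s * lam) *
          Complex.exp ((Complex.I * (s * lam) - QHyp.rho n) * QHyp.cartanA x)) •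
            QHyp.fgv τ (s * lam) g v (k₁ x))) := by
  have hC : QHyp.HasCartan n := fun x => ⟨k₁ x, k₂ x, QHyp.cartanA x, hk x⟩
  simp only [QHyp.extK_sum_eq_leadingTerm]
  exact ⟨hτ.memBStar_sphericalFn hC hlam g v, hτ.memBStar_leadingTerm hC lam g v k₁ k₂ hk,
    hτ.asympEq_leadingTerm hC hlam g v k₁ k₂ hk⟩
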